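/- **Model.** Let $S$ and $P$ be two qubits and let $E$ consist of $N$ harmonic oscillators with annihilation operators $b_i$, angular frequencies $\omega_i>0$ and real coupling constants $g_i$. Let $\hbar>0$, and let $\rho_E=e^{-\beta H_E}/\mathrm{Tr}\,e^{-\beta H_E}$ be the thermal state of $E$ at inverse temperature $\beta>0$, where $$H_E=\sum_{i=1}^N\hbar\omega_i\bigl(b_i^\dagger b_i+\tfrac12\bigr),\qquad H_{ET}=\sum_{i=1}^N A_T\otimes g_i(b_i+b_i^\dagger).$$ The total Hamiltonian is $H=H_E+H_{ET}$ (neither $S$ nor $P$ has a free evolution and they do not interact directly). Here $A_T=\sum_{i=1}^4\alpha_i|\alpha_i\rangle\langle\alpha_i|$ is Hermitian on $S+P$ with the Bell eigenvectors $|\alpha_{1,2}\rangle=\frac1{\sqrt2}(|11\rangle\pm|22\rangle)$, $|\alpha_{3,4}\rangle=\frac1{\sqrt2}(|12\rangle\pm|21\rangle)$ in orthonormal bases of $S$ and $P$, with respect to which all matrices below are taken. With $X(t)=e^{-iHt/\hbar}$, the state of $S$ is $$\rho_S(t,u)=\mathrm{Tr}_P\mathrm{Tr}_E\bigl(X(t)\,\rho_S\otimes\rho_P(u)\otimes\rho_E\,X(t)^\dagger\bigr),$$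 where the control is the initial state $\rho_P(u)$ of $P$, which may be any density matrix. Let $\mathcal P_S$ be the set of density matrices of $S$, $\mathcal R(\rho_S,t)$ the set of all $\rho_S(t,u)$, $\mathcal R_T(\rho_S)=\bigcup_{0\le t\le T}\mathcal R(\rho_S,t)$ and $\mathcal R(\rho_S)=\bigcup_{T}\mathcal R_T(\rho_S)$. $S$ is *controllable* if $\mathcal R(\rho_S)=\mathcal P_S$ for all $\rho_S\in\mathcal P_S$, and *accessible* if for all $T>0$ and all $\rho_S\in\mathcal P_S$ the set $\mathcal R_T(\rho_S)$ contains a non-empty (relatively) open subset of $\mathcal P_S$. Put $\bar n_i=1/(e^{\beta\hbar\omega_i}-1)$, $$f(t)=\sum_i\Bigl(\tfrac{g_i}{\hbar\omega_i}\Bigr)^2(1+2\bar n_i)(1-\cos\omega_it),\qquad \varphi(t)=\sum_i\Bigl(\tfrac{g_i}{\hbar\omega_i}\Bigr)^2(\omega_it-\sin\omega_it),$$ $\gamma_{ij}(t)=e^{-(\alpha_i-\alpha_j)^2f(t)+i(\alpha_i^2-\alpha_j^2)\varphi(t)}$ and $\gamma_{ij\pm kl}=\gamma_{ij}\pm\gamma_{kl}$.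 For $\vec s_0=(s_x,s_y,s_z)$ in the Bloch ball let $$A(t,\vec s_0)=\tfrac12\,\mathrm{Im}\begin{pmatrix} i\gamma_{13-24}&s_z\gamma_{13-24}&s_y\gamma_{13+24}\\ s_z\gamma_{14-23}&i\gamma_{23-14}&-s_x\gamma_{23+14}\\ -s_y\gamma_{12+34}&s_x\gamma_{34-12}&i\gamma_{12-34}\end{pmatrix},\qquad \vec a(t,\vec s_0)=\tfrac12\,\mathrm{Re}\begin{pmatrix}s_x\gamma_{13+24}\\ s_y\gamma_{23+14}\\ s_z\gamma_{12+34}\end{pmatrix}.$$ **Statement.** Let $\alpha_1=\alpha_2=\alpha_3=0$ and $\alpha_4\ne0$. Suppose that there are a time $\hat t\in\mathbb R$ and integers $k_{2i}$ $(1\le i\le N)$ and $k_1$ with $\omega_i\hat t=2k_{2i}\pi$ for all $i$ and $$\frac1{\alpha_4^2}=\frac2{2k_1+1}\sum_{i=1}^Nk_{2i}\Bigl(\frac{g_i}{\hbar\omega_i}\Bigr)^2 .$$ Then: 1. There is exactly one strongly continuous unitary group $X(t)$ whose generator extends $-iH/\hbar$ on the finite linear combinations of the product number states, so that the model is well defined.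 2. $A(\hat t,\vec s_0)=\mathbb I$ and $\vec a(\hat t,\vec s_0)=\vec 0$ for all $\vec s_0$ in the Bloch ball. 3. At time $\hat t$ the coherence vectors of the states satisfy $\vec s(\hat t,u)=A(\hat t,\vec s_0)\,\vec p(u)+\vec a(\hat t,\vec s_0)$ for all initial states of $S$ and $P$, where $\vec s_0$ and $\vec p(u)$ are the coherence vectors of $\rho_S$ and $\rho_P(u)$. 4. $\mathcal R(\rho_S,\hat t)=\mathcal P_S$ for every $\rho_S\in\mathcal P_S$, that is, the reachable set at $\hat t$ is the whole Bloch ball. 5. $S$ is controllable and accessible. -/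

import Mathlib

open scoped Kronecker ComplexOrder

noncomputable section

namespace EnvControl

/-! ### Reachability, accessibility and controllability

A controlled dynamics assigns to a time `t`, a control `u` and an initial state `ρ` a state
`Φ t u ρ`; `U` is the set of admitted controls and `P` the set of states. -/

section Control

variable {C M : Type*}

/-- The reachable set from `ρ` at time `t`. -/
def reachableAt (Φ : ℝ → C → M → M) (U : Set C) (ρ : M) (t : ℝ) : Set M :=
  {σ | ∃ u ∈ U, σ = Φ t u ρ}

/-- The reachable set from `ρ` until time `T`. -/
def reachableUntil (Φ : ℝ → C → M → M) (U : Set C) (ρ : M) (T : ℝ) : Set M :=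
  ⋃ t ∈ Set.Icc (0 : ℝ) T, reachableAt Φ U ρ t

/-- The reachable set from `ρ`: the limit for `T → ∞` of the increasing family of the reachable
sets until `T`, that is, their union. -/
def reachable (Φ : ℝ → C → M → M) (U : Set C) (ρ : M) : Set M :=
  ⋃ T : ℝ, reachableUntil Φ U ρ T

/-- For every `T > 0` and every initial state, the reachable set until `T` contains a nonempty
(relatively) open subset of the set of states. -/
def IsAccessible [TopologicalSpace M] (P : Set M) (Φ : ℝ → C → M → M) (U : Set C) : Prop :=
  ∀ T : ℝ, 0 < T → ∀ ρ ∈ P, ∃ O : Set M, IsOpen O ∧ (O ∩ P).Nonempty ∧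
    O ∩ P ⊆ reachableUntil Φ U ρ T

/-- From every initial state exactly the states are reachable. -/
def IsControllable (P : Set M) (Φ : ℝ → C → M → M) (U : Set C) : Prop :=
  ∀ ρ ∈ P, reachable Φ U ρ = P

end Control

/-! ### Qubits

Operators on the two-dimensional Hilbert space of `S` (of `P`) are written as matrices in the
orthonormal basis from which the Bell states of `S + P` are formed; the basis of `S + P` is
indexed by `Fin 2 × Fin 2`, with the index of `S` first. -/

/-- The density matrices of a qubit. -/
def densityMatrices : Set (Matrix (Fin 2) (Fin 2) ℂ) :=
  {ρ | ρ.PosSemidef ∧ ρ.trace = 1}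

/-- The Pauli matrices `σ_x, σ_y, σ_z`. -/
def pauli : Fin 3 → Matrix (Fin 2) (Fin 2) ℂ :=
  ![!![0, 1; 1, 0], !![0, -Complex.I; Complex.I, 0], !![1, 0; 0, -1]]

/-- The coherence vector of `ρ`: for a density matrix, the real vector `s` with
`ρ = (1 + s · σ) / 2`. -/
def bloch (ρ : Matrix (Fin 2) (Fin 2) ℂ) : Fin 3 → ℝ :=
  fun k => (ρ * pauli k).trace.re

/-- The closed unit ball of `ℝ³` for the Euclidean norm. -/
def blochBall : Set (Fin 3 → ℝ) := {v | v ⬝ᵥ v ≤ 1}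

/-- The Bell states `(|11⟩ + |22⟩)/√2`, `(|11⟩ - |22⟩)/√2`, `(|12⟩ + |21⟩)/√2`,
`(|12⟩ - |21⟩)/√2`, in this order. -/
def bell : Fin 4 → (Fin 2 × Fin 2 → ℂ) :=
  let e : Fin 2 → Fin 2 → (Fin 2 × Fin 2 → ℂ) := fun k l => Pi.single (k, l) 1
  let c : ℂ := ((1 / √2 : ℝ) : ℂ)
  ![c • (e 0 0 + e 1 1), c • (e 0 0 - e 1 1), c • (e 0 1 + e 1 0), c • (e 0 1 - e 1 0)]

/-- The Hermitian operator `A_T = ∑ i, α i |α_i⟩⟨α_i|` on `S + P` with Bell eigenvectors. -/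
def couplingOp (α : Fin 4 → ℝ) : Matrix (Fin 2 × Fin 2) (Fin 2 × Fin 2) ℂ :=
  ∑ i, (α i : ℂ) • Matrix.vecMulVec (bell i) (star (bell i))

/-! ### The system, the probe and the oscillators of the environment

An orthonormal basis of the Hilbert space of `S + P + E` is given by the vectors `|j, n⟩`, where
`j` labels the basis of `S + P` and `n : Fin N → ℕ` the occupation numbers of the `N`
oscillators. -/

/-- The labels of the basis vectors `|j, n⟩`. -/
abbrev Label (N : ℕ) : Type := (Fin 2 × Fin 2) × (Fin N → ℕ)

/-- The Hilbert space of `S + P + E`. -/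
abbrev TotalSpace (N : ℕ) : Type := lp (fun _ : Label N => ℂ) 2

/-- The finite linear combinations of the basis vectors, the domain of the Hamiltonian. -/
abbrev FiniteVec (N : ℕ) : Type := Label N →₀ ℂ

/-- The vector `|x⟩` of the orthonormal basis. -/
def ket {N : ℕ} (x : Label N) : TotalSpace N := lp.single 2 x (1 : ℂ)

/-- The inclusion of the finite linear combinations in the Hilbert space. -/
def incl {N : ℕ} : FiniteVec N →ₗ[ℂ] TotalSpace N := Finsupp.linearCombination ℂ ket

/-- The annihilation operator `b_i |j, n⟩ = √(n_i) |j, n - e_i⟩`. -/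
def annihilation {N : ℕ} (i : Fin N) : FiniteVec N →ₗ[ℂ] FiniteVec N :=
  Finsupp.linearCombination ℂ fun x =>
    Finsupp.single (x.1, Function.update x.2 i (x.2 i - 1)) ((√(x.2 i : ℝ) : ℝ) : ℂ)

/-- The creation operator `b_i† |j, n⟩ = √(n_i + 1) |j, n + e_i⟩`. -/
def creation {N : ℕ} (i : Fin N) : FiniteVec N →ₗ[ℂ] FiniteVec N :=
  Finsupp.linearCombination ℂ fun x =>
    Finsupp.single (x.1, Function.update x.2 i (x.2 i + 1)) ((√((x.2 i : ℝ) + 1) : ℝ) : ℂ)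

/-- The operator `B ⊗ 1` for an operator `B` on `S + P`. -/
def actT {N : ℕ} (B : Matrix (Fin 2 × Fin 2) (Fin 2 × Fin 2) ℂ) :
    FiniteVec N →ₗ[ℂ] FiniteVec N :=
  Finsupp.linearCombination ℂ fun x => ∑ j, Finsupp.single (j, x.2) (B j x.1)

/-- `H_E = ∑ i, ħ ω_i (b_i† b_i + 1/2)`. -/
def hamiltonianE {N : ℕ} (hbar : ℝ) (ω : Fin N → ℝ) : FiniteVec N →ₗ[ℂ] FiniteVec N :=
  ∑ i, ((hbar * ω i : ℝ) : ℂ) •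
    (creation i ∘ₗ annihilation i + (1 / 2 : ℂ) • LinearMap.id)

/-- `H_ET = ∑ i, A_T ⊗ g_i (b_i + b_i†)`. -/
def hamiltonianET {N : ℕ} (g : Fin N → ℝ) (B : Matrix (Fin 2 × Fin 2) (Fin 2 × Fin 2) ℂ) :
    FiniteVec N →ₗ[ℂ] FiniteVec N :=
  ∑ i, actT B ∘ₗ ((g i : ℂ) • (annihilation i + creation i))

/-- The Hamiltonian `H_E + H_ET` of `S + P + E`; neither `S + P` by itself nor the pair `S`, `P`
contributes to it. -/
def hamiltonian {N : ℕ} (hbar : ℝ) (ω g : Fin N → ℝ)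
    (B : Matrix (Fin 2 × Fin 2) (Fin 2 × Fin 2) ℂ) : FiniteVec N →ₗ[ℂ] FiniteVec N :=
  hamiltonianE hbar ω + hamiltonianET g B

/-- `X t = exp (-i H t / ħ)`: a strongly continuous unitary group whose generator extends
`-i H / ħ` on the finite linear combinations of the basis vectors. -/
structure IsPropagator {N : ℕ} (hbar : ℝ) (H : FiniteVec N →ₗ[ℂ] FiniteVec N)
    (X : ℝ → TotalSpace N →L[ℂ] TotalSpace N) : Prop where
  mem_unitary : ∀ t, X t ∈ unitary (TotalSpace N →L[ℂ] TotalSpace N)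
  map_zero : X 0 = 1
  map_add : ∀ s t, X (s + t) = X s * X t
  continuous : ∀ ψ, Continuous fun t => X t ψ
  hasDerivAt : ∀ v : FiniteVec N,
    HasDerivAt (fun t => X t (incl v)) ((-Complex.I / (hbar : ℂ)) • incl (H v)) 0

/-- The energy of the oscillators in the state with occupation numbers `n`. -/
def energy {N : ℕ} (hbar : ℝ) (ω : Fin N → ℝ) (n : Fin N → ℕ) : ℝ :=
  ∑ i, hbar * ω i * ((n i : ℝ) + 1 / 2)

/-- The weight of `|n⟩⟨n|` in the thermal state `ρ_E = exp (-β H_E) / Tr exp (-β H_E)`. -/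
def thermalWeight {N : ℕ} (hbar β : ℝ) (ω : Fin N → ℝ) (n : Fin N → ℕ) : ℝ :=
  Real.exp (-β * energy hbar ω n) / ∑' m, Real.exp (-β * energy hbar ω m)

/-- The matrix element `⟨x| X(t) (R ⊗ ρ_E) X(t)† |y⟩` of the evolved state of `S + P + E`, where
`R` is the initial state of `S + P` and `ρ_E` the thermal state. -/
def evolvedElement {N : ℕ} (hbar β : ℝ) (ω : Fin N → ℝ)
    (X : ℝ → TotalSpace N →L[ℂ] TotalSpace N) (t : ℝ)
    (R : Matrix (Fin 2 × Fin 2) (Fin 2 × Fin 2) ℂ) (x y : Label N) : ℂ :=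
  ∑' n, (thermalWeight hbar β ω n : ℂ) *
    ∑ j, ∑ k, R j k * inner ℂ (ket x) (X t (ket (j, n))) *
      star (inner ℂ (ket y) (X t (ket (k, n))))

/-- `ρ_S(t, u) = Tr_P Tr_E (X(t) (ρ_S ⊗ ρ_P ⊗ ρ_E) X(t)†)`, with the initial state `ρ_P` of the
probe as the control. -/
def reducedState {N : ℕ} (hbar β : ℝ) (ω : Fin N → ℝ)
    (X : ℝ → TotalSpace N →L[ℂ] TotalSpace N) (t : ℝ)
    (ρP ρS : Matrix (Fin 2) (Fin 2) ℂ) : Matrix (Fin 2) (Fin 2) ℂ :=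
  Matrix.of fun a b => ∑ p, ∑' m, evolvedElement hbar β ω X t (ρS ⊗ₖ ρP) ((a, p), m) ((b, p), m)

/-! ### The coherence vector representation of the dynamics -/

/-- The average thermal occupation number of an oscillator of angular frequency `w`. -/
def occupation (hbar β w : ℝ) : ℝ := 1 / (Real.exp (β * (hbar * w)) - 1)

def dampingF {N : ℕ} (hbar β : ℝ) (ω g : Fin N → ℝ) (t : ℝ) : ℝ :=
  ∑ i, (g i / (hbar * ω i)) ^ 2 * (1 + 2 * occupation hbar β (ω i)) * (1 - Real.cos (ω i * t))

def phasePhi {N : ℕ} (hbar : ℝ) (ω g : Fin N → ℝ) (t : ℝ) : ℝ :=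
  ∑ i, (g i / (hbar * ω i)) ^ 2 * (ω i * t - Real.sin (ω i * t))

/-- `γ_ij(t) = exp (-(α_i - α_j)² f(t) + i (α_i² - α_j²) φ(t))`. -/
def gam {N : ℕ} (hbar β : ℝ) (ω g : Fin N → ℝ) (α : Fin 4 → ℝ) (t : ℝ) (i j : Fin 4) : ℂ :=
  Complex.exp (((-(α i - α j) ^ 2 * dampingF hbar β ω g t : ℝ) : ℂ) +
    Complex.I * (((α i ^ 2 - α j ^ 2) * phasePhi hbar ω g t : ℝ) : ℂ))

/-- The matrix `A(t, s)` of the dynamics `s(t, u) = A(t, s) p(u) + a(t, s)` of the coherence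
vector. The Bell states are numbered from `0`, so that `G 0 2` is `γ_13(t)`, and so on. -/
def blochA {N : ℕ} (hbar β : ℝ) (ω g : Fin N → ℝ) (α : Fin 4 → ℝ) (t : ℝ) (s : Fin 3 → ℝ) :
    Matrix (Fin 3) (Fin 3) ℝ :=
  let G := gam hbar β ω g α t
  let sx : ℂ := s 0
  let sy : ℂ := s 1
  let sz : ℂ := s 2
  let I := Complex.I
  (1 / 2 : ℝ) • Matrix.map
    !![I * (G 0 2 - G 1 3), sz * (G 0 2 - G 1 3), sy * (G 0 2 + G 1 3);
       sz * (G 0 3 - G 1 2), I * (G 1 2 - G 0 3), -sx * (G 1 2 + G 0 3);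
       -sy * (G 0 1 + G 2 3), sx * (G 2 3 - G 0 1), I * (G 0 1 - G 2 3)]
    Complex.im

/-- The vector `a(t, s)` of the dynamics `s(t, u) = A(t, s) p(u) + a(t, s)` of the coherence
vector. -/
def blochShift {N : ℕ} (hbar β : ℝ) (ω g : Fin N → ℝ) (α : Fin 4 → ℝ) (t : ℝ) (s : Fin 3 → ℝ) :
    Fin 3 → ℝ :=
  let G := gam hbar β ω g α t
  ![1 / 2 * (s 0 * (G 0 2 + G 1 3)).re,
    1 / 2 * (s 1 * (G 1 2 + G 0 3)).re,
    1 / 2 * (s 2 * (G 0 1 + G 2 3)).re]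

end EnvControl

end

noncomputable section

namespace EnvControl

open Filter Topology

variable {N : ℕ}

/-! ### Finite vectors -/

/-! Only the singlet |α₄⟩ couples to the oscillators, so with Q the singlet projector H = H_E + α₄ Q
⊗ Σ g_i (b_i + b_i†). Off the singlet the oscillators run freely and number states acquire phases.
On the singlet every oscillator is driven by a constant force: with μ_i = α₄ g_i / ħ, an exponential
vector exp(Σ z_i b_i†)|0⟩ stays one up to a scalar, and z_i rotates about -μ_i / ω_i
(`apply_expVec`). If ω_i t̂ is a multiple of 2π for all i, these circles close and the propagator is
a scalar on each eigenspace of the coupling (`apply_prodKet_of_period`). The two scalars differ by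
exp(i Σ μ_i² t̂ / ω_i), and the condition on α₄ makes this exponent an odd multiple of iπ
(`sum_phase_eq`). Hence X(t̂) is a phase times (1 - Q) - Q, which is the swap of S and P: the state
of the probe is written onto S, so every state is reached at t̂.

At a general time the thermal state enters only through one complex number γ(t) = r + i d with |γ| ≤
1, the `coherence`: ρ_S(t) = (1+r)/2 ρ_S + (1-r)/2 ρ_P + (i d/2)[ρ_P, ρ_S] (`reducedState_eq`). For
coherence vectors this is affine in p, with a linear part that is invertible when r < 1
(`det_flowMatrix`), and it preserves the ball (`flow_mem`). Accessibility thus needs r < 1 at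
arbitrarily small times. If r = 1 on all of [0, T], the singlet with the oscillator vacuum would
evolve only by a phase, but its derivative at 0 has a component with one quantum in any mode with
g_i ≠ 0 (`exists_coherence_re_lt_one`).

Existence of the propagator rests on analytic vectors: H raises the total occupation number by at
most one and has norm O(k) in degree k. Exponentials of bounded truncations therefore converge on
finite vectors for small times, and unitarity extends this to all vectors and times
(`exists_isPropagator`). Uniqueness follows because any propagator moves exponential vectors by the
same explicit formula, and these vectors are total (`apply_prodKet_eq_zero`). -/

theorem ket_apply (x y : Label N) : (ket x : Label N → ℂ) y = if y = x then 1 else 0 := by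
  simp [ket, lp.single_apply, Pi.single_apply]

@[simp]
theorem incl_single (x : Label N) (c : ℂ) : incl (Finsupp.single x c) = c • ket x := by
  simp [incl]

@[simp]
theorem incl_apply (v : FiniteVec N) (x : Label N) : (incl v : Label N → ℂ) x = v x := by
  induction v using Finsupp.induction_linear with
  | zero => simp
  | add v w hv hw => simp [hv, hw]
  | single y c => simp [ket_apply, Finsupp.single_apply, eq_comm]

theorem inner_ket_left (x : Label N) (ψ : TotalSpace N) : inner ℂ (ket x) ψ = ψ x := by
  rw [ket, lp.inner_single_left]; simp

theorem inner_incl_incl (v w : FiniteVec N) :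
    inner ℂ (incl v) (incl w) = v.sum fun x c => star c * w x := by
  induction v using Finsupp.induction_linear with
  | zero => simp
  | add v v' hv hv' =>
    rw [Finsupp.sum_add_index' (by simp) (by intros; simp [add_mul]), map_add, inner_add_left, hv,
      hv']
  | single y c => simp [inner_ket_left, mul_comm]

theorem denseRange_incl : DenseRange (incl (N := N)) := by
  intro ψ
  have h := lp.hasSum_single (p := 2) (by norm_num) ψ
  refine mem_closure_of_tendsto h (Eventually.of_forall fun s => ?_)
  refine ⟨∑ x ∈ s, Finsupp.single x (ψ x), ?_⟩
  rw [map_sum]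
  refine Finset.sum_congr rfl fun x _ => ?_
  rw [incl_single, ket, ← lp.single_smul, smul_eq_mul, mul_one]

theorem clm_ext {F : Type*} [NormedAddCommGroup F] [NormedSpace ℂ F]
    {S T : TotalSpace N →L[ℂ] F} (h : ∀ v, S (incl v) = T (incl v)) : S = T := by
  ext1 ψ
  exact congrFun (denseRange_incl.equalizer S.continuous T.continuous (funext h)) ψ

/-- Bilinear extension of an identity between basis vectors. -/
theorem inner_map_eq_of_single (S T : FiniteVec N →ₗ[ℂ] FiniteVec N)
    (h : ∀ x y, inner ℂ (incl (S (Finsupp.single x 1))) (ket y) =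
      inner ℂ (ket x) (incl (T (Finsupp.single y 1)))) (v w : FiniteVec N) :
    inner ℂ (incl (S v)) (incl w) = inner ℂ (incl v) (incl (T w)) := by
  induction v using Finsupp.induction_linear with
  | zero => simp
  | add v v' hv hv' => simp only [map_add, inner_add_left, hv, hv']
  | single x c =>
    induction w using Finsupp.induction_linear with
    | zero => simp
    | add w w' hw hw' => simp only [map_add, inner_add_right, hw, hw']
    | single y d =>
      have hx : Finsupp.single x c = c • Finsupp.single x (1 : ℂ) := by simp
      have hy : Finsupp.single y d = d • Finsupp.single y (1 : ℂ) := by simp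
      rw [hx, hy]
      simp only [map_smul, inner_smul_left, inner_smul_right, incl_single, one_smul, h]

/-! ### Creation and annihilation operators -/

theorem creation_single (i : Fin N) (x : Label N) (c : ℂ) :
    creation i (Finsupp.single x c) =
      Finsupp.single (x.1, Function.update x.2 i (x.2 i + 1))
        (c * ((√((x.2 i : ℝ) + 1) : ℝ) : ℂ)) := by
  simp [creation]

theorem annihilation_single (i : Fin N) (x : Label N) (c : ℂ) :
    annihilation i (Finsupp.single x c) =
      Finsupp.single (x.1, Function.update x.2 i (x.2 i - 1))
        (c * ((√(x.2 i : ℝ) : ℝ) : ℂ)) := by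
  simp [annihilation]

theorem actT_single (B : Matrix (Fin 2 × Fin 2) (Fin 2 × Fin 2) ℂ) (x : Label N) (c : ℂ) :
    actT B (Finsupp.single x c) = ∑ j, Finsupp.single (j, x.2) (c * B j x.1) := by
  simp [actT, Finset.smul_sum]

theorem update_succ_eq_iff {n m : Fin N → ℕ} {i : Fin N} (hm : m i ≠ 0) :
    Function.update n i (n i + 1) = m ↔ n = Function.update m i (m i - 1) := by
  constructor
  · rintro rfl; simp
  · rintro rfl
    simp [Nat.sub_add_cancel (Nat.pos_of_ne_zero hm)]

theorem inner_creation_left (i : Fin N) (v w : FiniteVec N) :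
    inner ℂ (incl (creation i v)) (incl w) = inner ℂ (incl v) (incl (annihilation i w)) := by
  refine inner_map_eq_of_single _ _ (fun x y => ?_) v w
  rw [creation_single, annihilation_single, incl_single, incl_single, inner_smul_left,
    inner_smul_right, inner_ket_left, inner_ket_left, ket_apply, ket_apply]
  obtain ⟨j, n⟩ := x
  obtain ⟨k, m⟩ := y
  -- For `m i = 0` the truncated subtraction in the annihilation operator is harmless: its
  -- coefficient √0 vanishes, and no raised label has occupation number 0 at i.
  by_cases hm : m i = 0
  · have : (j, Function.update n i (n i + 1)) ≠ (k, m) := by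
      intro h
      have := congrFun (Prod.ext_iff.1 h).2 i
      simp [hm] at this
    simp [this, hm]
  · by_cases h : j = k ∧ Function.update n i (n i + 1) = m
    · obtain ⟨rfl, rfl⟩ := h
      simp
    · have h' : ¬(j = k ∧ n = Function.update m i (m i - 1)) := by
        rwa [← update_succ_eq_iff hm]
      simp only [Prod.mk.injEq, h, h', if_false, mul_zero]

theorem inner_annihilation_left (i : Fin N) (v w : FiniteVec N) :
    inner ℂ (incl (annihilation i v)) (incl w) = inner ℂ (incl v) (incl (creation i w)) := by
  rw [← inner_conj_symm, ← inner_creation_left, inner_conj_symm]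

theorem inner_actT_left (B : Matrix (Fin 2 × Fin 2) (Fin 2 × Fin 2) ℂ) (v w : FiniteVec N) :
    inner ℂ (incl (actT B v)) (incl w) =
      inner ℂ (incl v) (incl (actT B.conjTranspose w)) := by
  refine inner_map_eq_of_single _ _ (fun x y => ?_) v w
  obtain ⟨j, n⟩ := x
  obtain ⟨k, m⟩ := y
  rw [actT_single, actT_single, inner_ket_left, incl_apply, ← inner_conj_symm, inner_ket_left,
    incl_apply]
  by_cases h : n = m <;>
    simp [Finsupp.finsetSum_apply, Finsupp.single_apply, h, eq_comm (a := m)]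

theorem annihilation_creation_single (i j : Fin N) (x : Label N) (c : ℂ) :
    annihilation i (creation j (Finsupp.single x c)) =
      creation j (annihilation i (Finsupp.single x c)) +
        (if i = j then (1 : ℂ) else 0) • Finsupp.single x c := by
  obtain ⟨k, n⟩ := x
  simp only [creation_single, annihilation_single]
  by_cases h : i = j
  · subst h
    rcases hn : n i with - | m
    · simp
      rw [← hn, Function.update_eq_self]
    · have h1 : (((√((m : ℝ) + 1) : ℝ) : ℂ)) * ((√((m : ℝ) + 1) : ℝ) : ℂ) = (m + 1 : ℂ) := by
        rw [← Complex.ofReal_mul, Real.mul_self_sqrt (by positivity)]; simp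
      have h2 : (((√((m : ℝ) + 1 + 1) : ℝ) : ℂ)) * ((√((m : ℝ) + 1 + 1) : ℝ) : ℂ) =
          (m + 1 + 1 : ℂ) := by
        rw [← Complex.ofReal_mul, Real.mul_self_sqrt (by positivity)]; simp
      simp only [Function.update_self, Function.update_idem, Nat.add_sub_cancel, Nat.cast_add,
        Nat.cast_one, mul_assoc, if_true, one_smul]
      rw [h1, h2]
      have : Function.update n i (m + 1) = n := by rw [← hn, Function.update_eq_self]
      rw [this, ← Finsupp.single_add]
      congr 1
      ring
  · have h' : j ≠ i := fun e => h e.symm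
    simp only [h, if_false, zero_smul, add_zero]
    rw [Function.update_of_ne h', Function.update_of_ne h, Function.update_comm h]
    congr 1
    ring

/-- The canonical commutation relations. -/
theorem annihilation_creation (i j : Fin N) (v : FiniteVec N) :
    annihilation i (creation j v) =
      creation j (annihilation i v) + (if i = j then (1 : ℂ) else 0) • v := by
  induction v using Finsupp.induction_linear with
  | zero => simp
  | add v w hv hw => simp only [map_add, hv, hw, smul_add]; abel
  | single x c => exact annihilation_creation_single i j x c

theorem creation_creation (i j : Fin N) (v : FiniteVec N) :
    creation i (creation j v) = creation j (creation i v) := by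
  induction v using Finsupp.induction_linear with
  | zero => simp
  | add v w hv hw => simp only [map_add, hv, hw]
  | single x c =>
    by_cases h : i = j
    · rw [h]
    · have h' : j ≠ i := fun e => h e.symm
      simp only [creation_single]
      rw [Function.update_of_ne h', Function.update_of_ne h, Function.update_comm h]
      congr 1
      ring

theorem creation_annihilation_single (i : Fin N) (x : Label N) (c : ℂ) :
    creation i (annihilation i (Finsupp.single x c)) = Finsupp.single x (c * (x.2 i : ℂ)) := by
  obtain ⟨k, n⟩ := x
  simp only [creation_single, annihilation_single]
  rcases hn : n i with - | m
  · simp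
  · have h1 : (((√((m : ℝ) + 1) : ℝ) : ℂ)) * ((√((m : ℝ) + 1) : ℝ) : ℂ) = (m + 1 : ℂ) := by
      rw [← Complex.ofReal_mul, Real.mul_self_sqrt (by positivity)]; simp
    have : Function.update n i (m + 1) = n := by rw [← hn, Function.update_eq_self]
    simp [mul_assoc, h1, this]

theorem actT_creation (B : Matrix (Fin 2 × Fin 2) (Fin 2 × Fin 2) ℂ) (i : Fin N)
    (v : FiniteVec N) : actT B (creation i v) = creation i (actT B v) := by
  induction v using Finsupp.induction_linear with
  | zero => simp
  | add v w hv hw => simp only [map_add, hv, hw]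
  | single x c => simp only [creation_single, actT_single, map_sum, mul_right_comm]

theorem actT_annihilation (B : Matrix (Fin 2 × Fin 2) (Fin 2 × Fin 2) ℂ) (i : Fin N)
    (v : FiniteVec N) : actT B (annihilation i v) = annihilation i (actT B v) := by
  induction v using Finsupp.induction_linear with
  | zero => simp
  | add v w hv hw => simp only [map_add, hv, hw]
  | single x c => simp only [annihilation_single, actT_single, map_sum, mul_right_comm]

theorem actT_actT (B C : Matrix (Fin 2 × Fin 2) (Fin 2 × Fin 2) ℂ) (v : FiniteVec N) :
    actT B (actT C v) = actT (B * C) v := by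
  induction v using Finsupp.induction_linear with
  | zero => simp
  | add v w hv hw => simp only [map_add, hv, hw]
  | single x c =>
    simp only [actT_single, map_sum, Matrix.mul_apply, Finset.mul_sum]
    rw [Finset.sum_comm]
    refine Finset.sum_congr rfl fun j _ => ?_
    rw [← Finsupp.single_finsetSum]
    congr 1
    exact Finset.sum_congr rfl fun k _ => by ring

theorem actT_smul (a : ℂ) (B : Matrix (Fin 2 × Fin 2) (Fin 2 × Fin 2) ℂ) (v : FiniteVec N) :
    actT (a • B) v = a • actT B v := by
  induction v using Finsupp.induction_linear with
  | zero => simp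
  | add v w hv hw => simp only [map_add, hv, hw, smul_add]
  | single x c =>
    simp only [actT_single, Finset.smul_sum, mul_left_comm, Matrix.smul_apply, smul_eq_mul,
      Finsupp.smul_single]

/-! ### The filtration by the total occupation number -/

/-- The finite linear combinations of basis vectors with total occupation number at most `k`. -/
def degreeLE (N k : ℕ) : Submodule ℂ (FiniteVec N) :=
  Finsupp.supported ℂ ℂ {x | ∑ i, x.2 i ≤ k}

theorem single_mem_degreeLE {k : ℕ} {x : Label N} (hx : ∑ i, x.2 i ≤ k) (c : ℂ) :
    Finsupp.single x c ∈ degreeLE N k :=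
  Finsupp.single_mem_supported ℂ c hx

theorem degreeLE_mono {k l : ℕ} (h : k ≤ l) : degreeLE N k ≤ degreeLE N l :=
  Finsupp.supported_mono fun _ hx => le_trans hx h

theorem exists_mem_degreeLE (v : FiniteVec N) : ∃ k, v ∈ degreeLE N k := by
  induction v using Finsupp.induction_linear with
  | zero => exact ⟨0, zero_mem _⟩
  | add v w hv hw =>
    obtain ⟨k, hk⟩ := hv
    obtain ⟨l, hl⟩ := hw
    exact ⟨max k l, add_mem (degreeLE_mono (le_max_left _ _) hk)
      (degreeLE_mono (le_max_right _ _) hl)⟩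
  | single x c => exact ⟨_, single_mem_degreeLE le_rfl c⟩

/-- A linear map sends `degreeLE N k` into a submodule if it does so with the basis vectors. -/
theorem map_mem_of_degreeLE {k : ℕ} {T : FiniteVec N →ₗ[ℂ] FiniteVec N}
    {W : Submodule ℂ (FiniteVec N)}
    (h : ∀ x : Label N, ∑ i, x.2 i ≤ k → T (Finsupp.single x 1) ∈ W) {v : FiniteVec N}
    (hv : v ∈ degreeLE N k) : T v ∈ W := by
  rw [degreeLE, Finsupp.supported_eq_span_single] at hv
  induction hv using Submodule.span_induction with
  | mem y hy => obtain ⟨x, hx, rfl⟩ := hy; exact h x hx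
  | zero => simp
  | add y z _ _ hy hz => rw [map_add]; exact add_mem hy hz
  | smul a y _ hy => rw [map_smul]; exact Submodule.smul_mem _ _ hy

theorem sum_update (n : Fin N → ℕ) (i : Fin N) (m : ℕ) :
    ∑ j, Function.update n i m j + n i = ∑ j, n j + m := by
  rw [Finset.sum_update_of_mem (Finset.mem_univ i), ← Finset.sum_erase_add _ _ (Finset.mem_univ i),
    Finset.sdiff_singleton_eq_erase]
  ring

theorem creation_mem_degreeLE (i : Fin N) {k : ℕ} {v : FiniteVec N} (hv : v ∈ degreeLE N k) :
    creation i v ∈ degreeLE N (k + 1) := by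
  refine map_mem_of_degreeLE (fun x hx => ?_) hv
  rw [creation_single]
  refine single_mem_degreeLE ?_ _
  have := sum_update x.2 i (x.2 i + 1)
  simp only at this ⊢
  omega

theorem annihilation_mem_degreeLE (i : Fin N) {k : ℕ} {v : FiniteVec N} (hv : v ∈ degreeLE N k) :
    annihilation i v ∈ degreeLE N k := by
  refine map_mem_of_degreeLE (fun x hx => ?_) hv
  rw [annihilation_single]
  refine single_mem_degreeLE ?_ _
  have := sum_update x.2 i (x.2 i - 1)
  simp only at this ⊢
  omega

theorem actT_mem_degreeLE (B : Matrix (Fin 2 × Fin 2) (Fin 2 × Fin 2) ℂ) {k : ℕ}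
    {v : FiniteVec N} (hv : v ∈ degreeLE N k) : actT B v ∈ degreeLE N k := by
  refine map_mem_of_degreeLE (fun x hx => ?_) hv
  rw [actT_single]
  exact sum_mem fun j _ => single_mem_degreeLE (x := (j, x.2)) hx _

/-! ### Norm bounds in a given degree -/

theorem ofReal_norm_sq (ψ : TotalSpace N) : ((‖ψ‖ ^ 2 : ℝ) : ℂ) = inner ℂ ψ ψ := by
  rw [inner_self_eq_norm_sq_to_K]
  simp

theorem norm_incl_sq (v : FiniteVec N) : ‖incl v‖ ^ 2 = v.sum fun _ c => ‖c‖ ^ 2 := by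
  have h : ((‖incl v‖ ^ 2 : ℝ) : ℂ) = ((v.sum fun _ c => ‖c‖ ^ 2 : ℝ) : ℂ) := by
    rw [ofReal_norm_sq, inner_incl_incl]
    push_cast [Finsupp.sum]
    refine Finset.sum_congr rfl fun x _ => ?_
    exact Complex.conj_mul' (v x)
  exact_mod_cast h

/-- ‖b_i v‖² = ⟨v, b_i† b_i v⟩, and the number operator b_i† b_i is diagonal with entries at most k
in degree k. -/
theorem norm_annihilation_le (i : Fin N) {k : ℕ} {v : FiniteVec N} (hv : v ∈ degreeLE N k) :
    ‖incl (annihilation i v)‖ ≤ √k * ‖incl v‖ := by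
  have hdiag : ∀ (w : FiniteVec N) (x : Label N),
      creation i (annihilation i w) x = (x.2 i : ℂ) * w x := by
    intro w x
    induction w using Finsupp.induction_linear with
    | zero => simp
    | add v w hv hw => simp [hv, hw, mul_add]
    | single y c =>
      rw [creation_annihilation_single]
      by_cases h : y = x
      · subst h; simp [mul_comm]
      · simp [h]
  have h1 : ‖incl (annihilation i v)‖ ^ 2 = v.sum fun x c => (x.2 i : ℝ) * ‖c‖ ^ 2 := by
    have h : ((‖incl (annihilation i v)‖ ^ 2 : ℝ) : ℂ) =
        ((v.sum fun x c => (x.2 i : ℝ) * ‖c‖ ^ 2 : ℝ) : ℂ) := by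
      rw [ofReal_norm_sq, inner_annihilation_left, inner_incl_incl]
      push_cast [Finsupp.sum]
      refine Finset.sum_congr rfl fun x _ => ?_
      rw [hdiag, mul_left_comm]
      congr 1
      exact Complex.conj_mul' (v x)
    exact_mod_cast h
  refine (sq_le_sq₀ (norm_nonneg _) (by positivity)).1 ?_
  rw [mul_pow, Real.sq_sqrt (by positivity), h1, norm_incl_sq, Finsupp.sum, Finsupp.sum,
    Finset.mul_sum]
  refine Finset.sum_le_sum fun x hx => ?_
  have : ∑ i, x.2 i ≤ k := hv hx
  have : x.2 i ≤ k := (Finset.single_le_sum (fun _ _ => Nat.zero_le _) (Finset.mem_univ i)).trans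
    this
  gcongr

/-- By the commutation relation ‖b_i† v‖² = ‖b_i v‖² + ‖v‖². -/
theorem norm_creation_le (i : Fin N) {k : ℕ} {v : FiniteVec N} (hv : v ∈ degreeLE N k) :
    ‖incl (creation i v)‖ ≤ √(k + 1) * ‖incl v‖ := by
  have h1 : ‖incl (creation i v)‖ ^ 2 = ‖incl (annihilation i v)‖ ^ 2 + ‖incl v‖ ^ 2 := by
    have h : ((‖incl (creation i v)‖ ^ 2 : ℝ) : ℂ) =
        ((‖incl (annihilation i v)‖ ^ 2 + ‖incl v‖ ^ 2 : ℝ) : ℂ) := by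
      rw [Complex.ofReal_add, ofReal_norm_sq, ofReal_norm_sq, ofReal_norm_sq, inner_creation_left,
        annihilation_creation, inner_annihilation_left]
      simp
    exact_mod_cast h
  have h2 := norm_annihilation_le i hv
  refine (sq_le_sq₀ (norm_nonneg _) (by positivity)).1 ?_
  have h3 : ‖incl (annihilation i v)‖ ^ 2 ≤ (√k * ‖incl v‖) ^ 2 := by gcongr
  rw [mul_pow, Real.sq_sqrt (by positivity)] at h3 ⊢
  rw [h1]
  linarith

/-- Cauchy–Schwarz for ‖T v‖² = ⟨v, T v⟩. It serves both the truncations and the singlet projector.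
-/
theorem norm_le_of_symmetric_idempotent {T : FiniteVec N →ₗ[ℂ] FiniteVec N}
    (hT : ∀ v w, inner ℂ (incl (T v)) (incl w) = inner ℂ (incl v) (incl (T w)))
    (hTT : ∀ v, T (T v) = T v) (v : FiniteVec N) : ‖incl (T v)‖ ≤ ‖incl v‖ := by
  have h : ‖incl (T v)‖ * ‖incl (T v)‖ ≤ ‖incl v‖ * ‖incl (T v)‖ := by
    have : ((‖incl (T v)‖ * ‖incl (T v)‖ : ℝ) : ℂ) = inner ℂ (incl v) (incl (T v)) := by
      rw [← pow_two, ofReal_norm_sq, hT, hTT]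
    have h2 := norm_inner_le_norm (𝕜 := ℂ) (incl v) (incl (T v))
    rw [← this, Complex.norm_real, Real.norm_of_nonneg (by positivity)] at h2
    exact h2
  rcases (norm_nonneg (incl (T v))).eq_or_lt' with h0 | h0
  · rw [h0]; positivity
  · exact le_of_mul_le_mul_right h h0

/-! ### Truncations -/

/-- The projection onto the span of the basis vectors with label in `S`. -/
def cut (S : Finset (Label N)) : FiniteVec N →ₗ[ℂ] FiniteVec N :=
  Finsupp.linearCombination ℂ fun x => if x ∈ S then Finsupp.single x 1 else 0

theorem cut_apply (S : Finset (Label N)) (v : FiniteVec N) (x : Label N) :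
    cut S v x = if x ∈ S then v x else 0 := by
  induction v using Finsupp.induction_linear with
  | zero => simp
  | add v w hv hw => rw [map_add, Finsupp.add_apply, hv, hw]; split_ifs <;> simp
  | single y c =>
    rw [cut, Finsupp.linearCombination_single]
    by_cases h : y = x
    · subst h; split_ifs <;> simp
    · split_ifs <;> simp [h]

theorem cut_cut (S : Finset (Label N)) (v : FiniteVec N) : cut S (cut S v) = cut S v := by
  ext x
  simp only [cut_apply]
  split_ifs <;> rfl

theorem cut_eq_self {S : Finset (Label N)} {v : FiniteVec N} (h : ∀ x ∉ S, v x = 0) :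
    cut S v = v := by
  ext x
  rw [cut_apply]
  split_ifs with hx
  · rfl
  · exact (h x hx).symm

theorem inner_cut_left (S : Finset (Label N)) (v w : FiniteVec N) :
    inner ℂ (incl (cut S v)) (incl w) = inner ℂ (incl v) (incl (cut S w)) := by
  refine inner_map_eq_of_single _ _ (fun x y => ?_) v w
  rw [← inner_conj_symm, inner_ket_left, inner_ket_left, incl_apply, incl_apply, cut_apply,
    cut_apply]
  by_cases h : x = y
  · subst h
    split_ifs <;> simp
  · simp [h, Ne.symm h]

theorem norm_cut_le (S : Finset (Label N)) (v : FiniteVec N) : ‖incl (cut S v)‖ ≤ ‖incl v‖ :=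
  norm_le_of_symmetric_idempotent (inner_cut_left S) (cut_cut S) v

theorem cut_mem_degreeLE (S : Finset (Label N)) {k : ℕ} {v : FiniteVec N}
    (hv : v ∈ degreeLE N k) : cut S v ∈ degreeLE N k := by
  refine map_mem_of_degreeLE (fun x hx => ?_) hv
  rw [cut, Finsupp.linearCombination_single, one_smul]
  split_ifs
  · exact single_mem_degreeLE hx _
  · exact zero_mem _

/-- The labels with all occupation numbers at most `M`. -/
def box (N M : ℕ) : Finset (Label N) :=
  Finset.univ ×ˢ Fintype.piFinset fun _ => Finset.range (M + 1)

/-- A finite box contains every label of low degree, so on a fixed finite vector the truncation is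
eventually invisible. -/
theorem cut_box_eq_self {k M : ℕ} (h : k ≤ M) {v : FiniteVec N} (hv : v ∈ degreeLE N k) :
    cut (box N M) v = v := by
  refine cut_eq_self fun x hx => ?_
  by_contra h0
  have h1 : ∑ i, x.2 i ≤ k := hv (Finsupp.mem_support_iff.2 h0)
  apply hx
  simp only [box, Finset.mem_product, Finset.mem_univ, Fintype.mem_piFinset, Finset.mem_range,
    true_and]
  intro i
  have := Finset.single_le_sum (f := x.2) (fun _ _ => Nat.zero_le _) (Finset.mem_univ i)
  omega

/-- The bounded operator `P T P`, where `P` projects onto the span of the basis vectors with label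
in `S`. -/
def compression (S : Finset (Label N)) (T : FiniteVec N →ₗ[ℂ] FiniteVec N) :
    TotalSpace N →L[ℂ] TotalSpace N :=
  ∑ y ∈ S, (innerSL ℂ (ket y)).smulRight (incl (cut S (T (Finsupp.single y 1))))

theorem compression_incl (S : Finset (Label N)) (T : FiniteVec N →ₗ[ℂ] FiniteVec N)
    (v : FiniteVec N) : compression S T (incl v) = incl (cut S (T (cut S v))) := by
  induction v using Finsupp.induction_linear with
  | zero => simp
  | add v w hv hw => simp only [map_add, hv, hw]
  | single y c =>
    have hy : Finsupp.single y c = c • Finsupp.single y (1 : ℂ) := by simp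
    rw [hy]
    simp only [map_smul]
    congr 1
    rw [compression, sum_apply]
    simp only [ContinuousLinearMap.smulRight_apply, innerSL_apply_apply, inner_ket_left, incl_apply,
      Finsupp.single_apply, ite_smul, one_smul, zero_smul, Finset.sum_ite_eq]
    rw [cut, Finsupp.linearCombination_single, one_smul]
    split_ifs <;> simp

theorem isSelfAdjoint_compression (S : Finset (Label N)) {T : FiniteVec N →ₗ[ℂ] FiniteVec N}
    (hT : ∀ v w, inner ℂ (incl (T v)) (incl w) = inner ℂ (incl v) (incl (T w))) :
    IsSelfAdjoint (compression S T) := by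
  rw [ContinuousLinearMap.isSelfAdjoint_iff_isSymmetric]
  intro φ ψ
  refine denseRange_incl.induction_on₂
    (p := fun φ ψ => inner ℂ (compression S T φ) ψ = inner ℂ φ (compression S T ψ)) ?_ ?_ φ ψ
  · exact isClosed_eq (by fun_prop) (by fun_prop)
  · intro v w
    rw [compression_incl, compression_incl, inner_cut_left, hT, inner_cut_left]

/-! ### Powers of operators of linear growth -/

theorem pow_mem_degreeLE {T : Module.End ℂ (FiniteVec N)}
    (hT : ∀ k, ∀ v ∈ degreeLE N k, T v ∈ degreeLE N (k + 1)) {m : ℕ} {v : FiniteVec N}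
    (hv : v ∈ degreeLE N m) (k : ℕ) : (T ^ k) v ∈ degreeLE N (m + k) := by
  induction k with
  | zero => simpa using hv
  | succ k ih => rw [pow_succ', Module.End.mul_apply]; exact hT _ _ ih

/-- The j-th application of T takes place in degree m + j - 1 and costs C (m + j); the product of
these factors is C ^ k times a rising factorial. -/
theorem norm_pow_le {T : Module.End ℂ (FiniteVec N)} {C : ℝ} (hC : 0 ≤ C)
    (hT : ∀ k, ∀ v ∈ degreeLE N k, T v ∈ degreeLE N (k + 1))
    (hTC : ∀ k, ∀ v ∈ degreeLE N k, ‖incl (T v)‖ ≤ C * (k + 1) * ‖incl v‖) {m : ℕ}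
    {v : FiniteVec N} (hv : v ∈ degreeLE N m) (k : ℕ) :
    ‖incl ((T ^ k) v)‖ ≤ C ^ k * (m + 1).ascFactorial k * ‖incl v‖ := by
  induction k with
  | zero => simp
  | succ k ih =>
    rw [pow_succ', Module.End.mul_apply]
    refine (hTC _ _ (pow_mem_degreeLE hT hv k)).trans ?_
    calc C * ((m + k : ℕ) + 1) * ‖incl ((T ^ k) v)‖
        ≤ C * ((m + k : ℕ) + 1) * (C ^ k * (m + 1).ascFactorial k * ‖incl v‖) := by gcongr
      _ = _ := by rw [Nat.ascFactorial_succ]; push_cast; ring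

/-! ### Existence of the propagator -/

section ExpGroup

variable {E : Type*} [NormedAddCommGroup E] [InnerProductSpace ℂ E] [CompleteSpace E]

theorem norm_apply_of_mem_unitary {U : E →L[ℂ] E} (hU : U ∈ unitary (E →L[ℂ] E)) (ψ : E) :
    ‖U ψ‖ = ‖ψ‖ :=
  U.norm_map_of_mem_unitary hU ψ

theorem exp_smul_mem_unitary {A : E →L[ℂ] E} (hA : A ∈ skewAdjoint (E →L[ℂ] E)) (t : ℝ) :
    NormedSpace.exp (t • A) ∈ unitary (E →L[ℂ] E) :=
  letI := NormedAlgebra.restrictScalars ℚ ℂ (E →L[ℂ] E)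
  NormedSpace.exp_mem_unitary_of_mem_skewAdjoint (skewAdjoint.smul_mem t hA)

theorem exp_add_smul (A : E →L[ℂ] E) (s t : ℝ) :
    NormedSpace.exp ((s + t) • A) = NormedSpace.exp (s • A) * NormedSpace.exp (t • A) := by
  let := NormedAlgebra.restrictScalars ℚ ℂ (E →L[ℂ] E)
  rw [add_smul]
  exact NormedSpace.exp_add_of_commute (((Commute.refl A).smul_left s).smul_right t)

theorem hasDerivAt_exp_smul_apply (A : E →L[ℂ] E) (ψ : E) (t : ℝ) :
    HasDerivAt (fun t : ℝ => NormedSpace.exp (t • A) ψ) (NormedSpace.exp (t • A) (A ψ)) t := by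
  have h := hasDerivAt_exp_smul_const (𝕂 := ℝ) A t
  exact (((ContinuousLinearMap.apply ℂ E ψ).restrictScalars ℝ).hasFDerivAt.comp_hasDerivAt t h)

/-- The derivative e^{sA} A ψ has constant norm ‖A ψ‖. The bound involves A only through A ψ and so
survives the limit of truncations, whose norms need not stay bounded. -/
theorem norm_exp_smul_apply_sub_le {A : E →L[ℂ] E} (hA : A ∈ skewAdjoint (E →L[ℂ] E)) (ψ : E)
    (t : ℝ) : ‖NormedSpace.exp (t • A) ψ - ψ‖ ≤ ‖A ψ‖ * |t| := by
  have h := convex_univ.norm_image_sub_le_of_norm_hasDerivWithin_le (x := 0) (y := t)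
    (C := ‖A ψ‖) (fun s _ => (hasDerivAt_exp_smul_apply A ψ s).hasDerivWithinAt)
    (fun s _ => (norm_apply_of_mem_unitary (exp_smul_mem_unitary hA s) _).le)
    (Set.mem_univ _) (Set.mem_univ _)
  simpa using h

theorem norm_exp_smul_apply_sub_sub_le {A : E →L[ℂ] E} (hA : A ∈ skewAdjoint (E →L[ℂ] E))
    (ψ : E) (t : ℝ) :
    ‖NormedSpace.exp (t • A) ψ - ψ - t • A ψ‖ ≤ ‖A (A ψ)‖ * |t| ^ 2 := by
  -- The first-order bound, applied to A ψ, controls the derivative by ‖A (A ψ)‖ |t| on a symmetric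
  -- interval that serves both signs of t.
  have h := (convex_Icc (-|t|) |t|).norm_image_sub_le_of_norm_hasDerivWithin_le (x := 0) (y := t)
    (C := ‖A (A ψ)‖ * |t|) (f := fun s => NormedSpace.exp (s • A) ψ - ψ - s • A ψ)
    (f' := fun s => NormedSpace.exp (s • A) (A ψ) - A ψ)
    (fun s _ => by
      have := (((hasDerivAt_exp_smul_apply A ψ s).sub_const ψ).sub
        ((hasDerivAt_id s).smul_const (A ψ))).hasDerivWithinAt (s := Set.Icc (-|t|) |t|)
      rw [one_smul] at this
      exact this)
    (fun s hs => (norm_exp_smul_apply_sub_le hA (A ψ) s).trans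
      (mul_le_mul_of_nonneg_left (abs_le.2 hs) (norm_nonneg _)))
    ⟨by simp, by simp⟩ ⟨neg_abs_le t, le_abs_self t⟩
  simpa [mul_assoc, pow_two] using h

/-- Strong convergence of exponentials at small times implies strong convergence at all times. -/
theorem exists_tendsto_exp_smul {A : ℕ → E →L[ℂ] E} (hA : ∀ M, A M ∈ skewAdjoint (E →L[ℂ] E))
    {r : ℝ} (hr : 0 < r)
    (h : ∀ t : ℝ, |t| < r → ∀ ψ, ∃ φ, Tendsto (fun M => NormedSpace.exp (t • A M) ψ) atTop (𝓝 φ))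
    (t : ℝ) (ψ : E) : ∃ φ, Tendsto (fun M => NormedSpace.exp (t • A M) ψ) atTop (𝓝 φ) := by
  -- Write e^{(n+1)sA} ψ as e^{nsA}(e^{sA} ψ - φ) + e^{nsA} φ; the first term tends to 0 because
  -- e^{nsA} is isometric.
  have key : ∀ (n : ℕ) (s : ℝ), |s| < r → ∀ ψ, ∃ φ,
      Tendsto (fun M => NormedSpace.exp ((n * s) • A M) ψ) atTop (𝓝 φ) := by
    intro n s hs
    induction n with
    | zero => intro ψ; exact ⟨ψ, by simp⟩
    | succ n ih =>
      intro ψ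
      obtain ⟨φ, hφ⟩ := h s hs ψ
      obtain ⟨χ, hχ⟩ := ih φ
      refine ⟨χ, ?_⟩
      rw [tendsto_iff_norm_sub_tendsto_zero] at hφ
      have h1 : Tendsto (fun M => NormedSpace.exp ((n * s) • A M)
          (NormedSpace.exp (s • A M) ψ - φ)) atTop (𝓝 0) := by
        rw [tendsto_zero_iff_norm_tendsto_zero]
        simpa only [norm_apply_of_mem_unitary (exp_smul_mem_unitary (hA _) _)] using hφ
      refine (h1.add hχ).congr' (Eventually.of_forall fun M => ?_) |>.trans (by rw [zero_add])
      have : ((n + 1 : ℕ) : ℝ) * s = n * s + s := by push_cast; ring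
      rw [this, exp_add_smul, mul_apply_eq_comp, map_sub, sub_add_cancel]
  obtain ⟨n, hn⟩ := exists_nat_gt (|t| / r)
  have hn0 : (0 : ℝ) < n := lt_of_le_of_lt (by positivity) hn
  have := key n (t / n) (by
    rw [abs_div, Nat.abs_cast, div_lt_iff₀ hn0]
    rwa [div_lt_iff₀ hr, mul_comm] at hn) ψ
  rwa [mul_div_cancel₀ _ hn0.ne'] at this

/-- A pointwise bounded family of isometric evolutions converges strongly if it converges on a
dense set. -/
theorem exists_tendsto_of_denseRange {ι : Type*} {e : ι → E} (he : DenseRange e)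
    {U : ℕ → E →L[ℂ] E} (hU : ∀ M, U M ∈ unitary (E →L[ℂ] E))
    (h : ∀ v, ∃ φ, Tendsto (fun M => U M (e v)) atTop (𝓝 φ)) (ψ : E) :
    ∃ φ, Tendsto (fun M => U M ψ) atTop (𝓝 φ) := by
  apply cauchySeq_tendsto_of_complete
  rw [Metric.cauchySeq_iff']
  intro ε hε
  obtain ⟨v, hv⟩ := he.exists_dist_lt ψ (show 0 < ε / 3 by positivity)
  obtain ⟨φ, hφ⟩ := h v
  obtain ⟨K, hK⟩ := Metric.cauchySeq_iff'.1 hφ.cauchySeq (ε / 3) (by positivity)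
  refine ⟨K, fun M hM => ?_⟩
  have hd : ∀ M, dist (U M ψ) (U M (e v)) = dist ψ (e v) := fun M => by
    rw [dist_eq_norm, dist_eq_norm, ← map_sub, norm_apply_of_mem_unitary (hU M)]
  calc dist (U M ψ) (U K ψ)
      ≤ dist (U M ψ) (U M (e v)) + dist (U M (e v)) (U K (e v)) + dist (U K (e v)) (U K ψ) :=
        dist_triangle4 _ _ _ _
    _ < ε / 3 + ε / 3 + ε / 3 := by
        rw [dist_comm (U K (e v)), hd, hd]
        have := hK M hM
        gcongr
    _ = ε := by ring

end ExpGroup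

/-- The generator `-i T / ħ` on finite vectors. -/
def generator (hbar : ℝ) (T : FiniteVec N →ₗ[ℂ] FiniteVec N) : Module.End ℂ (FiniteVec N) :=
  (-Complex.I / (hbar : ℂ)) • T

theorem incl_generator (hbar : ℝ) (T : FiniteVec N →ₗ[ℂ] FiniteVec N) (v : FiniteVec N) :
    incl (generator hbar T v) = (-Complex.I / (hbar : ℂ)) • incl (T v) := by
  simp [generator]

/-- The truncated generators. -/
def truncGen (hbar : ℝ) (T : FiniteVec N →ₗ[ℂ] FiniteVec N) (M : ℕ) :
    TotalSpace N →L[ℂ] TotalSpace N :=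
  (-Complex.I / (hbar : ℂ)) • compression (box N M) T

theorem truncGen_mem_skewAdjoint (hbar : ℝ) {T : FiniteVec N →ₗ[ℂ] FiniteVec N}
    (hT : ∀ v w, inner ℂ (incl (T v)) (incl w) = inner ℂ (incl v) (incl (T w))) (M : ℕ) :
    truncGen hbar T M ∈ skewAdjoint (TotalSpace N →L[ℂ] TotalSpace N) := by
  rw [skewAdjoint.mem_iff, truncGen, star_smul, (isSelfAdjoint_compression _ hT).star_eq, ← neg_smul]
  congr 1
  simp [neg_div]

theorem truncGen_incl (hbar : ℝ) (T : FiniteVec N →ₗ[ℂ] FiniteVec N) (M : ℕ) (v : FiniteVec N) :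
    truncGen hbar T M (incl v) =
      incl (generator hbar (cut (box N M) ∘ₗ T ∘ₗ cut (box N M)) v) := by
  rw [truncGen, smul_apply, compression_incl, incl_generator]
  rfl

theorem truncGen_pow_incl (hbar : ℝ) (T : FiniteVec N →ₗ[ℂ] FiniteVec N) (M : ℕ)
    (v : FiniteVec N) (k : ℕ) :
    (truncGen hbar T M ^ k) (incl v) =
      incl ((generator hbar (cut (box N M) ∘ₗ T ∘ₗ cut (box N M)) ^ k) v) := by
  induction k with
  | zero => simp
  | succ k ih =>
    rw [pow_succ', pow_succ', mul_apply_eq_comp, ih, truncGen_incl,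
      Module.End.mul_apply]

theorem truncGen_incl_of_mem (hbar : ℝ) {T : FiniteVec N →ₗ[ℂ] FiniteVec N}
    (hTdeg : ∀ k, ∀ v ∈ degreeLE N k, T v ∈ degreeLE N (k + 1)) {m M : ℕ} (h : m + 1 ≤ M)
    {v : FiniteVec N} (hv : v ∈ degreeLE N m) :
    truncGen hbar T M (incl v) = incl (generator hbar T v) := by
  rw [truncGen_incl, incl_generator, incl_generator]
  simp only [LinearMap.comp_apply]
  rw [cut_box_eq_self (by omega) hv, cut_box_eq_self h (hTdeg _ _ hv)]

theorem generator_mem_degreeLE (hbar : ℝ) {T : FiniteVec N →ₗ[ℂ] FiniteVec N}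
    (hTdeg : ∀ k, ∀ v ∈ degreeLE N k, T v ∈ degreeLE N (k + 1)) (k : ℕ) (v : FiniteVec N)
    (hv : v ∈ degreeLE N k) : generator hbar T v ∈ degreeLE N (k + 1) :=
  Submodule.smul_mem _ _ (hTdeg _ _ hv)

theorem truncGen_pow_incl_of_mem (hbar : ℝ) {T : FiniteVec N →ₗ[ℂ] FiniteVec N}
    (hTdeg : ∀ k, ∀ v ∈ degreeLE N k, T v ∈ degreeLE N (k + 1)) {m M k : ℕ} (h : m + k ≤ M)
    {v : FiniteVec N} (hv : v ∈ degreeLE N m) :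
    (truncGen hbar T M ^ k) (incl v) = incl ((generator hbar T ^ k) v) := by
  induction k with
  | zero => simp
  | succ k ih =>
    rw [pow_succ', pow_succ', mul_apply_eq_comp, ih (by omega), Module.End.mul_apply]
    exact truncGen_incl_of_mem hbar hTdeg (by omega)
      (pow_mem_degreeLE (generator_mem_degreeLE hbar hTdeg) hv k)

/-- The bound is uniform in M, since truncation neither raises the degree nor increases the norm. -/
theorem norm_truncGen_pow_incl_le {hbar : ℝ} (hhbar : 0 < hbar)
    {T : FiniteVec N →ₗ[ℂ] FiniteVec N} {C : ℝ} (hC : 0 ≤ C)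
    (hTdeg : ∀ k, ∀ v ∈ degreeLE N k, T v ∈ degreeLE N (k + 1))
    (hTC : ∀ k, ∀ v ∈ degreeLE N k, ‖incl (T v)‖ ≤ C * (k + 1) * ‖incl v‖) (M : ℕ) {m : ℕ}
    {v : FiniteVec N} (hv : v ∈ degreeLE N m) (k : ℕ) :
    ‖(truncGen hbar T M ^ k) (incl v)‖ ≤
      (C / hbar) ^ k * (m + 1).ascFactorial k * ‖incl v‖ := by
  rw [truncGen_pow_incl]
  refine norm_pow_le (by positivity) ?_ ?_ hv k
  · exact generator_mem_degreeLE hbar fun k v hv =>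
      cut_mem_degreeLE _ (hTdeg _ _ (cut_mem_degreeLE _ hv))
  · intro k v hv
    rw [incl_generator, norm_smul, norm_div, norm_neg, Complex.norm_I, Complex.norm_real,
      Real.norm_of_nonneg hhbar.le]
    calc 1 / hbar * ‖incl (cut (box N M) (T (cut (box N M) v)))‖
        ≤ 1 / hbar * (C * (k + 1) * ‖incl v‖) := by
          gcongr
          refine (norm_cut_le _ _).trans ((hTC _ _ (cut_mem_degreeLE _ hv)).trans ?_)
          gcongr
          exact norm_cut_le _ _
      _ = _ := by ring

/-- Finite vectors are analytic, uniformly in the truncation. For fixed k the k-th term of the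
exponential series is eventually constant in M, and dominated convergence gives the limit. -/
theorem exists_tendsto_exp_truncGen_incl {hbar : ℝ} (hhbar : 0 < hbar)
    {T : FiniteVec N →ₗ[ℂ] FiniteVec N} {C : ℝ} (hC : 0 ≤ C)
    (hTdeg : ∀ k, ∀ v ∈ degreeLE N k, T v ∈ degreeLE N (k + 1))
    (hTC : ∀ k, ∀ v ∈ degreeLE N k, ‖incl (T v)‖ ≤ C * (k + 1) * ‖incl v‖) {t : ℝ}
    (ht : |t| * (C / hbar) < 1) (v : FiniteVec N) :
    ∃ φ, Tendsto (fun M => NormedSpace.exp (t • truncGen hbar T M) (incl v)) atTop (𝓝 φ) := by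
  obtain ⟨m, hv⟩ := exists_mem_degreeLE v
  obtain ⟨a, ha⟩ : ∃ a : ℕ → ℕ → TotalSpace N, ∀ M k, a M k =
    (k.factorial : ℝ)⁻¹ • ((t • truncGen hbar T M) ^ k) (incl v) := ⟨_, fun _ _ => rfl⟩
  have hsum : ∀ M, HasSum (a M) (NormedSpace.exp (t • truncGen hbar T M) (incl v)) := by
    intro M
    have h := NormedSpace.exp_series_hasSum_exp' (𝕂 := ℝ) (t • truncGen hbar T M)
    rw [funext (ha M)]
    exact h.mapL ((ContinuousLinearMap.apply ℂ (TotalSpace N) (incl v)).restrictScalars ℝ)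
  have hak : ∀ M k, a M k = ((k.factorial : ℝ)⁻¹ * t ^ k) • (truncGen hbar T M ^ k) (incl v) := by
    intro M k
    rw [ha, smul_pow, smul_apply, smul_smul]
  refine ⟨∑' k, ((k.factorial : ℝ)⁻¹ * t ^ k) • incl ((generator hbar T ^ k) v), ?_⟩
  -- The rising factorial (m+1)⋯(m+k) divided by k! is the binomial coefficient, so the dominating
  -- series is a differentiated geometric series of ratio |t| C / ħ.
  have hbound : Summable fun k : ℕ =>
      ((k + m).choose m : ℝ) * (|t| * (C / hbar)) ^ k * ‖incl v‖ := by
    have h1 : ‖|t| * (C / hbar)‖ < 1 := by rwa [Real.norm_of_nonneg (by positivity)]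
    exact (summable_choose_mul_geometric_of_norm_lt_one m h1).mul_right _
  simp only [← (hsum _).tsum_eq]
  refine tendsto_tsum_of_dominated_convergence hbound (fun k => ?_)
    (Eventually.of_forall fun M k => ?_)
  · refine tendsto_const_nhds.congr' ?_
    filter_upwards [eventually_ge_atTop (m + k)] with M hM
    rw [hak, truncGen_pow_incl_of_mem hbar hTdeg hM hv]
  · rw [hak, norm_smul, norm_mul, norm_inv, norm_pow, Real.norm_eq_abs, Real.norm_eq_abs,
      Nat.abs_cast]
    calc (k.factorial : ℝ)⁻¹ * |t| ^ k * ‖(truncGen hbar T M ^ k) (incl v)‖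
        ≤ (k.factorial : ℝ)⁻¹ * |t| ^ k *
            ((C / hbar) ^ k * (m + 1).ascFactorial k * ‖incl v‖) := by
          gcongr
          exact norm_truncGen_pow_incl_le hhbar hC hTdeg hTC M hv k
      _ = _ := by
          rw [Nat.ascFactorial_eq_factorial_mul_choose, add_comm m k,
            ← Nat.choose_symm_add (a := k) (b := m)]
          have : (k.factorial : ℝ) ≠ 0 := by positivity
          push_cast
          field_simp
          ring

/-- A symmetric operator on the finite vectors that raises the total occupation number by at most
one and grows linearly with it generates a propagator. -/
theorem exists_isPropagator {hbar : ℝ} (hhbar : 0 < hbar) {T : FiniteVec N →ₗ[ℂ] FiniteVec N}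
    (hT : ∀ v w, inner ℂ (incl (T v)) (incl w) = inner ℂ (incl v) (incl (T w)))
    {C : ℝ} (hC : 0 < C) (hTdeg : ∀ k, ∀ v ∈ degreeLE N k, T v ∈ degreeLE N (k + 1))
    (hTC : ∀ k, ∀ v ∈ degreeLE N k, ‖incl (T v)‖ ≤ C * (k + 1) * ‖incl v‖) :
    ∃ X, IsPropagator hbar T X := by
  set A := truncGen hbar T with hAdef
  have hA := truncGen_mem_skewAdjoint hbar hT
  have hconv : ∀ (t : ℝ) ψ, ∃ φ, Tendsto (fun M => NormedSpace.exp (t • A M) ψ) atTop (𝓝 φ) := by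
    refine exists_tendsto_exp_smul hA (r := hbar / C) (by positivity) fun t ht => ?_
    refine exists_tendsto_of_denseRange denseRange_incl
      (fun M => exp_smul_mem_unitary (hA M) t) ?_
    refine exists_tendsto_exp_truncGen_incl hhbar hC.le hTdeg hTC ?_
    rw [← mul_div_assoc, div_lt_one hhbar]
    rwa [lt_div_iff₀ hC] at ht
  choose Y hY using hconv
  set X : ℝ → TotalSpace N →L[ℂ] TotalSpace N := fun t =>
    continuousLinearMapOfTendsto (fun M => NormedSpace.exp (t • A M)) (tendsto_pi_nhds.2 (hY t))
    with hX
  have hXY : ∀ t ψ, Tendsto (fun M => NormedSpace.exp (t • A M) ψ) atTop (𝓝 (X t ψ)) := hY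
  have hexp : ∀ t M ψ, ‖NormedSpace.exp (t • A M) ψ‖ = ‖ψ‖ := fun t M ψ =>
    norm_apply_of_mem_unitary (exp_smul_mem_unitary (hA M) t) ψ
  have hnorm : ∀ t ψ, ‖X t ψ‖ = ‖ψ‖ := fun t ψ =>
    tendsto_nhds_unique (hXY t ψ).norm (tendsto_const_nhds.congr fun M => (hexp t M ψ).symm)
  have hzero : X 0 = 1 := by
    ext1 ψ
    refine tendsto_nhds_unique (hXY 0 ψ) ?_
    simp
  have hadd : ∀ s t, X (s + t) = X s * X t := by
    intro s t
    ext1 ψ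
    refine tendsto_nhds_unique (hXY (s + t) ψ) ?_
    have h1 : Tendsto (fun M => NormedSpace.exp (s • A M)
        (NormedSpace.exp (t • A M) ψ - X t ψ)) atTop (𝓝 0) := by
      rw [tendsto_zero_iff_norm_tendsto_zero]
      simpa only [hexp] using
        tendsto_iff_norm_sub_tendsto_zero.1 (hXY t ψ)
    have h2 := h1.add (hXY s (X t ψ))
    rw [zero_add] at h2
    refine h2.congr fun M => ?_
    have h3 : NormedSpace.exp ((s + t) • A M) =
        NormedSpace.exp (s • A M) * NormedSpace.exp (t • A M) := exp_add_smul (A M) s t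
    rw [h3, mul_apply_eq_comp, map_sub, sub_add_cancel]
  -- An isometry with right inverse X (-t) is unitary.
  have hunit : ∀ t, X t ∈ unitary (TotalSpace N →L[ℂ] TotalSpace N) := by
    intro t
    have h1 : star (X t) * X t = 1 := by
      rw [ContinuousLinearMap.star_eq_adjoint]
      exact (ContinuousLinearMap.norm_map_iff_adjoint_comp_self (X t)).1 (hnorm t)
    have h2 : X t * X (-t) = 1 := by rw [← hadd, add_neg_cancel, hzero]
    refine ⟨h1, ?_⟩
    have : star (X t) = X (-t) := by
      calc star (X t) = star (X t) * (X t * X (-t)) := by rw [h2, mul_one]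
        _ = X (-t) := by rw [← mul_assoc, h1, one_mul]
    rw [this, h2]
  -- On a fixed finite vector the truncated generators are eventually the full one, so the uniform
  -- estimates pass to the limit. The next one applies the generator twice and needs one more degree
  -- of room.
  have hfirst : ∀ v : FiniteVec N, ∀ t, ‖X t (incl v) - incl v‖ ≤
      ‖incl (generator hbar T v)‖ * |t| := by
    intro v t
    obtain ⟨m, hv⟩ := exists_mem_degreeLE v
    refine le_of_tendsto ((hXY t (incl v)).sub_const _).norm ?_
    filter_upwards [eventually_ge_atTop (m + 1)] with M hM
    rw [← truncGen_incl_of_mem hbar hTdeg hM hv]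
    exact norm_exp_smul_apply_sub_le (hA M) _ _
  have hsecond : ∀ v : FiniteVec N, ∀ t,
      ‖X t (incl v) - incl v - t • incl (generator hbar T v)‖ ≤
        ‖incl (generator hbar T (generator hbar T v))‖ * |t| ^ 2 := by
    intro v t
    obtain ⟨m, hv⟩ := exists_mem_degreeLE v
    refine le_of_tendsto (((hXY t (incl v)).sub_const _).sub_const _).norm ?_
    filter_upwards [eventually_ge_atTop (m + 1 + 1)] with M hM
    have h1 := truncGen_incl_of_mem hbar hTdeg (show m + 1 ≤ M by omega) hv
    have h2 := truncGen_incl_of_mem hbar hTdeg hM (generator_mem_degreeLE hbar hTdeg _ _ hv)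
    rw [← h2, ← h1]
    exact norm_exp_smul_apply_sub_sub_le (hA M) _ _
  refine ⟨X, hunit, hzero, hadd, fun ψ => ?_, fun v => ?_⟩
  · have h0 : Tendsto (fun t => X t ψ) (𝓝 0) (𝓝 ψ) := by
      rw [Metric.tendsto_nhds]
      intro ε hε
      obtain ⟨v, hv⟩ := denseRange_incl.exists_dist_lt ψ (show 0 < ε / 3 by positivity)
      have h1 : Tendsto (fun t : ℝ => ‖incl (generator hbar T v)‖ * |t|) (𝓝 0) (𝓝 0) := by
        have : Continuous fun t : ℝ => ‖incl (generator hbar T v)‖ * |t| := by fun_prop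
        simpa using this.tendsto 0
      filter_upwards [h1.eventually (gt_mem_nhds (show 0 < ε / 3 by positivity))] with t ht
      calc dist (X t ψ) ψ
          ≤ dist (X t ψ) (X t (incl v)) + dist (X t (incl v)) (incl v) + dist (incl v) ψ :=
            dist_triangle4 _ _ _ _
        _ < ε / 3 + ε / 3 + ε / 3 := by
            have h2 : dist (X t ψ) (X t (incl v)) < ε / 3 := by
              rwa [dist_eq_norm, ← map_sub, hnorm, ← dist_eq_norm]
            have h3 : dist (X t (incl v)) (incl v) < ε / 3 := by
              rw [dist_eq_norm]
              exact (hfirst v t).trans_lt ht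
            rw [dist_comm (incl v)]
            gcongr
        _ = ε := by ring
    rw [continuous_iff_continuousAt]
    intro s
    have h1 : Tendsto (fun t => t - s) (𝓝 s) (𝓝 0) := by
      have : Continuous fun t : ℝ => t - s := by fun_prop
      simpa using this.tendsto s
    have h2 := ((X s).continuous.tendsto ψ).comp (h0.comp h1)
    refine h2.congr fun t => ?_
    simp only [Function.comp_apply]
    rw [← mul_apply_eq_comp, ← hadd, add_sub_cancel]
  · rw [← incl_generator, hasDerivAt_iff_isLittleO_nhds_zero]
    -- The quadratic remainder `hsecond` is o(t), which is differentiability at 0.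
    have h1 : (fun t : ℝ => X (0 + t) (incl v) - X 0 (incl v) - t • incl (generator hbar T v)) =O[𝓝 0]
        fun t => t ^ 2 := by
      refine Asymptotics.IsBigO.of_bound ‖incl (generator hbar T (generator hbar T v))‖
        (Eventually.of_forall fun t => ?_)
      rw [zero_add, hzero, norm_pow, Real.norm_eq_abs]
      exact hsecond v t
    refine h1.trans_isLittleO ?_
    simpa using Asymptotics.isLittleO_pow_pow (𝕜 := ℝ) (show 1 < 2 by norm_num)

/-! ### Properties of the Hamiltonian -/

theorem hamiltonian_apply (hbar : ℝ) (ω g : Fin N → ℝ)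
    (B : Matrix (Fin 2 × Fin 2) (Fin 2 × Fin 2) ℂ) (v : FiniteVec N) :
    hamiltonian hbar ω g B v =
      ∑ i, ((hbar * ω i : ℝ) : ℂ) • (creation i (annihilation i v) + (1 / 2 : ℂ) • v) +
        ∑ i, (g i : ℂ) • actT B (annihilation i v + creation i v) := by
  simp [hamiltonian, hamiltonianE, hamiltonianET, LinearMap.sum_apply, -one_div]

theorem hamiltonian_symmetric (hbar : ℝ) (ω g : Fin N → ℝ)
    {B : Matrix (Fin 2 × Fin 2) (Fin 2 × Fin 2) ℂ} (hB : B.conjTranspose = B)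
    (v w : FiniteVec N) :
    inner ℂ (incl (hamiltonian hbar ω g B v)) (incl w) =
      inner ℂ (incl v) (incl (hamiltonian hbar ω g B w)) := by
  simp only [hamiltonian_apply, map_add, map_sum, map_smul, inner_add_left, inner_add_right,
    sum_inner, inner_sum, inner_smul_left, inner_smul_right, inner_creation_left,
    inner_annihilation_left, inner_actT_left, hB, actT_creation, actT_annihilation,
    Complex.conj_ofReal]
  refine congrArg₂ (· + ·) ?_ ?_
  · have h2 : (starRingEnd ℂ) 2 = 2 := map_ofNat _ 2
    simp [h2]
  · exact Finset.sum_congr rfl fun i _ => by ring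

theorem hamiltonian_mem_degreeLE (hbar : ℝ) (ω g : Fin N → ℝ)
    (B : Matrix (Fin 2 × Fin 2) (Fin 2 × Fin 2) ℂ) (k : ℕ) (v : FiniteVec N)
    (hv : v ∈ degreeLE N k) : hamiltonian hbar ω g B v ∈ degreeLE N (k + 1) := by
  rw [hamiltonian_apply]
  have hv' := degreeLE_mono (Nat.le_succ k) hv
  refine add_mem (sum_mem fun i _ => Submodule.smul_mem _ _ (add_mem ?_ ?_))
    (sum_mem fun i _ => Submodule.smul_mem _ _ (actT_mem_degreeLE _ (add_mem ?_ ?_)))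
  · exact creation_mem_degreeLE i (annihilation_mem_degreeLE i hv)
  · exact Submodule.smul_mem _ _ hv'
  · exact annihilation_mem_degreeLE i hv'
  · exact creation_mem_degreeLE i hv

theorem sqrt_le_of_one_le {x : ℝ} (hx : 1 ≤ x) : √x ≤ x := by
  rw [Real.sqrt_le_left (by linarith)]
  nlinarith

/-- The number operators contribute k + 1 and the ladder operators only √(k + 1) ≤ k + 1, so the
growth is linear, as required for analytic vectors. -/
theorem norm_hamiltonian_le {hbar : ℝ} {ω g : Fin N → ℝ}
    {B : Matrix (Fin 2 × Fin 2) (Fin 2 × Fin 2) ℂ} {D : ℝ}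
    (hB : ∀ v : FiniteVec N, ‖incl (actT B v)‖ ≤ D * ‖incl v‖) (k : ℕ)
    (v : FiniteVec N) (hv : v ∈ degreeLE N k) :
    ‖incl (hamiltonian hbar ω g B v)‖ ≤
      (∑ i, |hbar * ω i| * 2 + ∑ i, |g i| * (D * 2)) * (k + 1) * ‖incl v‖ := by
  have hk : (1 : ℝ) ≤ k + 1 := by simp
  have hs1 : √((k : ℝ) + 1) ≤ k + 1 := sqrt_le_of_one_le hk
  have hs0 : √(k : ℝ) ≤ √((k : ℝ) + 1) := Real.sqrt_le_sqrt (by simp)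
  have hsq : √((k : ℝ) + 1) * √((k : ℝ) + 1) = k + 1 := Real.mul_self_sqrt (by positivity)
  have ha : ∀ i, ‖incl (annihilation i v)‖ ≤ √((k : ℝ) + 1) * ‖incl v‖ := fun i =>
    (norm_annihilation_le i hv).trans (by gcongr)
  rw [hamiltonian_apply]
  simp only [map_add, map_sum, map_smul]
  rw [add_mul, add_mul, Finset.sum_mul, Finset.sum_mul, Finset.sum_mul, Finset.sum_mul]
  refine (norm_add_le _ _).trans (add_le_add ?_ ?_)
  · refine (norm_sum_le _ _).trans (Finset.sum_le_sum fun i _ => ?_)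
    rw [norm_smul, Complex.norm_real, Real.norm_eq_abs, mul_assoc, mul_assoc]
    gcongr
    refine (norm_add_le _ _).trans ?_
    have h1 : ‖incl (creation i (annihilation i v))‖ ≤ (k + 1) * ‖incl v‖ := by
      refine (norm_creation_le i (annihilation_mem_degreeLE i hv)).trans ?_
      calc √((k : ℝ) + 1) * ‖incl (annihilation i v)‖
          ≤ √((k : ℝ) + 1) * (√((k : ℝ) + 1) * ‖incl v‖) := by gcongr; exact ha i
        _ = _ := by rw [← mul_assoc, hsq]
    have h2 : ‖(1 / 2 : ℂ) • incl v‖ ≤ (k + 1) * ‖incl v‖ := by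
      rw [norm_smul]
      gcongr
      norm_num
      linarith
    linarith
  · refine (norm_sum_le _ _).trans (Finset.sum_le_sum fun i _ => ?_)
    rw [norm_smul, Complex.norm_real, Real.norm_eq_abs, mul_assoc, mul_assoc]
    gcongr
    have hD : 0 ≤ D * ‖incl v‖ := (norm_nonneg _).trans (hB v)
    have hD1 : ∀ w : FiniteVec N, ‖incl w‖ ≤ √((k : ℝ) + 1) * ‖incl v‖ →
        ‖incl (actT B w)‖ ≤ D * ((k + 1) * ‖incl v‖) := by
      intro w hw
      -- The sign of D is not assumed; `hB` gives D ≥ 0 only when v has positive norm.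
      rcases (norm_nonneg (incl v)).eq_or_lt' with h0 | h0
      · have h3 : ‖incl w‖ = 0 := le_antisymm (by simpa [h0] using hw) (norm_nonneg _)
        have h4 := hB w
        rw [h3] at h4
        simpa [h0] using h4
      · have hD0 : 0 ≤ D := nonneg_of_mul_nonneg_left hD h0
        refine (hB w).trans ?_
        gcongr
        exact hw.trans (by gcongr)
    have h2 := hD1 _ (ha i)
    have h3 := hD1 _ (norm_creation_le i hv)
    refine (norm_add_le _ _).trans ?_
    linarith

/-! ### Bell states -/

/-- The singlet projector. -/
def singlet : Matrix (Fin 2 × Fin 2) (Fin 2 × Fin 2) ℂ :=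
  Matrix.vecMulVec (bell 3) (star (bell 3))

theorem couplingOp_singlet (a : ℝ) : couplingOp ![0, 0, 0, a] = (a : ℂ) • singlet := by
  simp [couplingOp, Fin.sum_univ_four, singlet]

theorem inv_sqrt_two_mul_self : ((√2 : ℝ) : ℂ)⁻¹ * ((√2 : ℝ) : ℂ)⁻¹ = 1 / 2 := by
  rw [← mul_inv, ← Complex.ofReal_mul, Real.mul_self_sqrt (by norm_num)]
  norm_num

theorem bell_orthonormal (i j : Fin 4) : star (bell i) ⬝ᵥ bell j = if i = j then 1 else 0 := by
  have h := inv_sqrt_two_mul_self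
  fin_cases i <;> fin_cases j <;>
    simp [bell, dotProduct, Fintype.sum_prod_type, Fin.sum_univ_two, Pi.single_apply, Prod.ext_iff] <;>
    linear_combination 2 * h

theorem bell_complete (j k : Fin 2 × Fin 2) :
    ∑ i, bell i j * star (bell i k) = if j = k then 1 else 0 := by
  have h := inv_sqrt_two_mul_self
  obtain ⟨a, b⟩ := j
  obtain ⟨c, d⟩ := k
  fin_cases a <;> fin_cases b <;> fin_cases c <;> fin_cases d <;>
    simp [bell, Fin.sum_univ_four, Prod.ext_iff] <;>
    linear_combination 2 * h

theorem conjTranspose_singlet : singlet.conjTranspose = singlet := by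
  simp [singlet, Matrix.conjTranspose_vecMulVec]

theorem singlet_mulVec_bell (i : Fin 4) :
    singlet.mulVec (bell i) = (if i = 3 then (1 : ℂ) else 0) • bell i := by
  rw [singlet, Matrix.vecMulVec_mulVec, bell_orthonormal]
  by_cases h : i = 3
  · subst h; simp
  · simp [h, Ne.symm h]

theorem singlet_mul_singlet : singlet * singlet = singlet := by
  rw [singlet, Matrix.vecMulVec_mul_vecMulVec, bell_orthonormal]
  simp

/-! ### Product vectors and the creation operator of a mode -/

/-- The vector `u ⊗ |n⟩`. -/
def prodKet (u : Fin 2 × Fin 2 → ℂ) (n : Fin N → ℕ) : FiniteVec N :=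
  ∑ j, Finsupp.single (j, n) (u j)

theorem actT_prodKet (B : Matrix (Fin 2 × Fin 2) (Fin 2 × Fin 2) ℂ) (u : Fin 2 × Fin 2 → ℂ)
    (n : Fin N → ℕ) : actT B (prodKet u n) = prodKet (B.mulVec u) n := by
  simp only [prodKet, map_sum, actT_single, Matrix.mulVec, dotProduct]
  rw [Finset.sum_comm]
  refine Finset.sum_congr rfl fun j _ => ?_
  rw [← Finsupp.single_finsetSum]
  congr 1
  exact Finset.sum_congr rfl fun k _ => mul_comm _ _

theorem prodKet_smul (a : ℂ) (u : Fin 2 × Fin 2 → ℂ) (n : Fin N → ℕ) :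
    prodKet (a • u) n = a • prodKet u n := by
  simp [prodKet, Finset.smul_sum, -Finsupp.single_mul]

theorem creation_prodKet (i : Fin N) (u : Fin 2 × Fin 2 → ℂ) (n : Fin N → ℕ) :
    creation i (prodKet u n) =
      ((√((n i : ℝ) + 1) : ℝ) : ℂ) • prodKet u (Function.update n i (n i + 1)) := by
  simp [prodKet, creation_single, Finset.smul_sum, mul_comm]

theorem annihilation_prodKet_zero (i : Fin N) (u : Fin 2 × Fin 2 → ℂ) :
    annihilation i (prodKet u (0 : Fin N → ℕ)) = 0 := by
  simp [prodKet, annihilation_single]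

theorem creation_annihilation_prodKet (i : Fin N) (u : Fin 2 × Fin 2 → ℂ) (n : Fin N → ℕ) :
    creation i (annihilation i (prodKet u n)) = (n i : ℂ) • prodKet u n := by
  simp only [prodKet, map_sum, creation_annihilation_single, Finset.smul_sum, Finsupp.smul_single,
    smul_eq_mul, mul_comm]

theorem prodKet_mem_degreeLE (u : Fin 2 × Fin 2 → ℂ) (n : Fin N → ℕ) :
    prodKet u n ∈ degreeLE N (∑ i, n i) :=
  sum_mem fun j _ => single_mem_degreeLE (x := (j, n)) le_rfl _

/-- The operator `∑ i, z_i b_i†`. -/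
def modeCreation (z : Fin N → ℂ) : Module.End ℂ (FiniteVec N) := ∑ i, z i • creation i

theorem modeCreation_apply (z : Fin N → ℂ) (v : FiniteVec N) :
    modeCreation z v = ∑ i, z i • creation i v := by
  simp [modeCreation, LinearMap.sum_apply]

theorem modeCreation_add (z y : Fin N → ℂ) :
    modeCreation (z + y) = modeCreation z + modeCreation y := by
  simp [modeCreation, add_smul, Finset.sum_add_distrib]

theorem modeCreation_smul (a : ℂ) (z : Fin N → ℂ) :
    modeCreation (a • z) = a • modeCreation z := by
  simp [modeCreation, Finset.smul_sum, mul_smul]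

theorem modeCreation_single (i : Fin N) : modeCreation (Pi.single i 1) = creation i := by
  simp [modeCreation, Pi.single_apply]

theorem commute_modeCreation (z y : Fin N → ℂ) : Commute (modeCreation z) (modeCreation y) := by
  refine LinearMap.ext fun v => ?_
  simp only [Module.End.mul_apply, modeCreation_apply, map_sum, map_smul, Finset.smul_sum]
  rw [Finset.sum_comm]
  refine Finset.sum_congr rfl fun i _ => Finset.sum_congr rfl fun j _ => ?_
  rw [smul_comm, creation_creation]

theorem annihilation_modeCreation (i : Fin N) (z : Fin N → ℂ) (v : FiniteVec N) :
    annihilation i (modeCreation z v) = modeCreation z (annihilation i v) + z i • v := by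
  simp [modeCreation_apply, annihilation_creation, Finset.sum_add_distrib]

theorem actT_modeCreation (B : Matrix (Fin 2 × Fin 2) (Fin 2 × Fin 2) ℂ) (z : Fin N → ℂ)
    (v : FiniteVec N) : actT B (modeCreation z v) = modeCreation z (actT B v) := by
  simp [modeCreation_apply, actT_creation]

theorem actT_modeCreation_pow (B : Matrix (Fin 2 × Fin 2) (Fin 2 × Fin 2) ℂ) (z : Fin N → ℂ)
    (v : FiniteVec N) (k : ℕ) : actT B ((modeCreation z ^ k) v) = (modeCreation z ^ k) (actT B v) := by
  induction k with
  | zero => simp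
  | succ k ih => rw [pow_succ', Module.End.mul_apply, actT_modeCreation, ih, Module.End.mul_apply]

theorem modeCreation_mem_degreeLE (z : Fin N → ℂ) (k : ℕ) (v : FiniteVec N)
    (hv : v ∈ degreeLE N k) : modeCreation z v ∈ degreeLE N (k + 1) := by
  rw [modeCreation_apply]
  exact sum_mem fun i _ => Submodule.smul_mem _ _ (creation_mem_degreeLE i hv)

theorem norm_modeCreation_le {z : Fin N → ℂ} {R : ℝ} (hR : ∑ i, ‖z i‖ ≤ R) {k : ℕ}
    {v : FiniteVec N} (hv : v ∈ degreeLE N k) :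
    ‖incl (modeCreation z v)‖ ≤ R * √(k + 1) * ‖incl v‖ := by
  rw [modeCreation_apply, map_sum]
  calc ‖∑ i, incl (z i • creation i v)‖ ≤ ∑ i, ‖z i‖ * (√(k + 1) * ‖incl v‖) := by
        refine (norm_sum_le _ _).trans (Finset.sum_le_sum fun i _ => ?_)
        rw [map_smul, norm_smul]
        gcongr
        exact norm_creation_le i hv
    _ = (∑ i, ‖z i‖) * (√(k + 1) * ‖incl v‖) := by rw [Finset.sum_mul]
    _ ≤ R * (√(k + 1) * ‖incl v‖) := by gcongr
    _ = _ := by ring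

/-- The terms `(∑ i, z_i b_i†) ^ k (u ⊗ |0⟩) / k!` of an exponential vector. -/
def expTerm (u : Fin 2 × Fin 2 → ℂ) (z : Fin N → ℂ) (k : ℕ) : FiniteVec N :=
  ((k.factorial : ℂ)⁻¹) • (modeCreation z ^ k) (prodKet u 0)

theorem expTerm_zero (u : Fin 2 × Fin 2 → ℂ) (z : Fin N → ℂ) : expTerm u z 0 = prodKet u 0 := by
  simp [expTerm]

theorem modeCreation_expTerm (u : Fin 2 × Fin 2 → ℂ) (z : Fin N → ℂ) (k : ℕ) :
    modeCreation z (expTerm u z k) = ((k : ℂ) + 1) • expTerm u z (k + 1) := by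
  rw [expTerm, expTerm, map_smul, pow_succ', Module.End.mul_apply, smul_smul, Nat.factorial_succ]
  congr 1
  have : (k : ℂ) + 1 ≠ 0 := by exact_mod_cast k.succ_ne_zero
  push_cast
  field_simp

/-- By the commutation relations b_i acts on polynomials in the creation operators as ∂/∂b_i†, and
it kills the vacuum. -/
theorem annihilation_modeCreation_pow_succ (i : Fin N) (z : Fin N → ℂ) (u : Fin 2 × Fin 2 → ℂ)
    (k : ℕ) : annihilation i ((modeCreation z ^ (k + 1)) (prodKet u 0)) =
      (((k : ℂ) + 1) * z i) • (modeCreation z ^ k) (prodKet u 0) := by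
  induction k with
  | zero =>
    simp [annihilation_modeCreation, annihilation_prodKet_zero]
  | succ k ih =>
    rw [pow_succ', Module.End.mul_apply, annihilation_modeCreation, ih, map_smul,
      ← Module.End.mul_apply, ← pow_succ', ← add_smul]
    congr 1
    push_cast
    ring

theorem annihilation_expTerm_succ (i : Fin N) (u : Fin 2 × Fin 2 → ℂ) (z : Fin N → ℂ) (k : ℕ) :
    annihilation i (expTerm u z (k + 1)) = z i • expTerm u z k := by
  rw [expTerm, expTerm, map_smul, annihilation_modeCreation_pow_succ, smul_smul, smul_smul,
    Nat.factorial_succ]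
  congr 1
  have : (k : ℂ) + 1 ≠ 0 := by exact_mod_cast k.succ_ne_zero
  push_cast
  field_simp

theorem annihilation_expTerm_zero (i : Fin N) (u : Fin 2 × Fin 2 → ℂ) (z : Fin N → ℂ) :
    annihilation i (expTerm u z 0) = 0 := by
  rw [expTerm_zero, annihilation_prodKet_zero]

theorem expTerm_mem_degreeLE (u : Fin 2 × Fin 2 → ℂ) (z : Fin N → ℂ) (k : ℕ) :
    expTerm u z k ∈ degreeLE N k := by
  have h : prodKet u (0 : Fin N → ℕ) ∈ degreeLE N 0 := by
    simpa using prodKet_mem_degreeLE u (0 : Fin N → ℕ)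
  have := pow_mem_degreeLE (modeCreation_mem_degreeLE z) h k
  rw [zero_add] at this
  exact Submodule.smul_mem _ _ this

/-- Passing from term k to term k + 1 costs at most R √(k+1) / (k+1) = √(R² / (k+1)). -/
theorem norm_expTerm_le (u : Fin 2 × Fin 2 → ℂ) {z : Fin N → ℂ} {R : ℝ} (hR : ∑ i, ‖z i‖ ≤ R)
    (k : ℕ) : ‖incl (expTerm u z k)‖ ≤
      √((R ^ 2) ^ k / k.factorial) * ‖incl (prodKet u (0 : Fin N → ℕ))‖ := by
  have hR0 : 0 ≤ R := (Finset.sum_nonneg fun i _ => norm_nonneg _).trans hR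
  induction k with
  | zero => simp [expTerm_zero]
  | succ k ih =>
    have h1 : expTerm u z (k + 1) = ((k : ℂ) + 1)⁻¹ • modeCreation z (expTerm u z k) := by
      rw [modeCreation_expTerm, smul_smul, inv_mul_cancel₀, one_smul]
      exact_mod_cast k.succ_ne_zero
    have h2 : ‖((k : ℂ) + 1)⁻¹‖ = ((k : ℝ) + 1)⁻¹ := by
      rw [norm_inv]
      congr 1
      exact_mod_cast Complex.norm_natCast (k + 1)
    rw [h1, map_smul, norm_smul, h2]
    have hk : (0 : ℝ) < k + 1 := by positivity
    calc ((k : ℝ) + 1)⁻¹ * ‖incl (modeCreation z (expTerm u z k))‖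
        ≤ ((k : ℝ) + 1)⁻¹ * (R * √(k + 1) * (√((R ^ 2) ^ k / k.factorial) *
            ‖incl (prodKet u (0 : Fin N → ℕ))‖)) := by
          gcongr
          refine (norm_modeCreation_le hR (expTerm_mem_degreeLE u z k)).trans ?_
          gcongr
      _ = (((k : ℝ) + 1)⁻¹ * (R * √(k + 1)) * √((R ^ 2) ^ k / k.factorial)) *
            ‖incl (prodKet u (0 : Fin N → ℕ))‖ := by ring
      _ = _ := by
          congr 1
          have h3 : ((k : ℝ) + 1)⁻¹ * (R * √(k + 1)) = √(R ^ 2 / (k + 1)) := by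
            rw [Real.sqrt_div (sq_nonneg R), Real.sqrt_sq hR0, eq_div_iff (by positivity)]
            have := Real.mul_self_sqrt hk.le
            field_simp
            rw [pow_two, this, mul_comm]
          rw [h3, ← Real.sqrt_mul (by positivity), Nat.factorial_succ]
          congr 1
          push_cast
          field_simp
          ring

theorem tendsto_sqrt_pow_div_factorial (x : ℝ) :
    Tendsto (fun k : ℕ => √(x ^ k / k.factorial)) atTop (𝓝 0) := by
  have := (FloorSemiring.tendsto_pow_div_factorial_atTop x).sqrt
  simpa using this

theorem summable_norm_expTerm (u : Fin 2 × Fin 2 → ℂ) (z : Fin N → ℂ) :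
    Summable fun k => ‖incl (expTerm u z k)‖ := by
  set R := ∑ i, ‖z i‖ with hR
  -- Replacing R² by 4R² still leaves a bounded sequence and frees a factor (1/2)^k for comparison
  -- with a geometric series.
  have h1 := (tendsto_sqrt_pow_div_factorial (4 * R ^ 2)).bddAbove_range
  obtain ⟨K, hK⟩ := h1
  refine Summable.of_nonneg_of_le (fun _ => norm_nonneg _) (fun k => norm_expTerm_le u hR.ge k)
    (((summable_geometric_of_lt_one (show (0 : ℝ) ≤ 1 / 2 by norm_num) (by norm_num)).mul_left
      K).mul_right ‖incl (prodKet u (0 : Fin N → ℕ))‖ |>.of_nonneg_of_le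
        (fun _ => by positivity) fun k => ?_)
  gcongr
  have h2 : √((R ^ 2) ^ k / k.factorial) = √((4 * R ^ 2) ^ k / k.factorial) * (1 / 2) ^ k := by
    have h4 : ((1 : ℝ) / 2) ^ k = √((1 / 4) ^ k) := by
      rw [eq_comm, Real.sqrt_eq_iff_eq_sq (by positivity) (by positivity), ← pow_mul, mul_comm k,
        pow_mul]
      norm_num
    rw [h4, ← Real.sqrt_mul (by positivity)]
    congr 1
    rw [div_mul_eq_mul_div, ← mul_pow]
    congr 2
    ring
  rw [h2]
  gcongr
  exact hK ⟨k, rfl⟩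

/-- The exponential vector `u ⊗ exp (∑ i, z_i b_i†) |0⟩`. -/
def expVec (u : Fin 2 × Fin 2 → ℂ) (z : Fin N → ℂ) : TotalSpace N := ∑' k, incl (expTerm u z k)

theorem hasSum_expVec (u : Fin 2 × Fin 2 → ℂ) (z : Fin N → ℂ) :
    HasSum (fun k => incl (expTerm u z k)) (expVec u z) :=
  (summable_norm_expTerm u z).of_norm.hasSum

/-- The partial sums of an exponential vector. -/
def expPartial (u : Fin 2 × Fin 2 → ℂ) (z : Fin N → ℂ) (M : ℕ) : FiniteVec N :=
  ∑ k ∈ Finset.range M, expTerm u z k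

theorem tendsto_expPartial (u : Fin 2 × Fin 2 → ℂ) (z : Fin N → ℂ) :
    Tendsto (fun M => incl (expPartial u z M)) atTop (𝓝 (expVec u z)) := by
  simpa only [expPartial, map_sum] using (hasSum_expVec u z).tendsto_sum_nat

/-- The graded form of "exponential vectors are eigenvectors of b_i". The shift from M + 1 to M is
the source of the boundary term in the approximate motion below. -/
theorem annihilation_expPartial_succ (i : Fin N) (u : Fin 2 × Fin 2 → ℂ) (z : Fin N → ℂ)
    (M : ℕ) : annihilation i (expPartial u z (M + 1)) = z i • expPartial u z M := by
  rw [expPartial, Finset.sum_range_succ', map_add, annihilation_expTerm_zero, add_zero, map_sum,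
    expPartial, Finset.smul_sum]
  exact Finset.sum_congr rfl fun k _ => annihilation_expTerm_succ i u z k

theorem actT_expPartial {B : Matrix (Fin 2 × Fin 2) (Fin 2 × Fin 2) ℂ} {u : Fin 2 × Fin 2 → ℂ}
    {a : ℂ} (hu : B.mulVec u = a • u) (z : Fin N → ℂ) (M : ℕ) :
    actT B (expPartial u z M) = a • expPartial u z M := by
  rw [expPartial, map_sum, Finset.smul_sum]
  refine Finset.sum_congr rfl fun k _ => ?_
  rw [expTerm, map_smul, actT_modeCreation_pow, actT_prodKet, hu, prodKet_smul, map_smul, smul_comm]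

/-- The generator on the partial sums of an exponential vector, in an eigenspace of the
coupling. -/
theorem generator_expPartial_succ {hbar : ℝ} (hhbar : hbar ≠ 0) (ω g : Fin N → ℝ)
    {B : Matrix (Fin 2 × Fin 2) (Fin 2 × Fin 2) ℂ} {u : Fin 2 × Fin 2 → ℂ} {a : ℂ}
    (hu : B.mulVec u = a • u) {μ : Fin N → ℂ} (hμ : ∀ i, μ i = a * g i / hbar)
    (z : Fin N → ℂ) (M : ℕ) :
    generator hbar (hamiltonian hbar ω g B) (expPartial u z (M + 1)) =
      -Complex.I • (modeCreation (fun i => ω i * z i) (expPartial u z M) +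
        (∑ i, (ω i : ℂ) / 2) • expPartial u z (M + 1) + (∑ i, μ i * z i) • expPartial u z M +
        modeCreation μ (expPartial u z (M + 1))) := by
  have hh : (hbar : ℂ) ≠ 0 := by exact_mod_cast hhbar
  have hg : ∀ i, (g i : ℂ) * a = hbar * μ i := fun i => by rw [hμ]; field_simp
  rw [generator, LinearMap.smul_apply, hamiltonian_apply]
  simp only [map_add, actT_creation, actT_expPartial hu, map_smul,
    annihilation_expPartial_succ, modeCreation_apply, Finset.sum_smul, smul_add,
    Finset.sum_add_distrib, smul_smul, Finset.smul_sum]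
  have e1 : ∀ i, -Complex.I / (hbar : ℂ) * (((hbar * ω i : ℝ) : ℂ) * z i) =
      -Complex.I * (ω i * z i) := fun i => by push_cast; field_simp
  have e2 : ∀ i, -Complex.I / (hbar : ℂ) * (((hbar * ω i : ℝ) : ℂ) * (1 / 2)) =
      -Complex.I * (ω i / 2) := fun i => by push_cast; field_simp
  have e3 : ∀ i, -Complex.I / (hbar : ℂ) * ((g i : ℂ) * a) = -Complex.I * μ i := fun i => by
    rw [hg]; field_simp
  have e4 : ∀ i, -Complex.I / (hbar : ℂ) * ((g i : ℂ) * (z i * a)) = -Complex.I * (μ i * z i) :=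
    fun i => by rw [mul_left_comm (g i : ℂ), hg]; field_simp
  simp only [e1, e2, e3, e4]
  rw [← add_assoc]

/-! ### Derivatives along a path of modes -/

/-- The operators Σ z_i b_i† commute, so the usual power rule holds. The derivative is taken after a
moving linear map `Λ`, over which the induction generalizes: one factor is expanded as Σ z_i b_i†
and b_i† is absorbed into `Λ s ∘ₗ creation i`. For k = 0 the exponent `k - 1` is irrelevant, its
coefficient being 0. -/
theorem hasDerivAt_modeCreation_pow {F : Type*} [NormedAddCommGroup F] [NormedSpace ℂ F]
    {z : ℝ → Fin N → ℂ} {z' : Fin N → ℂ} {t : ℝ} (hz : ∀ i, HasDerivAt (fun s => z s i) (z' i) t)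
    (w : FiniteVec N) (k : ℕ) : ∀ {Λ : ℝ → FiniteVec N →ₗ[ℂ] F} {Λ' : FiniteVec N →ₗ[ℂ] F},
    (∀ v, HasDerivAt (fun s => Λ s v) (Λ' v) t) →
    HasDerivAt (fun s => Λ s ((modeCreation (z s) ^ k) w))
      (Λ' ((modeCreation (z t) ^ k) w) +
        (k : ℂ) • Λ t (modeCreation z' ((modeCreation (z t) ^ (k - 1)) w))) t := by
  induction k with
  | zero => intro Λ Λ' hΛ; simpa using hΛ w
  | succ k ih =>
    intro Λ Λ' hΛ
    have h1 : ∀ i, HasDerivAt (fun s => Λ s (creation i ((modeCreation (z s) ^ k) w)))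
        (Λ' (creation i ((modeCreation (z t) ^ k) w)) +
        (k : ℂ) • Λ t (creation i (modeCreation z' ((modeCreation (z t) ^ (k - 1)) w)))) t :=
      fun i => ih (Λ := fun s => Λ s ∘ₗ creation i) (Λ' := Λ' ∘ₗ creation i) fun v => hΛ _
    have h2 : HasDerivAt (fun s => ∑ i, z s i • Λ s (creation i ((modeCreation (z s) ^ k) w)))
        (∑ i, (z t i • (Λ' (creation i ((modeCreation (z t) ^ k) w)) +
        (k : ℂ) • Λ t (creation i (modeCreation z' ((modeCreation (z t) ^ (k - 1)) w)))) +
          z' i • Λ t (creation i ((modeCreation (z t) ^ k) w)))) t :=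
      HasDerivAt.fun_sum fun i _ => (hz i).smul (h1 i)
    have e : ∀ s, Λ s ((modeCreation (z s) ^ (k + 1)) w) =
        ∑ i, z s i • Λ s (creation i ((modeCreation (z s) ^ k) w)) := fun s => by
      rw [pow_succ', Module.End.mul_apply, modeCreation_apply, map_sum]
      simp only [map_smul]
    simp only [e]
    convert h2 using 1
    simp only [smul_add, Finset.sum_add_distrib]
    have e1 : ∀ (Γ : FiniteVec N →ₗ[ℂ] F) (y : Fin N → ℂ) (v : FiniteVec N),
        ∑ i, y i • Γ (creation i v) = Γ (modeCreation y v) := fun Γ y v => by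
      rw [modeCreation_apply, map_sum]
      simp only [map_smul]
    rw [e1 Λ', e1 (Λ t) z', ← Module.End.mul_apply (modeCreation (z t)), ← pow_succ',
      Nat.add_sub_cancel, add_assoc]
    congr 1
    simp only [smul_comm _ (k : ℂ), ← Finset.smul_sum]
    rw [e1, ← Module.End.mul_apply (modeCreation (z t)), (commute_modeCreation (z t) z').eq, Module.End.mul_apply]
    rcases k with - | k
    · simp
    · rw [← Module.End.mul_apply (modeCreation (z t)), ← pow_succ', Nat.add_sub_cancel]
      push_cast
      rw [add_smul, one_smul]

theorem hasDerivAt_expPartial_succ {F : Type*} [NormedAddCommGroup F] [NormedSpace ℂ F]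
    {z : ℝ → Fin N → ℂ} {z' : Fin N → ℂ} {t : ℝ} (hz : ∀ i, HasDerivAt (fun s => z s i) (z' i) t)
    (u : Fin 2 × Fin 2 → ℂ) (M : ℕ) {Λ : ℝ → FiniteVec N →ₗ[ℂ] F} {Λ' : FiniteVec N →ₗ[ℂ] F}
    (hΛ : ∀ v, HasDerivAt (fun s => Λ s v) (Λ' v) t) :
    HasDerivAt (fun s => Λ s (expPartial u (z s) (M + 1)))
      (Λ' (expPartial u (z t) (M + 1)) + Λ t (modeCreation z' (expPartial u (z t) M))) t := by
  have h1 : ∀ k, HasDerivAt (fun s => Λ s (expTerm u (z s) k))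
      (Λ' (expTerm u (z t) k) + ((k.factorial : ℂ)⁻¹ * k) •
        Λ t (modeCreation z' ((modeCreation (z t) ^ (k - 1)) (prodKet u 0)))) t := by
    intro k
    have := (hasDerivAt_modeCreation_pow hz (prodKet u 0) k hΛ).const_smul ((k.factorial : ℂ)⁻¹)
    simp only [expTerm, map_smul]
    rw [smul_add, smul_smul] at this
    exact this
  have h2 := HasDerivAt.fun_sum (u := Finset.range (M + 1)) fun k _ => h1 k
  simp only [expPartial, map_sum]
  convert h2 using 1
  rw [Finset.sum_add_distrib]
  congr 1
  rw [Finset.sum_range_succ']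
  simp only [Nat.cast_zero, mul_zero, zero_smul, add_zero]
  refine Finset.sum_congr rfl fun k _ => ?_
  rw [expTerm, map_smul, map_smul, Nat.add_sub_cancel, Nat.factorial_succ]
  congr 1
  have : (k : ℂ) + 1 ≠ 0 := by exact_mod_cast k.succ_ne_zero
  have : (k.factorial : ℂ) ≠ 0 := by exact_mod_cast k.factorial_ne_zero
  push_cast
  field_simp

/-! ### Totality of the exponential vectors -/

/-- Along the ray s z the hypothesis says that a power series in s vanishes identically; hence so do
its coefficients. -/
theorem apply_modeCreation_pow_eq_zero {F : Type*} [NormedAddCommGroup F] [NormedSpace ℂ F]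
    {T : TotalSpace N →L[ℂ] F} {u : Fin 2 × Fin 2 → ℂ} (h : ∀ z, T (expVec u z) = 0)
    (z : Fin N → ℂ) (k : ℕ) : T (incl ((modeCreation z ^ k) (prodKet u 0))) = 0 := by
  have h1 : ∀ s : ℂ, HasSum (fun k : ℕ => s ^ k • T (incl (expTerm u z k))) 0 := by
    intro s
    have := (hasSum_expVec u (s • z)).mapL T
    rw [h] at this
    refine this.congr_fun ?_
    intro k
    simp only [expTerm, modeCreation_smul, smul_pow, LinearMap.smul_apply, map_smul, smul_smul,
      mul_comm]
  set p : FormalMultilinearSeries ℂ ℂ F := fun k =>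
    ContinuousMultilinearMap.mkPiRing ℂ (Fin k) (T (incl (expTerm u z k))) with hp
  have h2 : HasFPowerSeriesAt (0 : ℂ → F) p 0 := by
    refine hasFPowerSeriesAt_iff.2 ?_
    refine Eventually.of_forall fun s => ?_
    simpa [FormalMultilinearSeries.coeff, hp] using h1 s
  have h3 := congrArg (fun p => p.coeff k) h2.eq_zero
  have h4 : T (incl (expTerm u z k)) = 0 := by
    simpa [FormalMultilinearSeries.coeff, hp] using h3
  rw [expTerm, map_smul, map_smul, smul_eq_zero] at h4
  exact h4.resolve_left (inv_ne_zero (by exact_mod_cast k.factorial_ne_zero))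

/-- Polarization: differentiating the power k + 1 at z in the direction of mode i splits off one
factor b_i†, and the differentiated function is identically 0 by induction. -/
theorem apply_creation_list_modeCreation_pow_eq_zero {F : Type*} [NormedAddCommGroup F]
    [NormedSpace ℂ F] {T : TotalSpace N →L[ℂ] F} {u : Fin 2 × Fin 2 → ℂ}
    (h : ∀ z, T (expVec u z) = 0) (l : List (Fin N)) : ∀ (z : Fin N → ℂ) (k : ℕ),
      T (incl ((l.map creation : List (Module.End ℂ (FiniteVec N))).prod
        ((modeCreation z ^ k) (prodKet u 0)))) = 0 := by
  induction l using List.reverseRecOn with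
  | nil => simpa using apply_modeCreation_pow_eq_zero h
  | append_singleton l i ih =>
    intro z k
    set Q : Module.End ℂ (FiniteVec N) := (l.map creation : List (Module.End ℂ (FiniteVec N))).prod
    have h1 := hasDerivAt_modeCreation_pow (t := 0)
      (z := fun s j => z j + s * (Pi.single i 1 : Fin N → ℂ) j) (z' := Pi.single i 1)
      (fun j => by
        simpa using ((Complex.ofRealCLM.hasDerivAt (x := 0)).mul_const
          ((Pi.single i 1 : Fin N → ℂ) j)).const_add (z j))
      (prodKet u 0) (k + 1)
      (Λ := fun _ => T.toLinearMap ∘ₗ incl ∘ₗ Q) (Λ' := 0) (fun v => hasDerivAt_const _ _)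
    have h2 := h1.unique (by
      simp only [LinearMap.comp_apply, ContinuousLinearMap.coe_coe]
      simp only [ih]
      exact hasDerivAt_const _ _)
    simp only [LinearMap.zero_apply, zero_add, smul_eq_zero] at h2
    have h3 := h2.resolve_left (by exact_mod_cast k.succ_ne_zero)
    simpa [modeCreation_single] using h3

/-- Exponential vectors are total in u ⊗ E. Quanta are removed from n one at a time, each as a
creation operator with nonzero coefficient appended to the list, until the vacuum is left. -/
theorem apply_prodKet_eq_zero {F : Type*} [NormedAddCommGroup F]
    [NormedSpace ℂ F] {T : TotalSpace N →L[ℂ] F} {u : Fin 2 × Fin 2 → ℂ}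
    (h : ∀ z, T (expVec u z) = 0) (n : Fin N → ℕ) : T (incl (prodKet u n)) = 0 := by
  have key : ∀ (d : ℕ) (n : Fin N → ℕ), ∑ i, n i = d → ∀ l : List (Fin N),
      T (incl ((l.map creation : List (Module.End ℂ (FiniteVec N))).prod (prodKet u n))) = 0 := by
    intro d
    induction d with
    | zero =>
      intro n hn l
      have : n = 0 := by
        ext i
        simpa using (Finset.sum_eq_zero_iff.1 hn) i (Finset.mem_univ i)
      subst this
      simpa using apply_creation_list_modeCreation_pow_eq_zero h l 0 0
    | succ d ih =>
      intro n hn l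
      obtain ⟨i, hi⟩ : ∃ i, n i ≠ 0 := by
        by_contra hcon
        push Not at hcon
        simp [hcon] at hn
      have h1 := sum_update n i (n i - 1)
      have h2 := ih (Function.update n i (n i - 1)) (by omega) (l ++ [i])
      have h3 : n i - 1 + 1 = n i := by omega
      simp only [List.map_append, List.map_cons, List.map_nil, List.prod_append, List.prod_cons,
        List.prod_nil, mul_one, Module.End.mul_apply, creation_prodKet, Function.update_self,
        Function.update_idem, h3, Function.update_eq_self, map_smul, smul_eq_zero] at h2
      refine h2.resolve_left ?_
      rw [Complex.ofReal_eq_zero]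
      positivity
  simpa using key _ n rfl []

theorem single_eq_sum_bell (x : Label N) :
    Finsupp.single x (1 : ℂ) = ∑ i, star (bell i x.1) • prodKet (bell i) x.2 := by
  obtain ⟨j, n⟩ := x
  simp only [prodKet, Finset.smul_sum, Finsupp.smul_single, smul_eq_mul]
  rw [Finset.sum_comm]
  simp only [← Finsupp.single_finsetSum, mul_comm (star _), bell_complete]
  rw [Finset.sum_eq_single j]
  · simp
  · intro b _ hb; simp [hb]
  · simp

theorem clm_ext_prodKet_bell {F : Type*} [NormedAddCommGroup F] [NormedSpace ℂ F]
    {S T : TotalSpace N →L[ℂ] F}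
    (h : ∀ i n, S (incl (prodKet (bell i) n)) = T (incl (prodKet (bell i) n))) : S = T := by
  refine clm_ext fun v => ?_
  induction v using Finsupp.induction_linear with
  | zero => simp
  | add v w hv hw => simp only [map_add, hv, hw]
  | single x c =>
    have hx : Finsupp.single x c = c • Finsupp.single x (1 : ℂ) := by simp
    rw [hx, single_eq_sum_bell]
    simp only [map_smul, map_sum, h]

/-! ### Propagators -/

namespace IsPropagator

variable {hbar : ℝ} {T : FiniteVec N →ₗ[ℂ] FiniteVec N}
  {X : ℝ → TotalSpace N →L[ℂ] TotalSpace N}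

theorem norm_apply (hX : IsPropagator hbar T X) (t : ℝ) (ψ : TotalSpace N) : ‖X t ψ‖ = ‖ψ‖ :=
  norm_apply_of_mem_unitary (hX.mem_unitary t) ψ

theorem apply_apply_neg (hX : IsPropagator hbar T X) (t : ℝ) (ψ : TotalSpace N) :
    X t (X (-t) ψ) = ψ := by
  rw [← mul_apply_eq_comp, ← hX.map_add, add_neg_cancel, hX.map_zero]
  rfl

theorem inner_apply_left (hX : IsPropagator hbar T X) (t : ℝ) (φ ψ : TotalSpace N) :
    inner ℂ (X t φ) ψ = inner ℂ φ (X (-t) ψ) := by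
  rw [← (X t).inner_map_map_of_mem_unitary (hX.mem_unitary t) φ, hX.apply_apply_neg]

/-- The group law moves the derivative from time 0 to time t. -/
theorem hasDerivAt_apply (hX : IsPropagator hbar T X) (t : ℝ) (v : FiniteVec N) :
    HasDerivAt (fun s => X s (incl v)) (X t (incl (generator hbar T v))) t := by
  rw [incl_generator]
  have h0 := hX.hasDerivAt v
  have h1 : HasDerivAt (fun s => X (s - t) (incl v)) ((-Complex.I / (hbar : ℂ)) • incl (T v)) t :=
    HasDerivAt.comp_sub_const t t (by rwa [sub_self])
  have h2 := ((X t).restrictScalars ℝ).hasFDerivAt.comp_hasDerivAt t h1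
  refine h2.congr_of_eventuallyEq (Eventually.of_forall fun s => ?_)
  simp only [Function.comp_apply, ContinuousLinearMap.coe_restrictScalars']
  rw [← mul_apply_eq_comp, ← hX.map_add, add_sub_cancel]

theorem hasDerivAt_apply_neg (hX : IsPropagator hbar T X) (t : ℝ) (v : FiniteVec N) :
    HasDerivAt (fun s => X (-s) (incl v)) (-X (-t) (incl (generator hbar T v))) t := by
  have h := (hX.hasDerivAt_apply (-t) v).scomp t (hasDerivAt_neg t)
  rw [neg_one_smul] at h
  exact h

end IsPropagator

/-! ### The motion of exponential vectors -/

theorem tendsto_sqrt_succ_mul_sqrt_pow_div_factorial {x : ℝ} (hx : 0 ≤ x) :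
    Tendsto (fun k : ℕ => √(k + 1) * √(x ^ k / k.factorial)) atTop (𝓝 0) := by
  refine squeeze_zero (fun k => by positivity) (fun k => ?_)
    (tendsto_sqrt_pow_div_factorial (2 * x))
  rw [← Real.sqrt_mul (by positivity), mul_pow, ← mul_div_assoc]
  refine Real.sqrt_le_sqrt ?_
  have : ((k : ℝ) + 1) ≤ 2 ^ k := by exact_mod_cast Nat.lt_two_pow_self (n := k)
  gcongr

namespace IsPropagator

variable {hbar : ℝ} {ω g : Fin N → ℝ} {B : Matrix (Fin 2 × Fin 2) (Fin 2 × Fin 2) ℂ}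
  {X : ℝ → TotalSpace N →L[ℂ] TotalSpace N}

/-- The derivative of the approximants: the sum telescopes to a boundary term. -/
theorem hasDerivAt_smul_apply_neg_expPartial (hX : IsPropagator hbar (hamiltonian hbar ω g B) X)
    (hhbar : hbar ≠ 0) {u : Fin 2 × Fin 2 → ℂ} {a : ℂ} (hu : B.mulVec u = a • u)
    {μ : Fin N → ℂ} (hμ : ∀ i, μ i = a * g i / hbar) {z : ℝ → Fin N → ℂ} {c : ℝ → ℂ} {t : ℝ}
    (hz : ∀ i, HasDerivAt (fun s => z s i) (-Complex.I * (ω i * z t i + μ i)) t)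
    (hc : HasDerivAt c (-Complex.I * (∑ i, (ω i : ℂ) / 2 + ∑ i, μ i * z t i) * c t) t) (M : ℕ) :
    HasDerivAt (fun s => c s • X (-s) (incl (expPartial u (z s) (M + 1))))
      ((-Complex.I * c t) • X (-t) (incl ((∑ i, μ i * z t i) • expTerm u (z t) M -
        modeCreation μ (expTerm u (z t) M)))) t := by
  have h1 := hasDerivAt_expPartial_succ hz u M
    (Λ := fun s => (X (-s)).toLinearMap ∘ₗ incl)
    (Λ' := -((X (-t)).toLinearMap ∘ₗ incl ∘ₗ generator hbar (hamiltonian hbar ω g B)))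
    (fun v => hX.hasDerivAt_apply_neg t v)
  have h2 := hc.smul h1
  refine h2.congr_deriv ?_
  have e1 : modeCreation (fun i => -Complex.I * (ω i * z t i + μ i)) =
      -Complex.I • (modeCreation (fun i => ω i * z t i) + modeCreation μ) := by
    rw [← modeCreation_add, ← modeCreation_smul]
    rfl
  have e2 : expPartial u (z t) (M + 1) = expPartial u (z t) M + expTerm u (z t) M := by
    rw [expPartial, Finset.sum_range_succ, expPartial]
  simp only [LinearMap.neg_apply, LinearMap.comp_apply, ContinuousLinearMap.coe_coe]
  rw [generator_expPartial_succ hhbar ω g hu hμ, e1, e2]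
  simp only [LinearMap.smul_apply, LinearMap.add_apply, _root_.map_add, map_smul, map_sub]
  module

/-- In an eigenspace of the coupling, exponential vectors move along classical trajectories. -/
theorem smul_apply_expVec (hX : IsPropagator hbar (hamiltonian hbar ω g B) X)
    (hhbar : hbar ≠ 0) {u : Fin 2 × Fin 2 → ℂ} {a : ℂ} (hu : B.mulVec u = a • u)
    {μ : Fin N → ℂ} (hμ : ∀ i, μ i = a * g i / hbar) {z : ℝ → Fin N → ℂ} {c : ℝ → ℂ}
    (hz : ∀ t i, HasDerivAt (fun s => z s i) (-Complex.I * (ω i * z t i + μ i)) t)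
    (hc : ∀ t, HasDerivAt c (-Complex.I * (∑ i, (ω i : ℂ) / 2 + ∑ i, μ i * z t i) * c t) t)
    (t : ℝ) : c 0 • X t (expVec u (z 0)) = c t • expVec u (z t) := by
  set V := ‖incl (prodKet u (0 : Fin N → ℕ))‖ with hV
  have hzc : ∀ i, Continuous fun s => z s i := fun i =>
    continuous_iff_continuousAt.2 fun s => (hz s i).continuousAt
  have hcc : Continuous c := continuous_iff_continuousAt.2 fun s => (hc s).continuousAt
  obtain ⟨R, hR⟩ := (isCompact_Icc (a := -|t|) (b := |t|)).exists_bound_of_continuousOn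
    (f := fun s => ∑ i, ‖z s i‖)
    (continuous_finsetSum _ fun i _ => (hzc i).norm).continuousOn
  obtain ⟨K, hK⟩ := (isCompact_Icc (a := -|t|) (b := |t|)).exists_bound_of_continuousOn
    hcc.continuousOn
  have h0mem : (0 : ℝ) ∈ Set.Icc (-|t|) |t| := ⟨by simp, by simp⟩
  have htmem : t ∈ Set.Icc (-|t|) |t| := ⟨neg_abs_le t, le_abs_self t⟩
  have hR' : ∀ s ∈ Set.Icc (-|t|) |t|, ∑ i, ‖z s i‖ ≤ R := fun s hs =>
    (le_abs_self _).trans (hR s hs)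
  have hR0 : 0 ≤ R := (norm_nonneg _).trans (hR 0 h0mem)
  have hK0 : 0 ≤ K := (norm_nonneg _).trans (hK 0 h0mem)
  set m := ∑ i, ‖μ i‖ with hm
  have hm0 : 0 ≤ m := Finset.sum_nonneg fun i _ => norm_nonneg _
  -- If the motion were exact, c(s) X(-s) exp(z(s)) would be constant. For partial sums its
  -- derivative is the boundary term, which tends to 0 uniformly on [-|t|, |t|], so the limits at t
  -- and 0 agree.
  set h : ℕ → ℝ → TotalSpace N := fun M s => c s • X (-s) (incl (expPartial u (z s) (M + 1)))
    with hh
  set δ : ℕ → ℝ := fun M => √(M + 1) * √((R ^ 2) ^ M / M.factorial) * (K * (m * (R + 1)) * V)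
    with hδ
  have hδ0 : Tendsto δ atTop (𝓝 0) := by
    have := (tendsto_sqrt_succ_mul_sqrt_pow_div_factorial (sq_nonneg R)).mul_const
      (K * (m * (R + 1)) * V)
    rwa [zero_mul] at this
  have hdiff : ∀ M, ‖h M t - h M 0‖ ≤ δ M * |t| := by
    intro M
    have := (convex_Icc (-|t|) |t|).norm_image_sub_le_of_norm_hasDerivWithin_le (x := 0) (y := t)
      (C := δ M) (f := h M)
      (fun s _ => (hX.hasDerivAt_smul_apply_neg_expPartial hhbar hu hμ (hz s) (hc s)
        M).hasDerivWithinAt) (fun s hs => ?_) h0mem htmem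
    · simpa using this
    · have hE := norm_expTerm_le u (hR' s hs) M
      have h1 : ‖incl (modeCreation μ (expTerm u (z s) M))‖ ≤
          m * √(M + 1) * ‖incl (expTerm u (z s) M)‖ :=
        norm_modeCreation_le le_rfl (expTerm_mem_degreeLE u (z s) M)
      have h2 : ‖∑ i, μ i * z s i‖ ≤ m * R := by
        refine (norm_sum_le _ _).trans ?_
        rw [hm, Finset.sum_mul]
        refine Finset.sum_le_sum fun i hi => ?_
        rw [norm_mul]
        gcongr
        exact (Finset.single_le_sum (f := fun i => ‖z s i‖) (fun _ _ => norm_nonneg _) hi).trans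
          (hR' s hs)
      -- This lets the scalar part of the boundary term share the factor √(M + 1) of the creation
      -- part.
      have hs1 : 1 ≤ √((M : ℝ) + 1) := by
        rw [Real.one_le_sqrt]
        simp
      rw [norm_smul, hX.norm_apply, map_sub, map_smul, norm_mul, norm_neg, Complex.norm_I, one_mul]
      calc ‖c s‖ * ‖(∑ i, μ i * z s i) • incl (expTerm u (z s) M) -
              incl (modeCreation μ (expTerm u (z s) M))‖
          ≤ K * (m * R * ‖incl (expTerm u (z s) M)‖ +
              m * √(M + 1) * ‖incl (expTerm u (z s) M)‖) := by
            gcongr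
            · exact hK s hs
            · refine (norm_sub_le _ _).trans (add_le_add ?_ h1)
              rw [norm_smul]
              gcongr
        _ = K * (m * (R * 1 + √(M + 1))) * ‖incl (expTerm u (z s) M)‖ := by ring
        _ ≤ K * (m * (R * √(M + 1) + √(M + 1))) * (√((R ^ 2) ^ M / M.factorial) * V) := by
            gcongr
        _ = δ M := by rw [hδ]; ring
  have hlim_t : Tendsto (fun M => h M t) atTop (𝓝 (c t • X (-t) (expVec u (z t)))) :=
    (((X (-t)).continuous.tendsto _).comp
      ((tendsto_expPartial u (z t)).comp (tendsto_add_atTop_nat 1))).const_smul _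
  have hlim_0 : Tendsto (fun M => h M 0) atTop (𝓝 (c 0 • X (-0) (expVec u (z 0)))) :=
    (((X (-0)).continuous.tendsto _).comp
      ((tendsto_expPartial u (z 0)).comp (tendsto_add_atTop_nat 1))).const_smul _
  have hle : ‖c t • X (-t) (expVec u (z t)) - c 0 • X (-0) (expVec u (z 0))‖ ≤ 0 := by
    refine le_of_tendsto_of_tendsto' (hlim_t.sub hlim_0).norm (g := fun M => δ M * |t|) ?_ hdiff
    simpa using hδ0.mul_const |t|
  have heq := sub_eq_zero.1 (norm_le_zero_iff.1 hle)
  rw [neg_zero, hX.map_zero] at heq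
  have := congrArg (X t) heq
  rw [map_smul, hX.apply_apply_neg, map_smul] at this
  exact this.symm

end IsPropagator

/-- The classical trajectory of a driven oscillator. -/
def trajectory (ω : Fin N → ℝ) (μ z₀ : Fin N → ℂ) (t : ℝ) (i : Fin N) : ℂ :=
  Complex.exp (-Complex.I * ω i * t) * (z₀ i + μ i / ω i) - μ i / ω i

/-- The scalar factor that accompanies `trajectory`. -/
def trajectoryFactor (ω : Fin N → ℝ) (μ z₀ : Fin N → ℂ) (t : ℝ) : ℂ :=
  Complex.exp (-Complex.I * ∑ i, (ω i * t / 2 + μ i * ((z₀ i + μ i / ω i) *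
    ((1 - Complex.exp (-Complex.I * ω i * t)) / (Complex.I * ω i)) - μ i / ω i * t)))

theorem hasDerivAt_exp_mul_ofReal (a : ℂ) (t : ℝ) :
    HasDerivAt (fun s : ℝ => Complex.exp (a * s)) (Complex.exp (a * t) * a) t := by
  have h : HasDerivAt (fun s : ℝ => a * (s : ℂ)) a t := by
    simpa using (Complex.ofRealCLM.hasDerivAt (x := t)).const_mul a
  exact h.cexp

theorem hasDerivAt_trajectory {ω : Fin N → ℝ} (hω : ∀ i, ω i ≠ 0) (μ z₀ : Fin N → ℂ) (t : ℝ)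
    (i : Fin N) : HasDerivAt (fun s => trajectory ω μ z₀ s i)
      (-Complex.I * (ω i * trajectory ω μ z₀ t i + μ i)) t := by
  have hωi : (ω i : ℂ) ≠ 0 := by exact_mod_cast hω i
  have h := ((hasDerivAt_exp_mul_ofReal (-Complex.I * ω i) t).mul_const
    (z₀ i + μ i / ω i)).sub_const (μ i / ω i)
  refine h.congr_deriv ?_
  rw [trajectory]
  field_simp
  ring

/-- The exponent is -i times the antiderivative, vanishing at 0, of Σ (ω_i / 2 + μ_i z_i(t)). -/
theorem hasDerivAt_trajectoryFactor {ω : Fin N → ℝ} (hω : ∀ i, ω i ≠ 0) (μ z₀ : Fin N → ℂ)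
    (t : ℝ) : HasDerivAt (trajectoryFactor ω μ z₀)
      (-Complex.I * (∑ i, (ω i : ℂ) / 2 + ∑ i, μ i * trajectory ω μ z₀ t i) *
        trajectoryFactor ω μ z₀ t) t := by
  have hid : HasDerivAt (fun s : ℝ => (s : ℂ)) 1 t := by
    simpa using (hasDerivAt_id t).ofReal_comp
  have h1 : ∀ i, HasDerivAt (fun t : ℝ => ((ω i * t / 2 + μ i * ((z₀ i + μ i / ω i) *
      ((1 - Complex.exp (-Complex.I * ω i * t)) / (Complex.I * ω i)) - μ i / ω i * t)) : ℂ))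
      ((ω i : ℂ) / 2 + μ i * trajectory ω μ z₀ t i) t := by
    intro i
    have hωi : (ω i : ℂ) ≠ 0 := by exact_mod_cast hω i
    have h2 := (((hasDerivAt_exp_mul_ofReal (-Complex.I * ω i) t).const_sub 1).div_const
      (Complex.I * ω i)).const_mul (z₀ i + μ i / ω i)
    have h3 := ((hid.const_mul (ω i : ℂ)).div_const 2).add
      ((h2.sub (hid.const_mul (μ i / ω i))).const_mul (μ i))
    refine h3.congr_deriv ?_
    rw [trajectory]
    field_simp
  have h4 := ((HasDerivAt.fun_sum (u := Finset.univ) fun i _ => h1 i).const_mul (-Complex.I)).cexp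
  refine h4.congr_deriv ?_
  rw [← Finset.sum_add_distrib, trajectoryFactor, mul_comm]

theorem trajectory_zero (ω : Fin N → ℝ) (μ z₀ : Fin N → ℂ) : trajectory ω μ z₀ 0 = z₀ := by
  ext i
  simp [trajectory]

theorem trajectoryFactor_zero (ω : Fin N → ℝ) (μ z₀ : Fin N → ℂ) :
    trajectoryFactor ω μ z₀ 0 = 1 := by
  simp [trajectoryFactor]

namespace IsPropagator

variable {hbar : ℝ} {ω g : Fin N → ℝ} {B : Matrix (Fin 2 × Fin 2) (Fin 2 × Fin 2) ℂ}
  {X : ℝ → TotalSpace N →L[ℂ] TotalSpace N}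

theorem apply_expVec (hX : IsPropagator hbar (hamiltonian hbar ω g B) X)
    (hhbar : hbar ≠ 0) (hω : ∀ i, ω i ≠ 0) {u : Fin 2 × Fin 2 → ℂ} {a : ℂ}
    (hu : B.mulVec u = a • u) {μ : Fin N → ℂ} (hμ : ∀ i, μ i = a * g i / hbar)
    (t : ℝ) (z : Fin N → ℂ) :
    X t (expVec u z) = trajectoryFactor ω μ z t • expVec u (trajectory ω μ z t) := by
  have := hX.smul_apply_expVec hhbar hu hμ (hasDerivAt_trajectory hω μ z)
    (hasDerivAt_trajectoryFactor hω μ z) t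
  rwa [trajectory_zero, trajectoryFactor_zero, one_smul] at this

/-- A Hamiltonian with Bell eigenvectors of the coupling determines its propagator. -/
theorem unique (hhbar : hbar ≠ 0) (hω : ∀ i, ω i ≠ 0) {α : Fin 4 → ℂ}
    (hB : ∀ i, B.mulVec (bell i) = α i • bell i)
    {Y : ℝ → TotalSpace N →L[ℂ] TotalSpace N}
    (hX : IsPropagator hbar (hamiltonian hbar ω g B) X)
    (hY : IsPropagator hbar (hamiltonian hbar ω g B) Y) : X = Y := by
  ext1 t
  refine clm_ext_prodKet_bell fun i n => ?_
  rw [← sub_eq_zero, ← sub_apply]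
  refine apply_prodKet_eq_zero (fun z => ?_) n
  rw [sub_apply, hX.apply_expVec hhbar hω (hB i) (fun _ => rfl),
    hY.apply_expVec hhbar hω (hB i) (fun _ => rfl), sub_self]

/-- At a common period of the oscillators, the propagator acts as a scalar in each eigenspace of
the coupling. -/
theorem apply_prodKet_of_period (hX : IsPropagator hbar (hamiltonian hbar ω g B) X)
    (hhbar : hbar ≠ 0) (hω : ∀ i, ω i ≠ 0) {u : Fin 2 × Fin 2 → ℂ} {a : ℂ}
    (hu : B.mulVec u = a • u) {t : ℝ} {k : Fin N → ℤ}
    (ht : ∀ i, ω i * t = 2 * (k i : ℝ) * Real.pi) (n : Fin N → ℕ) :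
    X t (incl (prodKet u n)) =
      Complex.exp (-Complex.I * ∑ i, ((ω i : ℂ) / 2 - (a * g i / hbar) ^ 2 / ω i) * t) •
        incl (prodKet u n) := by
  set μ : Fin N → ℂ := fun i => a * g i / hbar with hμ
  have hexp : ∀ i, Complex.exp (-Complex.I * ω i * t) = 1 := by
    intro i
    rw [Complex.exp_eq_one_iff]
    refine ⟨-k i, ?_⟩
    have : (ω i : ℂ) * t = 2 * (k i) * Real.pi := by exact_mod_cast ht i
    push_cast
    linear_combination -Complex.I * this
  -- With closed trajectories every exponential vector is an eigenvector, and the eigenvalue does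
  -- not depend on z; totality carries this over to number states.
  have key : ∀ z, (X t - (Complex.exp (-Complex.I * ∑ i, ((ω i : ℂ) / 2 - μ i ^ 2 / ω i) * t)) •
      (1 : TotalSpace N →L[ℂ] TotalSpace N)) (expVec u z) = 0 := by
    intro z
    rw [sub_apply, hX.apply_expVec hhbar hω hu (fun _ => rfl)]
    have h1 : trajectory ω μ z t = z := by
      ext i
      rw [trajectory, hexp]
      ring
    have h2 : trajectoryFactor ω μ z t =
        Complex.exp (-Complex.I * ∑ i, ((ω i : ℂ) / 2 - μ i ^ 2 / ω i) * t) := by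
      rw [trajectoryFactor]
      congr 2
      refine Finset.sum_congr rfl fun i _ => ?_
      rw [hexp]
      ring
    rw [h1, h2]
    simp
  have := apply_prodKet_eq_zero key n
  rw [sub_apply, sub_eq_zero] at this
  simpa using this

/-- Eigenvectors of the Hamiltonian are stationary. -/
theorem apply_of_eigenvector {T : FiniteVec N →ₗ[ℂ] FiniteVec N} (hX : IsPropagator hbar T X)
    {v : FiniteVec N} {e : ℂ} (hv : generator hbar T v = e • v) (t : ℝ) :
    X t (incl v) = Complex.exp (e * t) • incl v := by
  have h1 : ∀ s, HasDerivAt (fun s : ℝ => Complex.exp (-e * s) • X s (incl v)) 0 s := by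
    intro s
    have := (hasDerivAt_exp_mul_ofReal (-e) s).smul (hX.hasDerivAt_apply s v)
    refine this.congr_deriv ?_
    rw [hv, map_smul, map_smul]
    module
  have h2 := is_const_of_deriv_eq_zero (fun s => (h1 s).differentiableAt)
    (fun s => (h1 s).deriv) t 0
  simp only [Complex.ofReal_zero, mul_zero, Complex.exp_zero, hX.map_zero, one_smul] at h2
  have h3 : (1 : TotalSpace N →L[ℂ] TotalSpace N) (incl v) = incl v := rfl
  rw [h3] at h2
  conv_rhs => rw [← h2, smul_smul, ← Complex.exp_add]
  simp

end IsPropagator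

/-! ### Thermal weights -/

theorem summable_prod_pi : ∀ {N : ℕ} {f : Fin N → ℕ → ℝ}, (∀ i k, 0 ≤ f i k) →
    (∀ i, Summable (f i)) → Summable fun n : Fin N → ℕ => ∏ i, f i (n i)
  | 0, _, _, _ => Summable.of_finite
  | N + 1, f, h0, hf => by
    rw [← (Fin.consEquiv fun _ : Fin (N + 1) => ℕ).summable_iff]
    have h1 := (hf 0).mul_of_nonneg (summable_prod_pi (fun i => h0 i.succ) fun i => hf i.succ)
      (h0 0) fun n => Finset.prod_nonneg fun i _ => h0 i.succ (n i)
    refine h1.congr fun p => ?_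
    simp [Fin.prod_univ_succ, Fin.consEquiv]

theorem summable_exp_energy {hbar β : ℝ} {ω : Fin N → ℝ} (hhbar : 0 < hbar) (hβ : 0 < β)
    (hω : ∀ i, 0 < ω i) : Summable fun n : Fin N → ℕ => Real.exp (-β * energy hbar ω n) := by
  have h : ∀ i, Summable fun k : ℕ => Real.exp (-β * (hbar * ω i * ((k : ℝ) + 1 / 2))) := by
    intro i
    have h1 : Summable fun k : ℕ => Real.exp (k * (-(β * (hbar * ω i)))) :=
      Real.summable_exp_nat_mul_iff.2 (by have := hω i; simp only [neg_lt_zero]; positivity)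
    refine (h1.mul_right (Real.exp (-β * (hbar * ω i * (1 / 2))))).congr fun k => ?_
    rw [← Real.exp_add]
    congr 1
    ring
  refine (summable_prod_pi (fun i k => (Real.exp_pos _).le) h).congr fun n => ?_
  rw [← Real.exp_sum, energy, Finset.mul_sum]

theorem tsum_exp_energy_pos {hbar β : ℝ} {ω : Fin N → ℝ} (hhbar : 0 < hbar) (hβ : 0 < β)
    (hω : ∀ i, 0 < ω i) : 0 < ∑' n : Fin N → ℕ, Real.exp (-β * energy hbar ω n) :=
  (summable_exp_energy hhbar hβ hω).tsum_pos (fun _ => (Real.exp_pos _).le) 0 (Real.exp_pos _)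

theorem thermalWeight_pos {hbar β : ℝ} {ω : Fin N → ℝ} (hhbar : 0 < hbar) (hβ : 0 < β)
    (hω : ∀ i, 0 < ω i) (n : Fin N → ℕ) : 0 < thermalWeight hbar β ω n :=
  div_pos (Real.exp_pos _) (tsum_exp_energy_pos hhbar hβ hω)

theorem hasSum_thermalWeight {hbar β : ℝ} {ω : Fin N → ℝ} (hhbar : 0 < hbar) (hβ : 0 < β)
    (hω : ∀ i, 0 < ω i) : HasSum (thermalWeight hbar β ω) 1 := by
  have h := (summable_exp_energy hhbar hβ hω).hasSum.div_const
    (∑' n : Fin N → ℕ, Real.exp (-β * energy hbar ω n))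
  rwa [div_self (tsum_exp_energy_pos hhbar hβ hω).ne'] at h

/-! ### Matrix elements of the propagator -/

theorem inner_prodKet (u w : Fin 2 × Fin 2 → ℂ) (m n : Fin N → ℕ) :
    inner ℂ (incl (prodKet u m)) (incl (prodKet w n)) = if m = n then star u ⬝ᵥ w else 0 := by
  simp only [prodKet, map_sum, incl_single, sum_inner, inner_sum, inner_smul_left,
    inner_smul_right, inner_ket_left, ket_apply, Prod.mk.injEq]
  by_cases h : m = n
  · simp [h, dotProduct, mul_comm]
  · simp [h]

theorem prodKet_add (u w : Fin 2 × Fin 2 → ℂ) (n : Fin N → ℕ) :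
    prodKet (u + w) n = prodKet u n + prodKet w n := by
  simp [prodKet, Finset.sum_add_distrib]

theorem prodKet_single (j : Fin 2 × Fin 2) (n : Fin N → ℕ) :
    prodKet (Pi.single j 1) n = Finsupp.single (j, n) 1 := by
  rw [prodKet, Finset.sum_eq_single j]
  · simp
  · intro b _ hb; simp [hb]
  · simp

theorem generator_prodKet {hbar : ℝ} {ω g : Fin N → ℝ}
    {B : Matrix (Fin 2 × Fin 2) (Fin 2 × Fin 2) ℂ} {u : Fin 2 × Fin 2 → ℂ}
    (hu : B.mulVec u = 0) (n : Fin N → ℕ) :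
    generator hbar (hamiltonian hbar ω g B) (prodKet u n) =
      (-Complex.I / hbar * (energy hbar ω n : ℂ)) • prodKet u n := by
  have h0 : prodKet (0 : Fin 2 × Fin 2 → ℂ) n = 0 := by simp [prodKet]
  rw [generator, LinearMap.smul_apply, hamiltonian_apply]
  simp only [creation_annihilation_prodKet, map_add, actT_annihilation, actT_creation,
    actT_prodKet, hu, h0, map_zero, add_zero, smul_zero, Finset.sum_const_zero, ← add_smul,
    smul_smul, ← Finset.sum_smul]
  congr 2
  simp [energy]

/-- The phase that a stationary vector with occupation numbers `n` acquires. -/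
def phase (hbar : ℝ) (ω : Fin N → ℝ) (t : ℝ) (n : Fin N → ℕ) : ℂ :=
  Complex.exp (-Complex.I / hbar * (energy hbar ω n : ℂ) * t)

theorem phase_eq (hbar : ℝ) (ω : Fin N → ℝ) (t : ℝ) (n : Fin N → ℕ) :
    phase hbar ω t n = Complex.exp (((-(energy hbar ω n * t / hbar) : ℝ) : ℂ) * Complex.I) := by
  rw [phase]
  congr 1
  push_cast
  ring

theorem norm_phase (hbar : ℝ) (ω : Fin N → ℝ) (t : ℝ) (n : Fin N → ℕ) :
    ‖phase hbar ω t n‖ = 1 := by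
  rw [phase_eq, Complex.norm_exp_ofReal_mul_I]

/-- The matrix elements of the propagator between singlet states. -/
def singletElement (X : ℝ → TotalSpace N →L[ℂ] TotalSpace N) (t : ℝ) (m n : Fin N → ℕ) : ℂ :=
  inner ℂ (incl (prodKet (bell 3) m)) (X t (incl (prodKet (bell 3) n)))

theorem norm_prodKet_bell (i : Fin 4) (n : Fin N → ℕ) : ‖incl (prodKet (bell i) n)‖ = 1 := by
  have h := ofReal_norm_sq (incl (prodKet (bell i) n))
  rw [inner_prodKet, if_pos rfl, bell_orthonormal, if_pos rfl] at h
  have h2 : ‖incl (prodKet (bell i) n)‖ ^ 2 = 1 := by exact_mod_cast h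
  exact (pow_eq_one_iff_of_nonneg (norm_nonneg _) two_ne_zero).1 h2

theorem singlet_apply (j k : Fin 2 × Fin 2) : singlet j k = bell 3 j * star (bell 3 k) := by
  simp [singlet, Matrix.vecMulVec_apply]

theorem singlet_mulVec_sub (u : Fin 2 × Fin 2 → ℂ) :
    singlet.mulVec (u - singlet.mulVec u) = 0 := by
  rw [Matrix.mulVec_sub, Matrix.mulVec_mulVec, singlet_mul_singlet, sub_self]

theorem ket_eq_add (j : Fin 2 × Fin 2) (n : Fin N → ℕ) :
    ket (j, n) = incl (prodKet (Pi.single j 1 - singlet.mulVec (Pi.single j 1)) n) +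
      star (bell 3 j) • incl (prodKet (bell 3) n) := by
  have h : star (bell 3 j) • bell 3 = singlet.mulVec (Pi.single j 1) := by
    ext k
    simp [singlet_apply, mul_comm]
  rw [← map_smul, ← prodKet_smul, h, ← map_add, ← prodKet_add, sub_add_cancel, prodKet_single,
    incl_single, one_smul]

namespace IsPropagator

variable {hbar : ℝ} {ω g : Fin N → ℝ} {a : ℂ} {X : ℝ → TotalSpace N →L[ℂ] TotalSpace N}

theorem apply_prodKet_of_singlet_mulVec
    (hX : IsPropagator hbar (hamiltonian hbar ω g (a • singlet)) X) {u : Fin 2 × Fin 2 → ℂ}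
    (hu : singlet.mulVec u = 0) (t : ℝ) (n : Fin N → ℕ) :
    X t (incl (prodKet u n)) = phase hbar ω t n • incl (prodKet u n) :=
  hX.apply_of_eigenvector
    (generator_prodKet (by rw [Matrix.smul_mulVec, hu, smul_zero]) n) t

/-- The hypothesis says that u is orthogonal to the singlet. Moving the propagator to the side of u
produces only a phase, so the orthogonality persists. -/
theorem inner_apply_singlet_eq_zero
    (hX : IsPropagator hbar (hamiltonian hbar ω g (a • singlet)) X) {u : Fin 2 × Fin 2 → ℂ}
    (hu : singlet.mulVec u = 0) (t : ℝ) (m n : Fin N → ℕ) :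
    inner ℂ (incl (prodKet u m)) (X t (incl (prodKet (bell 3) n))) = 0 := by
  have h := hX.inner_apply_left (-t) (incl (prodKet u m)) (incl (prodKet (bell 3) n))
  rw [neg_neg] at h
  have h0 : star (bell 3) ⬝ᵥ u = 0 := by
    have h1 : singlet.mulVec u = (star (bell 3) ⬝ᵥ u) • bell 3 := by
      rw [singlet, Matrix.vecMulVec_mulVec]; simp
    rw [hu] at h1
    have h2 := congrArg (fun v => star (bell 3) ⬝ᵥ v) h1
    simpa [dotProduct_smul, bell_orthonormal] using h2.symm
  have h1 : star u ⬝ᵥ bell 3 = 0 := by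
    rw [← star_star (bell 3), Matrix.star_dotProduct_star, h0, star_zero]
  rw [← h, hX.apply_prodKet_of_singlet_mulVec hu, inner_smul_left, inner_prodKet, h1]
  simp

/-- The propagator is block diagonal: free motion on the range of 1 - Q, and one matrix in the
occupation numbers on the singlet. -/
theorem inner_ket_apply_ket (hX : IsPropagator hbar (hamiltonian hbar ω g (a • singlet)) X)
    (t : ℝ) (i j : Fin 2 × Fin 2) (m n : Fin N → ℕ) :
    inner ℂ (ket (i, m)) (X t (ket (j, n))) =
      (1 - singlet) i j * (if m = n then phase hbar ω t n else 0) +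
        singlet i j * singletElement X t m n := by
  set P : Fin 2 × Fin 2 → Fin 2 × Fin 2 → ℂ := fun j =>
    Pi.single j 1 - singlet.mulVec (Pi.single j 1) with hP
  have hP0 : ∀ j, singlet.mulVec (P j) = 0 := fun j => singlet_mulVec_sub _
  have h1 : star (P i) ⬝ᵥ P j = (1 - singlet) i j := by
    have : star (P i) = Matrix.vecMul (star (Pi.single i 1)) (1 - singlet) := by
      rw [hP, star_sub, Matrix.star_mulVec, conjTranspose_singlet, Matrix.vecMul_sub,
        Matrix.vecMul_one]
    rw [this, ← Matrix.dotProduct_mulVec, Matrix.sub_mulVec, hP0, sub_zero, Matrix.one_mulVec, hP]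
    simp [dotProduct, Pi.single_apply, Matrix.one_apply]
  have h2 : star (bell 3) ⬝ᵥ P j = 0 := by
    -- At time 0 the vanishing matrix element is just the orthogonality of `P j` and the singlet.
    have h := hX.inner_apply_singlet_eq_zero (hP0 j) 0 n n
    rw [hX.map_zero] at h
    have h' : inner ℂ (incl (prodKet (P j) n)) (incl (prodKet (bell 3) n)) = 0 := h
    rw [inner_prodKet, if_pos rfl] at h'
    rw [← star_star (P j), Matrix.star_dotProduct_star, h', star_zero]
  rw [ket_eq_add, ket_eq_add, _root_.map_add, map_smul,
    hX.apply_prodKet_of_singlet_mulVec (hP0 j), inner_add_left, inner_add_right, inner_add_right,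
    inner_smul_right, inner_smul_right, inner_smul_left, inner_smul_left, inner_smul_right,
    inner_smul_right, hX.inner_apply_singlet_eq_zero (hP0 i), inner_prodKet, inner_prodKet,
    ← singletElement]
  rw [show star (Pi.single i 1 - singlet.mulVec (Pi.single i 1)) ⬝ᵥ
    (Pi.single j 1 - singlet.mulVec (Pi.single j 1)) = (1 - singlet) i j from h1,
    show star (bell 3) ⬝ᵥ (Pi.single j 1 - singlet.mulVec (Pi.single j 1)) = 0 from h2,
    singlet_apply]
  by_cases h : m = n
  · simp [h]
    ring
  · simp [h]
    ring

/-- Parseval for a unit vector that stays in singlet ⊗ E; the sum over the basis of S + P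
contributes ‖bell 3‖² = 1. -/
theorem hasSum_norm_singletElement_sq
    (hX : IsPropagator hbar (hamiltonian hbar ω g (a • singlet)) X) (t : ℝ) (n : Fin N → ℕ) :
    HasSum (fun m => ‖singletElement X t m n‖ ^ 2) 1 := by
  set ψ := X t (incl (prodKet (bell 3) n)) with hψ
  have h1 : HasSum (fun x => ‖ψ x‖ ^ 2) 1 := by
    have := lp.hasSum_norm (p := 2) (by norm_num) ψ
    rw [hψ, hX.norm_apply, norm_prodKet_bell] at this
    simpa using this
  have h2 : ∀ m j, ‖ψ (j, m)‖ ^ 2 = ‖bell 3 j‖ ^ 2 * ‖singletElement X t m n‖ ^ 2 := by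
    intro m j
    rw [← inner_ket_left, ket_eq_add, inner_add_left, inner_smul_left,
      hX.inner_apply_singlet_eq_zero (singlet_mulVec_sub _), zero_add, ← mul_pow, ← norm_mul,
      singletElement, ← hψ]
    simp
  rw [← (Equiv.prodComm (Fin N → ℕ) (Fin 2 × Fin 2)).hasSum_iff] at h1
  refine h1.prod_fiberwise fun m => ?_
  have h3 := hasSum_fintype fun j => ‖ψ (j, m)‖ ^ 2
  simp only [h2, ← Finset.sum_mul] at h3
  have h4 : ∑ j, ‖bell 3 j‖ ^ 2 = 1 := by
    have h5 := bell_orthonormal 3 3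
    rw [if_pos rfl, dotProduct] at h5
    have h6 : ((∑ j, ‖bell 3 j‖ ^ 2 : ℝ) : ℂ) = 1 := by
      rw [← h5]
      push_cast
      exact Finset.sum_congr rfl fun j _ => (Complex.conj_mul' _).symm
    exact_mod_cast h6
  rw [h4, one_mul] at h3
  simpa [Function.comp_def, h2] using h3

theorem norm_singletElement_le (hX : IsPropagator hbar (hamiltonian hbar ω g (a • singlet)) X)
    (t : ℝ) (m n : Fin N → ℕ) : ‖singletElement X t m n‖ ≤ 1 := by
  refine (norm_inner_le_norm _ _).trans ?_
  rw [hX.norm_apply, norm_prodKet_bell, norm_prodKet_bell, one_mul]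

end IsPropagator

/-! ### The reduced dynamics -/

/-- The thermal average of the overlap between the motion of the singlet and the free motion of the
oscillators. -/
def coherence (hbar β : ℝ) (ω : Fin N → ℝ) (X : ℝ → TotalSpace N →L[ℂ] TotalSpace N) (t : ℝ) : ℂ :=
  ∑' n, (thermalWeight hbar β ω n : ℂ) * (phase hbar ω t n * star (singletElement X t n n))

theorem sum_sum_mul_star (R A C : Matrix (Fin 2 × Fin 2) (Fin 2 × Fin 2) ℂ)
    (hC : C.conjTranspose = C) (i k : Fin 2 × Fin 2) :
    ∑ j, ∑ l, R j l * A i j * star (C k l) = (A * R * C) i k := by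
  simp only [Matrix.mul_apply, Finset.sum_mul]
  rw [Finset.sum_comm]
  refine Finset.sum_congr rfl fun l _ => Finset.sum_congr rfl fun j _ => ?_
  have : star (C k l) = C l k := by rw [← Matrix.conjTranspose_apply, hC]
  rw [this]
  ring

namespace IsPropagator

variable {hbar β : ℝ} {ω g : Fin N → ℝ} {a : ℂ} {X : ℝ → TotalSpace N →L[ℂ] TotalSpace N}

theorem norm_coherence_term_le (hX : IsPropagator hbar (hamiltonian hbar ω g (a • singlet)) X)
    (hhbar : 0 < hbar) (hβ : 0 < β) (hω : ∀ i, 0 < ω i) (t : ℝ) (n : Fin N → ℕ) :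
    ‖(thermalWeight hbar β ω n : ℂ) * (phase hbar ω t n * star (singletElement X t n n))‖ ≤
      thermalWeight hbar β ω n := by
  have hw := (thermalWeight_pos hhbar hβ hω n).le
  rw [norm_mul, norm_mul, norm_phase, norm_star, one_mul, Complex.norm_real,
    Real.norm_of_nonneg hw]
  exact mul_le_of_le_one_right hw (hX.norm_singletElement_le t n n)

theorem hasSum_coherence (hX : IsPropagator hbar (hamiltonian hbar ω g (a • singlet)) X)
    (hhbar : 0 < hbar) (hβ : 0 < β) (hω : ∀ i, 0 < ω i) (t : ℝ) :
    HasSum (fun n => (thermalWeight hbar β ω n : ℂ) *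
      (phase hbar ω t n * star (singletElement X t n n))) (coherence hbar β ω X t) :=
  (Summable.of_norm_bounded (hasSum_thermalWeight hhbar hβ hω).summable
    (hX.norm_coherence_term_le hhbar hβ hω t)).hasSum

theorem norm_coherence_le (hX : IsPropagator hbar (hamiltonian hbar ω g (a • singlet)) X)
    (hhbar : 0 < hbar) (hβ : 0 < β) (hω : ∀ i, 0 < ω i) (t : ℝ) :
    ‖coherence hbar β ω X t‖ ≤ 1 :=
  tsum_of_norm_bounded (hasSum_thermalWeight hhbar hβ hω)
    (hX.norm_coherence_term_le hhbar hβ hω t)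

/-- Summing over final occupation numbers first gives the thermal weights. The terms are
nonnegative, so the order may be exchanged, as the trace over E requires. -/
theorem hasSum_weight_mul_norm_sq
    (hX : IsPropagator hbar (hamiltonian hbar ω g (a • singlet)) X)
    (hhbar : 0 < hbar) (hβ : 0 < β) (hω : ∀ i, 0 < ω i) (t : ℝ) :
    HasSum (fun p : (Fin N → ℕ) × (Fin N → ℕ) =>
      thermalWeight hbar β ω p.2 * ‖singletElement X t p.1 p.2‖ ^ 2) 1 := by
  have h1 : ∀ n, HasSum (fun m => thermalWeight hbar β ω n * ‖singletElement X t m n‖ ^ 2)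
      (thermalWeight hbar β ω n) := fun n => by
    simpa using (hX.hasSum_norm_singletElement_sq t n).mul_left (thermalWeight hbar β ω n)
  have h2 : Summable fun p : (Fin N → ℕ) × (Fin N → ℕ) =>
      thermalWeight hbar β ω p.1 * ‖singletElement X t p.2 p.1‖ ^ 2 := by
    refine (summable_prod_of_nonneg fun p =>
      mul_nonneg (thermalWeight_pos hhbar hβ hω _).le (sq_nonneg _)).2
      ⟨fun n => (h1 n).summable, ?_⟩
    simp only [(h1 _).tsum_eq]
    exact (hasSum_thermalWeight hhbar hβ hω).summable
  have h3 := h2.hasSum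
  rw [(h2.hasSum.prod_fiberwise h1).unique (hasSum_thermalWeight hhbar hβ hω)] at h3
  exact (Equiv.prodComm _ _).hasSum_iff.1 h3

theorem evolvedElement_eq (hX : IsPropagator hbar (hamiltonian hbar ω g (a • singlet)) X)
    (hhbar : 0 < hbar) (hβ : 0 < β) (hω : ∀ i, 0 < ω i) (t : ℝ)
    (R : Matrix (Fin 2 × Fin 2) (Fin 2 × Fin 2) ℂ) (i k : Fin 2 × Fin 2) (m : Fin N → ℕ) :
    evolvedElement hbar β ω X t R (i, m) (k, m) =
      ((1 - singlet) * R * (1 - singlet)) i k * (thermalWeight hbar β ω m : ℂ) +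
      ((1 - singlet) * R * singlet) i k * ((thermalWeight hbar β ω m : ℂ) *
        (phase hbar ω t m * star (singletElement X t m m))) +
      (singlet * R * (1 - singlet)) i k * star ((thermalWeight hbar β ω m : ℂ) *
        (phase hbar ω t m * star (singletElement X t m m))) +
      (singlet * R * singlet) i k *
        ((∑' n, thermalWeight hbar β ω n * ‖singletElement X t m n‖ ^ 2 : ℝ) : ℂ) := by
  have hP : (1 - singlet).conjTranspose = 1 - singlet := by
    rw [Matrix.conjTranspose_sub, Matrix.conjTranspose_one, conjTranspose_singlet]
  have hQ := conjTranspose_singlet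
  -- R is split into four blocks by Q. In every block with a factor 1 - Q the free motion is
  -- diagonal, so only n = m contributes; the singlet block keeps the whole sum.
  have hterm : ∀ n, (thermalWeight hbar β ω n : ℂ) *
      ∑ j, ∑ l, R j l * inner ℂ (ket (i, m)) (X t (ket (j, n))) *
        star (inner ℂ (ket (k, m)) (X t (ket (l, n)))) =
      (if n = m then ((1 - singlet) * R * (1 - singlet)) i k * (thermalWeight hbar β ω m : ℂ) +
      ((1 - singlet) * R * singlet) i k * ((thermalWeight hbar β ω m : ℂ) *
        (phase hbar ω t m * star (singletElement X t m m))) +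
      (singlet * R * (1 - singlet)) i k * star ((thermalWeight hbar β ω m : ℂ) *
        (phase hbar ω t m * star (singletElement X t m m))) else 0) +
      (singlet * R * singlet) i k *
        ((thermalWeight hbar β ω n * ‖singletElement X t m n‖ ^ 2 : ℝ) : ℂ) := by
    intro n
    set d : ℂ := if m = n then phase hbar ω t n else 0 with hd
    set s := singletElement X t m n with hs
    have e1 : ∑ j, ∑ l, R j l * inner ℂ (ket (i, m)) (X t (ket (j, n))) *
        star (inner ℂ (ket (k, m)) (X t (ket (l, n)))) =
        ((1 - singlet) * R * (1 - singlet)) i k * (d * star d) +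
        ((1 - singlet) * R * singlet) i k * (d * star s) +
        (singlet * R * (1 - singlet)) i k * (s * star d) +
        (singlet * R * singlet) i k * (s * star s) := by
      simp only [hX.inner_ket_apply_ket]
      rw [← sum_sum_mul_star _ _ _ hP, ← sum_sum_mul_star _ _ _ hQ, ← sum_sum_mul_star _ _ _ hP,
        ← sum_sum_mul_star _ _ _ hQ]
      simp only [Finset.sum_mul, ← Finset.sum_add_distrib]
      refine Finset.sum_congr rfl fun j _ => Finset.sum_congr rfl fun l _ => ?_
      rw [star_add, star_mul', star_mul', ← hd, ← hs]
      ring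
    have e2 : s * star s = ((‖s‖ ^ 2 : ℝ) : ℂ) := by
      push_cast
      exact Complex.mul_conj' s
    rw [e1, e2]
    by_cases h : n = m
    · subst h
      have e3 : d * star d = 1 := by
        rw [hd, if_pos rfl]
        have := Complex.mul_conj' (phase hbar ω t n)
        rw [norm_phase] at this
        simpa using this
      rw [if_pos rfl, e3, hd, if_pos rfl]
      simp only [star_mul', ← hs, Complex.star_def, Complex.conj_ofReal,
        Complex.conj_conj]
      push_cast
      ring
    · rw [if_neg h, hd, if_neg (Ne.symm h)]
      push_cast
      simp
      ring
  rw [evolvedElement]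
  simp only [hterm]
  have hsum := (hX.hasSum_weight_mul_norm_sq hhbar hβ hω t).summable.prod_factor m
  have h1 := (hasSum_ite_eq m (((1 - singlet) * R * (1 - singlet)) i k *
      (thermalWeight hbar β ω m : ℂ) +
      ((1 - singlet) * R * singlet) i k * ((thermalWeight hbar β ω m : ℂ) *
        (phase hbar ω t m * star (singletElement X t m m))) +
      (singlet * R * (1 - singlet)) i k * star ((thermalWeight hbar β ω m : ℂ) *
        (phase hbar ω t m * star (singletElement X t m m))))).add
    ((Complex.hasSum_ofReal.2 hsum.hasSum).mul_left ((singlet * R * singlet) i k))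
  exact h1.tsum_eq

/-- Tracing out E leaves the two diagonal blocks unchanged and multiplies the off-diagonal ones by
the coherence and its conjugate. -/
theorem hasSum_evolvedElement (hX : IsPropagator hbar (hamiltonian hbar ω g (a • singlet)) X)
    (hhbar : 0 < hbar) (hβ : 0 < β) (hω : ∀ i, 0 < ω i) (t : ℝ)
    (R : Matrix (Fin 2 × Fin 2) (Fin 2 × Fin 2) ℂ) (i k : Fin 2 × Fin 2) :
    HasSum (fun m => evolvedElement hbar β ω X t R (i, m) (k, m))
      (((1 - singlet) * R * (1 - singlet)) i k +
      ((1 - singlet) * R * singlet) i k * coherence hbar β ω X t +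
      (singlet * R * (1 - singlet)) i k * star (coherence hbar β ω X t) +
      (singlet * R * singlet) i k) := by
  simp only [hX.evolvedElement_eq hhbar hβ hω]
  have h1 := Complex.hasSum_ofReal.2 (hasSum_thermalWeight hhbar hβ hω)
  have h2 := hX.hasSum_coherence hhbar hβ hω t
  have h3 := hX.hasSum_weight_mul_norm_sq hhbar hβ hω t
  have h4 := Complex.hasSum_ofReal.2
    (h3.prod_fiberwise fun m => (h3.summable.prod_factor m).hasSum)
  have h5 := (((h1.mul_left (((1 - singlet) * R * (1 - singlet)) i k)).add
    (h2.mul_left (((1 - singlet) * R * singlet) i k))).add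
    (h2.star.mul_left ((singlet * R * (1 - singlet)) i k))).add
    (h4.mul_left ((singlet * R * singlet) i k))
  simpa using h5

end IsPropagator

/-- The swap of the two qubits. -/
def swap : Matrix (Fin 2 × Fin 2) (Fin 2 × Fin 2) ℂ :=
  Matrix.of fun x y => if x.1 = y.2 ∧ x.2 = y.1 then 1 else 0

theorem singlet_eq : singlet = (1 / 2 : ℂ) • (1 - swap) := by
  have h := inv_sqrt_two_mul_self
  ext ⟨i, j⟩ ⟨k, l⟩
  rw [singlet_apply]
  fin_cases i <;> fin_cases j <;> fin_cases k <;> fin_cases l <;>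
    simp [bell, swap, Prod.ext_iff] <;>
    linear_combination h

theorem swap_mul_apply (R : Matrix (Fin 2 × Fin 2) (Fin 2 × Fin 2) ℂ) (x y : Fin 2 × Fin 2) :
    (swap * R) x y = R (x.2, x.1) y := by
  rw [Matrix.mul_apply, Finset.sum_eq_single (x.2, x.1)]
  · simp [swap]
  · intro b _ hb
    have : ¬(x.1 = b.2 ∧ x.2 = b.1) := fun h => hb (Prod.ext h.2.symm h.1.symm)
    simp [swap, this]
  · simp

theorem mul_swap_apply (R : Matrix (Fin 2 × Fin 2) (Fin 2 × Fin 2) ℂ) (x y : Fin 2 × Fin 2) :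
    (R * swap) x y = R x (y.2, y.1) := by
  rw [Matrix.mul_apply, Finset.sum_eq_single (y.2, y.1)]
  · simp [swap]
  · intro b _ hb
    have : ¬(b.1 = y.2 ∧ b.2 = y.1) := fun h => hb (Prod.ext h.1 h.2)
    simp [swap, this]
  · simp

/-- The reduced dynamics in closed form. -/
theorem IsPropagator.reducedState_eq {hbar β : ℝ} {ω g : Fin N → ℝ} {a : ℂ}
    {X : ℝ → TotalSpace N →L[ℂ] TotalSpace N}
    (hX : IsPropagator hbar (hamiltonian hbar ω g (a • singlet)) X)
    (hhbar : 0 < hbar) (hβ : 0 < β) (hω : ∀ i, 0 < ω i) (t : ℝ)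
    {ρP ρS : Matrix (Fin 2) (Fin 2) ℂ} (hP : ρP.trace = 1) (hS : ρS.trace = 1) :
    reducedState hbar β ω X t ρP ρS =
      ((1 + (coherence hbar β ω X t).re : ℝ) / 2 : ℂ) • ρS +
      ((1 - (coherence hbar β ω X t).re : ℝ) / 2 : ℂ) • ρP +
      (Complex.I * (coherence hbar β ω X t).im / 2) • (ρP * ρS - ρS * ρP) := by
  obtain ⟨r, d, hγ⟩ : ∃ r d : ℝ, coherence hbar β ω X t = r + d * Complex.I :=
    ⟨_, _, (Complex.re_add_im _).symm⟩
  have hγ' : star (coherence hbar β ω X t) = r - d * Complex.I := by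
    rw [hγ]; simp [sub_eq_add_neg]
  have hre : (coherence hbar β ω X t).re = r := by rw [hγ]; simp
  have him : (coherence hbar β ω X t).im = d := by rw [hγ]; simp
  rw [Matrix.trace, Fin.sum_univ_two] at hP hS
  simp only [Matrix.diag_apply] at hP hS
  rw [hre, him]
  ext b c
  rw [reducedState, Matrix.of_apply]
  simp only [(hX.hasSum_evolvedElement hhbar hβ hω t _ _ _).tsum_eq]
  rw [hγ', hγ, singlet_eq]
  have e : (1 : Matrix (Fin 2 × Fin 2) (Fin 2 × Fin 2) ℂ) - (1 / 2 : ℂ) • (1 - swap) =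
      (1 / 2 : ℂ) • (1 + swap) := by module
  rw [e]
  -- With W the swap, Q = (1 - W)/2. The partial trace over P sends R = ρ_S ⊗ ρ_P to ρ_S, W R W to
  -- ρ_P, W R to ρ_P ρ_S and R W to ρ_S ρ_P; the first two use trace 1.
  simp only [Matrix.smul_mul, Matrix.mul_smul, Matrix.add_mul, Matrix.mul_add, Matrix.sub_mul,
    Matrix.mul_sub, Matrix.one_mul, Matrix.mul_one, Matrix.add_apply, Matrix.sub_apply,
    Matrix.smul_apply, swap_mul_apply, mul_swap_apply, Matrix.kronecker_apply, Fin.sum_univ_two]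
  simp only [Matrix.mul_apply, Fin.sum_univ_two, smul_eq_mul]
  push_cast
  linear_combination ((1 + r) / 2 * ρS b c) * hP + ((1 - r) / 2 * ρP b c) * hS

/-! ### The coherence at a common period and at small times -/

theorem sum_phase_eq {hbar : ℝ} {ω g : Fin N → ℝ} (hhbar : hbar ≠ 0) (hω : ∀ i, ω i ≠ 0)
    {a : ℝ} (ha : a ≠ 0) {t : ℝ} {k₁ : ℤ} {k₂ : Fin N → ℤ}
    (ht : ∀ i, ω i * t = 2 * (k₂ i : ℝ) * Real.pi)
    (hk : 1 / a ^ 2 = 2 / (2 * (k₁ : ℝ) + 1) * ∑ i, (k₂ i : ℝ) * (g i / (hbar * ω i)) ^ 2) :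
    ∑ i, (a * g i / hbar) ^ 2 / ω i * t = (2 * k₁ + 1) * Real.pi := by
  have h1 : (2 * (k₁ : ℝ) + 1) ≠ 0 := by
    have : 2 * k₁ + 1 ≠ 0 := by omega
    exact_mod_cast this
  have h2 : a ^ 2 * (2 * ∑ i, (k₂ i : ℝ) * (g i / (hbar * ω i)) ^ 2) = 2 * k₁ + 1 := by
    generalize ∑ i, (k₂ i : ℝ) * (g i / (hbar * ω i)) ^ 2 = S at hk
    field_simp at hk
    linarith
  rw [← h2, Finset.mul_sum, Finset.mul_sum, Finset.sum_mul]
  refine Finset.sum_congr rfl fun i _ => ?_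
  have h3 := hω i
  have h4 : t = 2 * (k₂ i : ℝ) * Real.pi / ω i := by rw [← ht i]; field_simp
  rw [h4]
  field_simp

theorem exp_odd_mul_pi (k : ℤ) :
    Complex.exp (Complex.I * (((2 * k + 1) * Real.pi : ℝ) : ℂ)) = -1 := by
  have : Complex.I * (((2 * k + 1) * Real.pi : ℝ) : ℂ) =
      k * (2 * Real.pi * Complex.I) + Real.pi * Complex.I := by push_cast; ring
  rw [this, Complex.exp_add, Complex.exp_int_mul_two_pi_mul_I, Complex.exp_pi_mul_I, one_mul]

namespace IsPropagator

variable {hbar β : ℝ} {ω g : Fin N → ℝ} {a : ℝ} {X : ℝ → TotalSpace N →L[ℂ] TotalSpace N}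

theorem coherence_of_period
    (hX : IsPropagator hbar (hamiltonian hbar ω g ((a : ℂ) • singlet)) X)
    (hhbar : 0 < hbar) (hβ : 0 < β) (hω : ∀ i, 0 < ω i) (ha : a ≠ 0) {t : ℝ} {k₁ : ℤ}
    {k₂ : Fin N → ℤ} (ht : ∀ i, ω i * t = 2 * (k₂ i : ℝ) * Real.pi)
    (hk : 1 / a ^ 2 = 2 / (2 * (k₁ : ℝ) + 1) * ∑ i, (k₂ i : ℝ) * (g i / (hbar * ω i)) ^ 2) :
    coherence hbar β ω X t = -1 := by
  have hω' : ∀ i, ω i ≠ 0 := fun i => (hω i).ne'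
  have h0 : ((a : ℂ) • singlet).mulVec (bell 0) = (0 : ℂ) • bell 0 := by
    rw [Matrix.smul_mulVec, singlet_mulVec_bell]; simp
  have h0' : singlet.mulVec (bell 0) = 0 := by rw [singlet_mulVec_bell]; simp
  have h3 : ((a : ℂ) • singlet).mulVec (bell 3) = (a : ℂ) • bell 3 := by
    rw [Matrix.smul_mulVec, singlet_mulVec_bell]; simp
  -- The spurious `0 * g i` makes this literally the case of coupling eigenvalue 0 of the formula at
  -- a common period.
  set c₀ := Complex.exp (-Complex.I * ∑ i, ((ω i : ℂ) / 2 - (0 * g i / hbar) ^ 2 / ω i) * t) with hc₀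
  -- Two expressions for the motion of the same uncoupled vector are compared, which shows that the
  -- phase does not depend on n.
  have hphase : ∀ n, phase hbar ω t n = c₀ := by
    intro n
    have h := hX.apply_prodKet_of_period hhbar.ne' hω' h0 ht n
    rw [hX.apply_prodKet_of_singlet_mulVec h0'] at h
    refine smul_left_injective ℂ (m := incl (prodKet (bell 0) n)) ?_ h
    rw [← norm_ne_zero_iff, norm_prodKet_bell]
    exact one_ne_zero
  have hc₀n : c₀ * star c₀ = 1 := by
    have h1 : ‖c₀‖ = 1 := by rw [← hphase 0, norm_phase]
    have h2 := Complex.mul_conj' c₀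
    rw [h1] at h2
    simpa using h2
  have hc : Complex.exp (-Complex.I * ∑ i, ((ω i : ℂ) / 2 - (a * g i / hbar) ^ 2 / ω i) * t) =
      -c₀ := by
    have h1 : -Complex.I * ∑ i, ((ω i : ℂ) / 2 - (a * g i / hbar) ^ 2 / ω i) * t =
        -Complex.I * ∑ i, ((ω i : ℂ) / 2 - (0 * g i / hbar) ^ 2 / ω i) * t +
          Complex.I * ((∑ i, (a * g i / hbar) ^ 2 / ω i * t : ℝ) : ℂ) := by
      push_cast
      rw [neg_mul, neg_mul, ← mul_neg, ← mul_neg, ← mul_add]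
      congr 1
      rw [← Finset.sum_neg_distrib, ← Finset.sum_neg_distrib, ← Finset.sum_add_distrib]
      exact Finset.sum_congr rfl fun i _ => by ring
    rw [h1, sum_phase_eq hhbar.ne' hω' ha ht hk, Complex.exp_add, exp_odd_mul_pi, mul_neg_one]
  have hel : ∀ n, singletElement X t n n = -c₀ := by
    intro n
    rw [singletElement, hX.apply_prodKet_of_period hhbar.ne' hω' h3 ht n, hc, inner_smul_right,
      inner_prodKet, if_pos rfl, bell_orthonormal, if_pos rfl, mul_one]
  have h1 := Complex.hasSum_ofReal.2 (hasSum_thermalWeight hhbar hβ hω)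
  refine ((h1.mul_right (-1)).congr_fun fun n => ?_).tsum_eq.trans (by simp)
  rw [hphase, hel, star_neg, mul_neg, hc₀n]

/-- Before any positive time the singlet component of the oscillator ground state has left the
free motion. -/
theorem exists_coherence_re_lt_one
    (hX : IsPropagator hbar (hamiltonian hbar ω g ((a : ℂ) • singlet)) X)
    (hhbar : 0 < hbar) (hβ : 0 < β) (hω : ∀ i, 0 < ω i) (ha : a ≠ 0) {i : Fin N} (hg : g i ≠ 0)
    {T : ℝ} (hT : 0 < T) : ∃ t ∈ Set.Icc 0 T, (coherence hbar β ω X t).re < 1 := by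
  by_contra hcon
  push Not at hcon
  set v := prodKet (bell 3) (0 : Fin N → ℕ) with hv
  have h3 : ((a : ℂ) • singlet).mulVec (bell 3) = (a : ℂ) • bell 3 := by
    rw [Matrix.smul_mulVec, singlet_mulVec_bell]; simp
  -- Each term of the coherence is bounded by its thermal weight, so a real part of at least 1
  -- forces equality in every term. The vacuum has positive weight; its two evolved unit vectors
  -- then have overlap of real part 1 and coincide.
  have hstat : ∀ t ∈ Set.Icc 0 T, X t (incl v) = phase hbar ω t 0 • incl v := by
    intro t ht
    have hw := hasSum_thermalWeight hhbar hβ hω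
    have h1 := hw.sub (Complex.hasSum_re (hX.hasSum_coherence hhbar hβ hω t))
    have hterm : ∀ n, 0 ≤ thermalWeight hbar β ω n - ((thermalWeight hbar β ω n : ℂ) *
        (phase hbar ω t n * star (singletElement X t n n))).re := fun n =>
      sub_nonneg.2 ((Complex.re_le_norm _).trans (hX.norm_coherence_term_le hhbar hβ hω t n))
    have h2 : 1 - (coherence hbar β ω X t).re = 0 :=
      le_antisymm (sub_nonpos.2 (hcon t ht)) (h1.nonneg hterm)
    rw [h2] at h1
    have h4 := congrFun ((hasSum_zero_iff_of_nonneg hterm).1 h1) 0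
    simp only [Pi.zero_apply, Complex.re_ofReal_mul] at h4
    have hw0 := (thermalWeight_pos hhbar hβ hω (0 : Fin N → ℕ)).ne'
    have h5 : (phase hbar ω t 0 * star (singletElement X t 0 0)).re = 1 := by
      have : thermalWeight hbar β ω 0 *
          (1 - (phase hbar ω t 0 * star (singletElement X t 0 0)).re) = 0 := by linarith
      have := (mul_eq_zero.1 this).resolve_left hw0
      linarith
    rw [← sub_eq_zero, ← norm_eq_zero, ← sq_eq_zero_iff]
    rw [@norm_sub_sq ℂ, hX.norm_apply, norm_smul, norm_phase, hv, norm_prodKet_bell,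
      inner_smul_right, ← inner_conj_symm, ← singletElement]
    have : RCLike.re (phase hbar ω t 0 * (starRingEnd ℂ) (singletElement X t 0 0)) = (1 : ℝ) := h5
    rw [this]
    norm_num
  have hd1 : HasDerivWithinAt (fun t => X t (incl v))
      (incl (generator hbar (hamiltonian hbar ω g ((a : ℂ) • singlet)) v)) (Set.Ioi 0) 0 := by
    have := hX.hasDerivAt_apply 0 v
    rw [hX.map_zero] at this
    exact this.hasDerivWithinAt
  have hd2 : HasDerivWithinAt (fun t : ℝ => phase hbar ω t (0 : Fin N → ℕ) • incl v)
      ((-Complex.I / hbar * (energy hbar ω (0 : Fin N → ℕ) : ℂ)) • incl v) (Set.Ioi 0) 0 := by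
    have := (hasDerivAt_exp_mul_ofReal
      (-Complex.I / hbar * (energy hbar ω (0 : Fin N → ℕ) : ℂ)) 0).smul_const (incl v)
    rw [Complex.ofReal_zero, mul_zero, Complex.exp_zero, one_mul] at this
    exact this.hasDerivWithinAt
  -- Stationarity is known only for t in [0, T], hence the one-sided derivatives.
  have hd3 := hd2.congr_of_eventuallyEq (f₁ := fun t => X t (incl v))
    (by
      filter_upwards [Ioo_mem_nhdsGT hT] with t ht
      exact hstat t ⟨ht.1.le, ht.2.le⟩)
    (hstat 0 ⟨le_rfl, hT.le⟩)
  have heq := (uniqueDiffWithinAt_Ioi (0 : ℝ)).eq_deriv _ hd1 hd3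
  -- At z = 0 and M = 0 the partial sum is the singlet with the vacuum, and the generator adds the
  -- one-quantum term Σ μ_j b_j†.
  have hgen := generator_expPartial_succ (N := N) hhbar.ne' ω g h3 (fun _ => rfl) 0 0
  simp only [expPartial, zero_add, Finset.sum_range_one, Finset.sum_range_zero, expTerm_zero,
    smul_zero, add_zero, ← hv] at hgen
  rw [hgen] at heq
  have hne : (Pi.single i 1 : Fin N → ℕ) ≠ 0 := by
    intro h
    simpa using congrFun h i
  -- Tested against the singlet with one quantum in mode i, the true derivative gives -i μ_i and the
  -- stationary one gives 0.
  have hin := congrArg (fun ψ => inner ℂ (incl (prodKet (bell 3) (Pi.single i 1))) ψ) heq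
  have hupd : ∀ j : Fin N, Function.update (0 : Fin N → ℕ) j 1 = Pi.single j 1 := fun j => rfl
  have hsingle : ∀ j, (Pi.single i 1 : Fin N → ℕ) = Pi.single j 1 ↔ j = i := by
    intro j
    constructor
    · intro h
      by_contra hij
      have := congrFun h i
      rw [Pi.single_eq_same, Pi.single_eq_of_ne (Ne.symm hij)] at this
      exact one_ne_zero this
    · rintro rfl; rfl
  simp only [map_smul, _root_.map_add, inner_smul_right, inner_add_right, hv, modeCreation_apply,
    map_sum, inner_sum, creation_prodKet, Pi.zero_apply, zero_add, hupd, inner_prodKet, hne,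
    hsingle, bell_orthonormal, if_true, if_false, mul_zero] at hin
  have hh : (hbar : ℂ) ≠ 0 := by exact_mod_cast hhbar.ne'
  have ha' : (a : ℂ) ≠ 0 := by exact_mod_cast ha
  have hg' : (g i : ℂ) ≠ 0 := by exact_mod_cast hg
  simp [hh, ha', hg'] at hin

end IsPropagator

/-! ### Density matrices and coherence vectors -/

/-- The matrix `(1 + s · σ) / 2` with coherence vector `s`. -/
def ofBloch (s : Fin 3 → ℝ) : Matrix (Fin 2) (Fin 2) ℂ :=
  !![(1 + s 2 : ℂ) / 2, (s 0 - Complex.I * s 1) / 2; (s 0 + Complex.I * s 1) / 2, (1 - s 2 : ℂ) / 2]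

theorem bloch_ofBloch (s : Fin 3 → ℝ) : bloch (ofBloch s) = s := by
  ext k
  fin_cases k <;>
    simp [bloch, ofBloch, pauli, Matrix.trace, Fin.sum_univ_two] <;> ring

theorem trace_ofBloch (s : Fin 3 → ℝ) : (ofBloch s).trace = 1 := by
  simp [ofBloch, Matrix.trace, Fin.sum_univ_two]
  ring

theorem ofBloch_bloch {ρ : Matrix (Fin 2) (Fin 2) ℂ} (hρ : ρ.IsHermitian) (ht : ρ.trace = 1) :
    ofBloch (bloch ρ) = ρ := by
  rw [Matrix.trace, Fin.sum_univ_two] at ht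
  have h00 := congrArg Complex.im (hρ.apply 0 0)
  have h11 := congrArg Complex.im (hρ.apply 1 1)
  have h01r := congrArg Complex.re (hρ.apply 0 1)
  have h01i := congrArg Complex.im (hρ.apply 0 1)
  have htr := congrArg Complex.re ht
  simp only [Matrix.diag_apply, Complex.add_re, Complex.one_re, Complex.star_def, Complex.conj_re,
    Complex.conj_im] at h00 h11 h01r h01i htr
  ext i j
  apply Complex.ext <;> fin_cases i <;> fin_cases j <;>
    simp [bloch, ofBloch, pauli, Matrix.trace, Matrix.mul_apply, Fin.sum_univ_two] <;> linarith

theorem det_ofBloch (s : Fin 3 → ℝ) : (ofBloch s).det = (((1 - s ⬝ᵥ s) / 4 : ℝ) : ℂ) := by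
  rw [ofBloch, Matrix.det_fin_two_of, dotProduct, Fin.sum_univ_three]
  push_cast
  linear_combination ((s 1 : ℂ) ^ 2 / 4) * Complex.I_sq

/-- Cayley–Hamilton at trace 1 gives ρ = ρ†ρ + det ρ · 1, which is positive when the determinant is
nonnegative. -/
theorem ofBloch_mem {s : Fin 3 → ℝ} (hs : s ∈ blochBall) : ofBloch s ∈ densityMatrices := by
  refine ⟨?_, trace_ofBloch s⟩
  have h : ofBloch s = (ofBloch s).conjTranspose * ofBloch s +
      (((1 - s ⬝ᵥ s) / 4 : ℝ) : ℂ) • (1 : Matrix (Fin 2) (Fin 2) ℂ) := by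
    have hI := Complex.I_sq
    have h2 : (starRingEnd ℂ) 2 = 2 := map_ofNat _ 2
    rw [dotProduct, Fin.sum_univ_three]
    ext i j
    fin_cases i <;> fin_cases j <;>
      simp [ofBloch, Matrix.mul_apply, Fin.sum_univ_two, h2] <;>
      first
        | ring1
        | linear_combination (-(s 1 : ℂ) ^ 2 / 4) * hI
        | linear_combination ((s 1 : ℂ) ^ 2 / 4) * hI
  rw [h]
  refine (Matrix.posSemidef_conjTranspose_mul_self _).add (Matrix.PosSemidef.one.smul ?_)
  have : s ⬝ᵥ s ≤ 1 := hs
  exact_mod_cast (by linarith : (0 : ℝ) ≤ (1 - s ⬝ᵥ s) / 4)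

theorem bloch_mem {ρ : Matrix (Fin 2) (Fin 2) ℂ} (hρ : ρ ∈ densityMatrices) :
    bloch ρ ∈ blochBall := by
  have h := hρ.1.det_nonneg
  rw [← ofBloch_bloch hρ.1.isHermitian hρ.2, det_ofBloch] at h
  have h' : (0 : ℝ) ≤ (1 - bloch ρ ⬝ᵥ bloch ρ) / 4 := by exact_mod_cast h
  show bloch ρ ⬝ᵥ bloch ρ ≤ 1
  linarith

theorem eq_ofBloch {ρ : Matrix (Fin 2) (Fin 2) ℂ} (hρ : ρ ∈ densityMatrices) :
    ofBloch (bloch ρ) = ρ :=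
  ofBloch_bloch hρ.1.isHermitian hρ.2

theorem bloch_image_densityMatrices : bloch '' densityMatrices = blochBall := by
  ext s
  constructor
  · rintro ⟨ρ, hρ, rfl⟩
    exact bloch_mem hρ
  · exact fun hs => ⟨ofBloch s, ofBloch_mem hs, bloch_ofBloch s⟩

theorem continuous_bloch : Continuous bloch := by
  refine continuous_pi fun k => Complex.continuous_re.comp ?_
  exact (continuous_id.matrix_mul continuous_const).matrix_trace

/-! ### The reduced dynamics of coherence vectors -/

/-- The linear part of the reduced dynamics of coherence vectors at coherence `r + i d`. -/
def flowMatrix (r d : ℝ) (s : Fin 3 → ℝ) : Matrix (Fin 3) (Fin 3) ℝ :=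
  (1 / 2 : ℝ) • !![1 - r, -d * s 2, d * s 1; d * s 2, 1 - r, -d * s 0; -d * s 1, d * s 0, 1 - r]

/-- The motion of coherence vectors at coherence `r + i d`. -/
def flow (r d : ℝ) (s p : Fin 3 → ℝ) : Fin 3 → ℝ :=
  (flowMatrix r d s).mulVec p + ((1 + r) / 2) • s

/-- The matrix is half of (1 - r) · 1 plus d times the cross product with s. -/
theorem det_flowMatrix (r d : ℝ) (s : Fin 3 → ℝ) :
    (flowMatrix r d s).det = (1 - r) * ((1 - r) ^ 2 + d ^ 2 * s ⬝ᵥ s) / 8 := by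
  rw [flowMatrix, Matrix.det_smul, Matrix.det_fin_three]
  simp [dotProduct, Fin.sum_univ_three]
  ring

theorem ofBloch_flow (r d : ℝ) (s p : Fin 3 → ℝ) :
    ofBloch (flow r d s p) = ((1 + r : ℝ) / 2 : ℂ) • ofBloch s + ((1 - r : ℝ) / 2 : ℂ) • ofBloch p +
      (Complex.I * d / 2) • (ofBloch p * ofBloch s - ofBloch s * ofBloch p) := by
  apply Matrix.ext
  intro i j
  apply Complex.ext <;> fin_cases i <;> fin_cases j <;>
    simp [flow, flowMatrix, ofBloch, dotProduct, Fin.sum_univ_three] <;>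
    first | ring1 | exact Or.inl (by ring1) | exact Or.inr (by ring1)

/-- By Lagrange's identity |s × p|² = |s|²|p|² - (s·p)². After d² ≤ 1 - r², |s| ≤ 1 and |p| ≤ 1 the
claim reduces to 2x - x² ≤ 1 for x = s·p. This ensures that reachable matrices are states. -/
theorem flow_mem {r d : ℝ} (hrd : r ^ 2 + d ^ 2 ≤ 1) {s p : Fin 3 → ℝ} (hs : s ∈ blochBall)
    (hp : p ∈ blochBall) : flow r d s p ∈ blochBall := by
  have hS : s ⬝ᵥ s ≤ 1 := hs
  have hP : p ⬝ᵥ p ≤ 1 := hp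
  have hS0 : 0 ≤ s ⬝ᵥ s := by
    rw [dotProduct, Fin.sum_univ_three]
    nlinarith [mul_self_nonneg (s 0), mul_self_nonneg (s 1), mul_self_nonneg (s 2)]
  have hP0 : 0 ≤ p ⬝ᵥ p := by
    rw [dotProduct, Fin.sum_univ_three]
    nlinarith [mul_self_nonneg (p 0), mul_self_nonneg (p 1), mul_self_nonneg (p 2)]
  have hC : 0 ≤ (s ⬝ᵥ s) * (p ⬝ᵥ p) - (s ⬝ᵥ p) ^ 2 := by
    have : (s ⬝ᵥ s) * (p ⬝ᵥ p) - (s ⬝ᵥ p) ^ 2 = (s 0 * p 1 - s 1 * p 0) ^ 2 +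
        (s 1 * p 2 - s 2 * p 1) ^ 2 + (s 2 * p 0 - s 0 * p 2) ^ 2 := by
      simp only [dotProduct, Fin.sum_univ_three]
      ring
    rw [this]
    positivity
  have hF : flow r d s p ⬝ᵥ flow r d s p = ((1 + r) ^ 2 * (s ⬝ᵥ s) + (1 - r) ^ 2 * (p ⬝ᵥ p) +
      2 * (1 - r ^ 2) * (s ⬝ᵥ p) + d ^ 2 * ((s ⬝ᵥ s) * (p ⬝ᵥ p) - (s ⬝ᵥ p) ^ 2)) / 4 := by
    simp [flow, flowMatrix, dotProduct, Fin.sum_univ_three]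
    ring
  show flow r d s p ⬝ᵥ flow r d s p ≤ 1
  rw [hF]
  generalize s ⬝ᵥ s = S at *
  generalize p ⬝ᵥ p = P at *
  generalize s ⬝ᵥ p = x at *
  have h1 : d ^ 2 * (S * P - x ^ 2) ≤ (1 - r ^ 2) * (S * P - x ^ 2) :=
    mul_le_mul_of_nonneg_right (by linarith) hC
  have h2 : (1 + r) ^ 2 * S ≤ (1 + r) ^ 2 := mul_le_of_le_one_right (sq_nonneg _) hS
  have h3 : (1 - r) ^ 2 * P ≤ (1 - r) ^ 2 := mul_le_of_le_one_right (sq_nonneg _) hP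
  have h4 : S * P ≤ 1 := mul_le_one₀ hS hP0 hP
  have hr : 0 ≤ 1 - r ^ 2 := by nlinarith [sq_nonneg d]
  have h5 : (1 - r ^ 2) * (S * P - x ^ 2 + 2 * x) ≤ (1 - r ^ 2) * 2 :=
    mul_le_mul_of_nonneg_left (by nlinarith [sq_nonneg (x - 1)]) hr
  nlinarith

namespace IsPropagator

variable {hbar β : ℝ} {ω g : Fin N → ℝ} {a : ℝ} {X : ℝ → TotalSpace N →L[ℂ] TotalSpace N}

theorem reducedState_ofBloch
    (hX : IsPropagator hbar (hamiltonian hbar ω g ((a : ℂ) • singlet)) X)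
    (hhbar : 0 < hbar) (hβ : 0 < β) (hω : ∀ i, 0 < ω i) (t : ℝ) (s p : Fin 3 → ℝ) :
    reducedState hbar β ω X t (ofBloch p) (ofBloch s) =
      ofBloch (flow (coherence hbar β ω X t).re (coherence hbar β ω X t).im s p) := by
  rw [hX.reducedState_eq hhbar hβ hω t (trace_ofBloch p) (trace_ofBloch s), ofBloch_flow]

theorem reducedState_mem (hX : IsPropagator hbar (hamiltonian hbar ω g ((a : ℂ) • singlet)) X)
    (hhbar : 0 < hbar) (hβ : 0 < β) (hω : ∀ i, 0 < ω i) (t : ℝ)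
    {ρP ρS : Matrix (Fin 2) (Fin 2) ℂ} (hP : ρP ∈ densityMatrices) (hS : ρS ∈ densityMatrices) :
    reducedState hbar β ω X t ρP ρS ∈ densityMatrices := by
  rw [← eq_ofBloch hP, ← eq_ofBloch hS, hX.reducedState_ofBloch hhbar hβ hω]
  refine ofBloch_mem (flow_mem ?_ (bloch_mem hS) (bloch_mem hP))
  have h := hX.norm_coherence_le hhbar hβ hω t
  have h2 := Complex.sq_norm (coherence hbar β ω X t)
  rw [Complex.normSq_apply] at h2
  nlinarith [norm_nonneg (coherence hbar β ω X t)]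

theorem reducedState_of_coherence
    (hX : IsPropagator hbar (hamiltonian hbar ω g ((a : ℂ) • singlet)) X)
    (hhbar : 0 < hbar) (hβ : 0 < β) (hω : ∀ i, 0 < ω i) {t : ℝ}
    (ht : coherence hbar β ω X t = -1) {ρP ρS : Matrix (Fin 2) (Fin 2) ℂ}
    (hP : ρP ∈ densityMatrices) (hS : ρS ∈ densityMatrices) :
    reducedState hbar β ω X t ρP ρS = ρP := by
  rw [hX.reducedState_eq hhbar hβ hω t hP.2 hS.2, ht]
  norm_num

theorem reachableAt_of_coherence
    (hX : IsPropagator hbar (hamiltonian hbar ω g ((a : ℂ) • singlet)) X)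
    (hhbar : 0 < hbar) (hβ : 0 < β) (hω : ∀ i, 0 < ω i) {t : ℝ}
    (ht : coherence hbar β ω X t = -1) {ρS : Matrix (Fin 2) (Fin 2) ℂ}
    (hS : ρS ∈ densityMatrices) :
    reachableAt (reducedState hbar β ω X) densityMatrices ρS t = densityMatrices := by
  ext σ
  constructor
  · rintro ⟨ρP, hP, rfl⟩
    rwa [hX.reducedState_of_coherence hhbar hβ hω ht hP hS]
  · exact fun hσ => ⟨σ, hσ, (hX.reducedState_of_coherence hhbar hβ hω ht hσ hS).symm⟩

theorem isControllable_of_coherence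
    (hX : IsPropagator hbar (hamiltonian hbar ω g ((a : ℂ) • singlet)) X)
    (hhbar : 0 < hbar) (hβ : 0 < β) (hω : ∀ i, 0 < ω i) {t : ℝ} (ht0 : 0 ≤ t)
    (ht : coherence hbar β ω X t = -1) :
    IsControllable densityMatrices (reducedState hbar β ω X) densityMatrices := by
  intro ρS hS
  ext σ
  simp only [reachable, reachableUntil, Set.mem_iUnion]
  constructor
  · rintro ⟨T, s, -, ρP, hP, rfl⟩
    exact hX.reducedState_mem hhbar hβ hω s hP hS
  · intro hσ
    refine ⟨t, t, ⟨ht0, le_rfl⟩, ?_⟩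
    rwa [hX.reachableAt_of_coherence hhbar hβ hω ht hS]

theorem isAccessible
    (hX : IsPropagator hbar (hamiltonian hbar ω g ((a : ℂ) • singlet)) X)
    (hhbar : 0 < hbar) (hβ : 0 < β) (hω : ∀ i, 0 < ω i) (ha : a ≠ 0) {i : Fin N} (hg : g i ≠ 0) :
    IsAccessible densityMatrices (reducedState hbar β ω X) densityMatrices := by
  intro T hT ρS hS
  obtain ⟨t, ht, hlt⟩ := hX.exists_coherence_re_lt_one hhbar hβ hω ha hg hT
  set r := (coherence hbar β ω X t).re with hr
  set d := (coherence hbar β ω X t).im with hd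
  set s := bloch ρS with hs
  set A := flowMatrix r d s with hA
  have hdet : IsUnit A.det := by
    rw [isUnit_iff_ne_zero, hA, det_flowMatrix]
    have h1 : 0 < 1 - r := by linarith
    have h2 : 0 ≤ s ⬝ᵥ s := by
      rw [dotProduct]
      exact Finset.sum_nonneg fun i _ => mul_self_nonneg _
    positivity
  -- `F` inverts the flow in p. It is defined and continuous on all matrices, so the preimage of the
  -- open ball is open there and relatively open among the states.
  set F : Matrix (Fin 2) (Fin 2) ℂ → Fin 3 → ℝ := fun σ =>
    A⁻¹.mulVec (bloch σ - ((1 + r) / 2) • s) with hF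
  have hFc : Continuous F :=
    continuous_const.matrix_mulVec (continuous_bloch.sub continuous_const)
  have hflow : ∀ σ, flow r d s (F σ) = bloch σ := by
    intro σ
    rw [flow, hF, ← hA, Matrix.mulVec_mulVec, Matrix.mul_nonsing_inv _ hdet, Matrix.one_mulVec,
      sub_add_cancel]
  have hSρ : ofBloch s = ρS := eq_ofBloch hS
  refine ⟨{σ | F σ ⬝ᵥ F σ < 1}, isOpen_lt (hFc.dotProduct hFc) continuous_const, ?_, ?_⟩
  · have h0 : (0 : Fin 3 → ℝ) ∈ blochBall := by simp [blochBall]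
    refine ⟨reducedState hbar β ω X t (ofBloch 0) ρS, ?_,
      hX.reducedState_mem hhbar hβ hω t (ofBloch_mem h0) hS⟩
    have h1 : F (reducedState hbar β ω X t (ofBloch 0) ρS) = 0 := by
      rw [← hSρ, hX.reducedState_ofBloch hhbar hβ hω, hF]
      simp [bloch_ofBloch, flow, ← hr, ← hd]
    simp [h1]
  · rintro σ ⟨hσ, hσP⟩
    have hσ' : F σ ⬝ᵥ F σ < 1 := hσ
    have hb : F σ ∈ blochBall := hσ'.le
    refine Set.mem_biUnion ht ⟨ofBloch (F σ), ofBloch_mem hb, ?_⟩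
    rw [← hSρ, hX.reducedState_ofBloch hhbar hβ hω, ← hr, ← hd, hflow, eq_ofBloch hσP]

end IsPropagator

/-! ### The coefficients of the dynamics at a common period -/

theorem dampingF_of_period (hbar β : ℝ) {ω : Fin N → ℝ} (g : Fin N → ℝ) {t : ℝ} {k : Fin N → ℤ}
    (ht : ∀ i, ω i * t = 2 * (k i : ℝ) * Real.pi) : dampingF hbar β ω g t = 0 := by
  refine Finset.sum_eq_zero fun i _ => ?_
  rw [ht, show 2 * (k i : ℝ) * Real.pi = k i * (2 * Real.pi) by ring, Real.cos_int_mul_two_pi]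
  ring

theorem sq_mul_phasePhi_of_period {hbar : ℝ} {ω g : Fin N → ℝ} (hhbar : hbar ≠ 0)
    (hω : ∀ i, ω i ≠ 0) (a : ℝ) {t : ℝ} {k : Fin N → ℤ}
    (ht : ∀ i, ω i * t = 2 * (k i : ℝ) * Real.pi) :
    a ^ 2 * phasePhi hbar ω g t = ∑ i, (a * g i / hbar) ^ 2 / ω i * t := by
  rw [phasePhi, Finset.mul_sum]
  refine Finset.sum_congr rfl fun i _ => ?_
  have h : Real.sin (ω i * t) = 0 := by
    rw [ht, show 2 * (k i : ℝ) * Real.pi = (2 * k i : ℤ) * Real.pi by push_cast; ring,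
      Real.sin_int_mul_pi]
  have := hω i
  rw [h]
  field_simp
  ring

/-- At the period f = 0, so γ_ij = 1 off the singlet and γ_i4 = -1. Every sum in A and a vanishes,
and every difference is ±2. -/
theorem blochA_blochShift_of_period {hbar β : ℝ} {ω g : Fin N → ℝ} (hhbar : hbar ≠ 0)
    (hω : ∀ i, ω i ≠ 0) {a : ℝ} (ha : a ≠ 0) {t : ℝ} {k₁ : ℤ} {k₂ : Fin N → ℤ}
    (ht : ∀ i, ω i * t = 2 * (k₂ i : ℝ) * Real.pi)
    (hk : 1 / a ^ 2 = 2 / (2 * (k₁ : ℝ) + 1) * ∑ i, (k₂ i : ℝ) * (g i / (hbar * ω i)) ^ 2)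
    (s : Fin 3 → ℝ) :
    blochA hbar β ω g ![0, 0, 0, a] t s = 1 ∧ blochShift hbar β ω g ![0, 0, 0, a] t s = 0 := by
  have hf := dampingF_of_period hbar β g ht
  have hφ := (sq_mul_phasePhi_of_period hhbar hω a ht).trans (sum_phase_eq hhbar hω ha ht hk)
  have h1 : ∀ i j : Fin 4, i ≠ 3 → j ≠ 3 → gam hbar β ω g ![0, 0, 0, a] t i j = 1 := by
    intro i j hi hj
    have h0 : ∀ l : Fin 4, l ≠ 3 → (![0, 0, 0, a] : Fin 4 → ℝ) l = 0 := by
      intro l hl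
      fin_cases l <;> simp_all
    simp [gam, h0 i hi, h0 j hj]
  have h2 : ∀ i : Fin 4, i ≠ 3 → gam hbar β ω g ![0, 0, 0, a] t i 3 = -1 := by
    intro i hi
    have h0 : (![0, 0, 0, a] : Fin 4 → ℝ) i = 0 := by
      fin_cases i <;> simp_all
    have h3 : (![0, 0, 0, a] : Fin 4 → ℝ) 3 = a := rfl
    -- The phase has the sign of -α₄², and -(2k₁ + 1) = 2(-k₁ - 1) + 1 is again odd.
    rw [gam, hf, h0, h3, show ((0 : ℝ) ^ 2 - a ^ 2) * phasePhi hbar ω g t =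
      (2 * ((-k₁ - 1 : ℤ) : ℝ) + 1) * Real.pi by push_cast; linarith, mul_zero, Complex.ofReal_zero,
      zero_add, exp_odd_mul_pi]
  have e1 := h1 0 2 (by decide) (by decide)
  have e2 := h1 1 2 (by decide) (by decide)
  have e3 := h1 0 1 (by decide) (by decide)
  have e4 := h2 0 (by decide)
  have e5 := h2 1 (by decide)
  have e6 := h2 2 (by decide)
  constructor
  · ext i j
    simp only [blochA, e1, e2, e3, e4, e5, e6]
    fin_cases i <;> fin_cases j <;> simp <;> norm_num
  · ext i
    simp only [blochShift, e1, e2, e3, e4, e5, e6]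
    fin_cases i <;> simp

/-- The propagator exists. -/
theorem exists_isPropagator_hamiltonian {hbar : ℝ} (hhbar : 0 < hbar) (ω g : Fin N → ℝ) (a : ℝ) :
    ∃ X, IsPropagator hbar (hamiltonian hbar ω g ((a : ℂ) • singlet)) X := by
  have hQ : ∀ v : FiniteVec N, ‖incl (actT singlet v)‖ ≤ ‖incl v‖ :=
    norm_le_of_symmetric_idempotent
      (fun v w => by rw [inner_actT_left, conjTranspose_singlet])
      (fun v => by rw [actT_actT, singlet_mul_singlet])
  have hB : ((a : ℂ) • singlet).conjTranspose = (a : ℂ) • singlet := by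
    rw [Matrix.conjTranspose_smul, conjTranspose_singlet, Complex.star_def, Complex.conj_ofReal]
  have hD : ∀ v : FiniteVec N, ‖incl (actT ((a : ℂ) • singlet) v)‖ ≤ |a| * ‖incl v‖ := fun v => by
    rw [actT_smul, map_smul, norm_smul, Complex.norm_real, Real.norm_eq_abs]
    gcongr
    exact hQ v
  set C := ∑ i, |hbar * ω i| * 2 + ∑ i, |g i| * (|a| * 2) with hC
  have hC0 : 0 ≤ C := by positivity
  -- C may be 0, whereas a radius of convergence ħ / C needs a positive constant; hence C + 1.
  refine exists_isPropagator hhbar (hamiltonian_symmetric hbar ω g hB) (C := C + 1) (by positivity)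
    (hamiltonian_mem_degreeLE hbar ω g _) fun k v hv => ?_
  refine (norm_hamiltonian_le hD k v hv).trans ?_
  have hC1 : C ≤ C + 1 := by linarith
  exact mul_le_mul_of_nonneg_right (mul_le_mul_of_nonneg_right hC1 (by positivity)) (norm_nonneg _)

end EnvControl

end

theorem mainTheorem2 (N : ℕ) (hbar β : ℝ) (ω g : Fin N → ℝ)
    (hhbar : 0 < hbar) (hβ : 0 < β) (hω : ∀ i, 0 < ω i)
    (α₄ : ℝ) (hα₄ : α₄ ≠ 0) (tHat : ℝ) (k₁ : ℤ) (k₂ : Fin N → ℤ)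
    (htHat : ∀ i, ω i * tHat = 2 * (k₂ i : ℝ) * Real.pi)
    (ha4 : 1 / α₄ ^ 2 =
      2 / (2 * (k₁ : ℝ) + 1) * ∑ i, (k₂ i : ℝ) * (g i / (hbar * ω i)) ^ 2) :
    -- the Hamiltonian determines one propagator
    (∃! X, EnvControl.IsPropagator hbar
      (EnvControl.hamiltonian hbar ω g (EnvControl.couplingOp ![0, 0, 0, α₄])) X) ∧
    ∀ X, EnvControl.IsPropagator hbar
      (EnvControl.hamiltonian hbar ω g (EnvControl.couplingOp ![0, 0, 0, α₄])) X →
      -- `A(tHat, s) = 1` and `a(tHat, s) = 0`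
      (∀ s ∈ EnvControl.blochBall,
        EnvControl.blochA hbar β ω g ![0, 0, 0, α₄] tHat s = 1 ∧
        EnvControl.blochShift hbar β ω g ![0, 0, 0, α₄] tHat s = 0) ∧
      -- `A` and `a` describe the dynamics at `tHat`
      (∀ ρS ∈ EnvControl.densityMatrices, ∀ ρP ∈ EnvControl.densityMatrices,
        EnvControl.bloch (EnvControl.reducedState hbar β ω X tHat ρP ρS) =
          (EnvControl.blochA hbar β ω g ![0, 0, 0, α₄] tHat (EnvControl.bloch ρS)).mulVec
            (EnvControl.bloch ρP) +
          EnvControl.blochShift hbar β ω g ![0, 0, 0, α₄] tHat (EnvControl.bloch ρS)) ∧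
      -- the reachable set at `tHat` is the set of all states, that is, the whole Bloch ball
      (∀ ρS ∈ EnvControl.densityMatrices,
        EnvControl.reachableAt (EnvControl.reducedState hbar β ω X)
          EnvControl.densityMatrices ρS tHat = EnvControl.densityMatrices ∧
        EnvControl.bloch '' EnvControl.reachableAt (EnvControl.reducedState hbar β ω X)
          EnvControl.densityMatrices ρS tHat = EnvControl.blochBall) ∧
      -- controllability and accessibility
      EnvControl.IsControllable EnvControl.densityMatrices
        (EnvControl.reducedState hbar β ω X) EnvControl.densityMatrices ∧
      EnvControl.IsAccessible EnvControl.densityMatrices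
        (EnvControl.reducedState hbar β ω X) EnvControl.densityMatrices := by
  have hω' : ∀ i, ω i ≠ 0 := fun i => (hω i).ne'
  have hhbar' : hbar ≠ 0 := hhbar.ne'
  rw [EnvControl.couplingOp_singlet]
  have hBell : ∀ i, ((α₄ : ℂ) • EnvControl.singlet).mulVec (EnvControl.bell i) =
      ((α₄ : ℂ) * if i = 3 then 1 else 0) • EnvControl.bell i := fun i => by
    rw [Matrix.smul_mulVec, EnvControl.singlet_mulVec_bell, smul_smul]
  refine ⟨?_, fun X hX => ?_⟩
  · obtain ⟨X, hX⟩ := EnvControl.exists_isPropagator_hamiltonian hhbar ω g α₄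
    exact ⟨X, hX, fun Y hY => EnvControl.IsPropagator.unique hhbar' hω' hBell hY hX⟩
  have hcoh : EnvControl.coherence hbar β ω X tHat = -1 :=
    hX.coherence_of_period hhbar hβ hω hα₄ htHat ha4
  have hAa := EnvControl.blochA_blochShift_of_period (β := β) hhbar' hω' hα₄ htHat ha4
  refine ⟨fun s _ => hAa s, fun ρS hS ρP hP => ?_, fun ρS hS => ?_, ?_, ?_⟩
  · rw [(hAa _).1, (hAa _).2, Matrix.one_mulVec, add_zero,
      hX.reducedState_of_coherence hhbar hβ hω hcoh hP hS]
  · have h := hX.reachableAt_of_coherence hhbar hβ hω hcoh hS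
    exact ⟨h, by rw [h, EnvControl.bloch_image_densityMatrices]⟩
  -- t̂ may be negative, but reachability counts only t ≥ 0. Then -t̂ satisfies the same hypotheses
  -- with -k₂ and -k₁ - 1: both 2k₁ + 1 and the sum change sign.
  · rcases le_total 0 tHat with ht | ht
    · exact hX.isControllable_of_coherence hhbar hβ hω ht hcoh
    · refine hX.isControllable_of_coherence hhbar hβ hω (neg_nonneg.2 ht)
        (hX.coherence_of_period hhbar hβ hω hα₄ (k₁ := -k₁ - 1) (k₂ := fun i => -k₂ i)
          (fun i => ?_) ?_)
      · rw [mul_neg, htHat]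
        push_cast
        ring
      · rw [ha4]
        push_cast
        simp only [neg_mul, Finset.sum_neg_distrib]
        rw [show 2 * (-(k₁ : ℝ) - 1) + 1 = -(2 * (k₁ : ℝ) + 1) by ring, div_neg, neg_mul_neg]
  -- If all couplings vanished, the condition on α₄ would read 1 / α₄² = 0.
  · obtain ⟨i, hg⟩ : ∃ i, g i ≠ 0 := by
      by_contra hcon
      push Not at hcon
      have h0 : 1 / α₄ ^ 2 = 0 := by rw [ha4]; simp [hcon]
      exact (one_div_ne_zero (pow_ne_zero 2 hα₄)) h0
    exact hX.isAccessible hhbar hβ hω hα₄ hg
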